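/- Let $M$ be a connected smooth manifold of dimension $2n+1$ with a normal almost contact metric structure $(\phi,\xi,\eta,g)$, that is, $\phi^2=-I+\eta\otimes\xi$, $\eta\circ\phi=0$, $\phi\xi=0$, $\eta(\xi)=1$, $g(\phi X,\phi Y)=g(X,Y)-\eta(X)\eta(Y)$, and $$\phi^2[X,Y]+[\phi X,\phi Y]-\phi[\phi X,Y]-\phi[X,\phi Y]+2\,d\eta(X,Y)\,\xi=0$$ for all vector fields $X,Y$. Assume that $M$ is $f$-cosymplectic, that is, $f$ is a smooth function on $M$ with $df\wedge\eta=0$, $d\eta=0$ and $d\omega=2f\,\eta\wedge\omega$, where $\omega(X,Y)=g(\phi X,Y)$. Assume that $g$ is a gradient Ricci soliton, that is, there are a smooth function $F$ on $M$ and a constant $\lambda$ with $\frac12\mathcal L_{DF}g+\mathrm{Ric}-\lambda g=0$, where $DF$ is the gradient of $F$. Put $\widetilde f=\xi(f)+f^2$ and assume that $\xi(\widetilde f)=0$. Then at least one of the following holds: 1. $f\equiv0$ (the structure is cosymplectic) and $M$ is locally the product of a Kähler manifold and an interval (equivalently, locally, of a Kähler manifold and an interval or a circle $S^1$): every point has an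 open neighbourhood diffeomorphic to $K\times(a,b)$, where $(K,J,g_K)$ is a Kähler manifold of real dimension $2n$, in such a way that $g$ corresponds to $g_K+dt^2$, $\xi$ to $\partial/\partial t$, and $\phi$ to $J$ on $TK$ and to $0$ on $\partial/\partial t$; 2. $M$ is Einstein, and its Ricci operator is $Q=-2n\widetilde f\,\mathrm{Id}$. -/

import Mathlib

open scoped Manifold ContDiff Bundle
open Bundle Set

noncomputable section

namespace FCosymplectic

/-- Euclidean coordinate space of dimension `m`. -/
abbrev Coord (m : ℕ) := EuclideanSpace ℝ (Fin m)

/-! ## Tensor calculus on open subsets of a coordinate space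

A Riemannian metric on an open subset of `Coord m` is given by its component function
`G : Coord m → (Coord m →L[ℝ] Coord m →L[ℝ] ℝ)`; similarly for vector fields, one-forms and
endomorphism fields.  Everything below is evaluated only at points of the open set in question. -/

section Local

variable {m : ℕ}

/-- The Christoffel symbol `Γ(u, v)` of the Levi-Civita connection of `G`: the vector with
`G(Γ(u, v), w) = (1/2) (D_u G(v, w) + D_v G(u, w) - D_w G(u, v))` for all `w`. -/
def christoffel (G : Coord m → (Coord m →L[ℝ] Coord m →L[ℝ] ℝ)) (y u v : Coord m) : Coord m :=
  (G y).inverse ((1 / 2 : ℝ) •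
    (fderiv ℝ G y u v + fderiv ℝ G y v u - ((fderiv ℝ G y).flip u).flip v))

/-- The Levi-Civita covariant derivative `∇_X Y` of vector fields. -/
def cov (G : Coord m → (Coord m →L[ℝ] Coord m →L[ℝ] ℝ)) (X Y : Coord m → Coord m)
    (y : Coord m) : Coord m :=
  fderiv ℝ Y y (X y) + christoffel G y (X y) (Y y)

/-- The curvature `R(X, Y)Z = ∇_X ∇_Y Z - ∇_Y ∇_X Z - ∇_[X,Y] Z`. -/
def curvature (G : Coord m → (Coord m →L[ℝ] Coord m →L[ℝ] ℝ)) (X Y Z : Coord m → Coord m)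
    (y : Coord m) : Coord m :=
  cov G X (cov G Y Z) y - cov G Y (cov G X Z) y - cov G (VectorField.lieBracket ℝ X Y) Z y

/-- The Ricci tensor `Ric(u, v)` at `y`: the trace of `w ↦ R(w, u)v`.  The curvature being a
tensor, it is evaluated on the constant extensions of the vectors involved. -/
def ricci (G : Coord m → (Coord m →L[ℝ] Coord m →L[ℝ] ℝ)) (y u v : Coord m) : ℝ :=
  ∑ i : Fin m,
    (curvature G (fun _ => EuclideanSpace.single i (1 : ℝ)) (fun _ => u) (fun _ => v) y) i

/-- The Lie derivative `(L_V G)(u, v)` of the metric along the vector field `V`. -/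
def lieDerivMetric (G : Coord m → (Coord m →L[ℝ] Coord m →L[ℝ] ℝ)) (V : Coord m → Coord m)
    (y u v : Coord m) : ℝ :=
  fderiv ℝ G y (V y) u v + G y (fderiv ℝ V y u) v + G y u (fderiv ℝ V y v)

/-- The exterior derivative of a one-form: `dα(u, v) = D_u α(v) - D_v α(u)`. -/
def dOne (α : Coord m → (Coord m →L[ℝ] ℝ)) (y u v : Coord m) : ℝ :=
  fderiv ℝ α y u v - fderiv ℝ α y v u

/-- The exterior derivative of a two-form:
`dθ(u, v, w) = D_u θ(v, w) + D_v θ(w, u) + D_w θ(u, v)`. -/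
def dTwo (θ : Coord m → Coord m → Coord m → ℝ) (y u v w : Coord m) : ℝ :=
  fderiv ℝ (fun z => θ z v w) y u + fderiv ℝ (fun z => θ z w u) y v +
    fderiv ℝ (fun z => θ z u v) y w

/-- The wedge product of a one-form and a two-form (at a point), normalised as `dTwo`:
`(α ∧ θ)(u, v, w) = α(u) θ(v, w) + α(v) θ(w, u) + α(w) θ(u, v)`. -/
def wedgeOneTwo (α : Coord m → ℝ) (θ : Coord m → Coord m → ℝ) (u v w : Coord m) : ℝ :=
  α u * θ v w + α v * θ w u + α w * θ u v

/-- The form `ω(u, v) = G(Φ u, v)` of a metric and an endomorphism field. -/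
def fundamentalForm (G : Coord m → (Coord m →L[ℝ] Coord m →L[ℝ] ℝ))
    (Φ : Coord m → (Coord m →L[ℝ] Coord m)) (y u v : Coord m) : ℝ :=
  G y (Φ y u) v

/-- The Nijenhuis torsion `Φ²[X, Y] + [ΦX, ΦY] - Φ[ΦX, Y] - Φ[X, ΦY]`. -/
def nijenhuis (Φ : Coord m → (Coord m →L[ℝ] Coord m)) (X Y : Coord m → Coord m)
    (y : Coord m) : Coord m :=
  Φ y (Φ y (VectorField.lieBracket ℝ X Y y))
    + VectorField.lieBracket ℝ (fun z => Φ z (X z)) (fun z => Φ z (Y z)) y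
    - Φ y (VectorField.lieBracket ℝ (fun z => Φ z (X z)) Y y)
    - Φ y (VectorField.lieBracket ℝ X (fun z => Φ z (Y z)) y)

/-- `(V, G, J)` is a Kähler manifold: `G` is a smooth Riemannian metric on the open set `V`, `J` is
a smooth integrable almost complex structure compatible with `G`, and the form `G(J·, ·)` is
closed. -/
structure IsKahler (V : Set (Coord m)) (G : Coord m → (Coord m →L[ℝ] Coord m →L[ℝ] ℝ))
    (J : Coord m → (Coord m →L[ℝ] Coord m)) : Prop where
  isOpen : IsOpen V
  smooth_metric : ContDiffOn ℝ ∞ G V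
  metric_symm : ∀ y ∈ V, ∀ u v, G y u v = G y v u
  metric_pos : ∀ y ∈ V, ∀ u, u ≠ 0 → 0 < G y u u
  smooth_complex : ContDiffOn ℝ ∞ J V
  complex_sq : ∀ y ∈ V, ∀ u, J y (J y u) = -u
  hermitian : ∀ y ∈ V, ∀ u v, G y (J y u) (J y v) = G y u v
  integrable : ∀ X Y : Coord m → Coord m, ContDiffOn ℝ ∞ X V → ContDiffOn ℝ ∞ Y V →
    ∀ y ∈ V, nijenhuis J X Y y = 0
  closed : ∀ y ∈ V, ∀ u v w, dTwo (fundamentalForm G J) y u v w = 0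

end Local

/-! ## Tensor fields on a manifold and their components in a chart -/

section Charts

variable {m : ℕ} {M : Type*} [TopologicalSpace M] [ChartedSpace (Coord m) M]

/-- The differential of the inverse of the chart `e` at the point `y` of its target. -/
def frame (e : OpenPartialHomeomorph M (Coord m)) (y : Coord m) :
    Coord m →L[ℝ] TangentSpace 𝓘(ℝ, Coord m) (e.symm y) :=
  mfderiv 𝓘(ℝ, Coord m) 𝓘(ℝ, Coord m) e.symm y

/-- The differential of the chart `e` at the point with coordinates `y`. -/
def coframe (e : OpenPartialHomeomorph M (Coord m)) (y : Coord m) :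
    TangentSpace 𝓘(ℝ, Coord m) (e.symm y) →L[ℝ] Coord m :=
  mfderiv 𝓘(ℝ, Coord m) 𝓘(ℝ, Coord m) e (e.symm y)

/-- Components in the chart `e` of a field of bilinear forms. -/
def chartBilin (e : OpenPartialHomeomorph M (Coord m))
    (g : ∀ x : M, TangentSpace 𝓘(ℝ, Coord m) x →L[ℝ] TangentSpace 𝓘(ℝ, Coord m) x →L[ℝ] ℝ)
    (y : Coord m) : Coord m →L[ℝ] Coord m →L[ℝ] ℝ :=
  ((frame e y).precomp ℝ).comp ((g (e.symm y)).comp (frame e y))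

/-- Components in the chart `e` of a vector field. -/
def chartVec (e : OpenPartialHomeomorph M (Coord m))
    (V : ∀ x : M, TangentSpace 𝓘(ℝ, Coord m) x) (y : Coord m) : Coord m :=
  coframe e y (V (e.symm y))

/-- Components in the chart `e` of a one-form. -/
def chartForm (e : OpenPartialHomeomorph M (Coord m))
    (α : ∀ x : M, TangentSpace 𝓘(ℝ, Coord m) x →L[ℝ] ℝ) (y : Coord m) : Coord m →L[ℝ] ℝ :=
  (α (e.symm y)).comp (frame e y)

/-- Components in the chart `e` of an endomorphism field. -/
def chartEnd (e : OpenPartialHomeomorph M (Coord m))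
    (φ : ∀ x : M, TangentSpace 𝓘(ℝ, Coord m) x →L[ℝ] TangentSpace 𝓘(ℝ, Coord m) x)
    (y : Coord m) : Coord m →L[ℝ] Coord m :=
  (coframe e y).comp ((φ (e.symm y)).comp (frame e y))

end Charts

section Manifolds

/-- Smooth Riemannian metrics on a manifold of dimension `m`. -/
abbrev Metric (m : ℕ) (M : Type*) [TopologicalSpace M] [ChartedSpace (Coord m) M]
    [IsManifold 𝓘(ℝ, Coord m) ∞ M] :=
  ContMDiffRiemannianMetric 𝓘(ℝ, Coord m) ∞ (Coord m)
    (fun x : M => TangentSpace 𝓘(ℝ, Coord m) x)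

variable {m : ℕ} {M : Type*} [TopologicalSpace M] [ChartedSpace (Coord m) M]
  [IsManifold 𝓘(ℝ, Coord m) ∞ M]

/-- `Ric = μ g` for the function `μ`; equivalently the Ricci operator `Q`, defined by
`g(Q X, Y) = Ric(X, Y)`, equals `μ Id`. -/
def RicciEqSmul (g : Metric m M) (μ : M → ℝ) : Prop :=
  ∀ e ∈ atlas (Coord m) M, ∀ y ∈ e.target, ∀ u v : Coord m,
    ricci (chartBilin e g.inner) y u v = μ (e.symm y) * chartBilin e g.inner y u v

/-- `g` is an Einstein metric: `Ric = c g` for a constant `c`. -/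
def IsEinstein (g : Metric m M) : Prop :=
  ∃ c : ℝ, RicciEqSmul g (fun _ => c)

/-- `(g, V)` is a Ricci soliton with constant `c`: `(1/2) L_V g + Ric - c g = 0`. -/
def IsRicciSoliton (g : Metric m M) (V : ∀ x : M, TangentSpace 𝓘(ℝ, Coord m) x) (c : ℝ) : Prop :=
  ∀ e ∈ atlas (Coord m) M, ∀ y ∈ e.target, ∀ u v : Coord m,
    (1 / 2 : ℝ) * lieDerivMetric (chartBilin e g.inner) (chartVec e V) y u v
      + ricci (chartBilin e g.inner) y u v - c * chartBilin e g.inner y u v = 0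

/-- `V` is the gradient field of the function `F` with respect to `g`. -/
def IsGradient (g : Metric m M) (F : M → ℝ) (V : ∀ x : M, TangentSpace 𝓘(ℝ, Coord m) x) : Prop :=
  ∀ (x : M) (v : TangentSpace 𝓘(ℝ, Coord m) x),
    g.inner x (V x) v = mvfderiv 𝓘(ℝ, Coord m) F x v

/-- `g` is a gradient Ricci soliton: a Ricci soliton whose potential field is the gradient of a
smooth function. -/
def IsGradientRicciSoliton (g : Metric m M) : Prop :=
  ∃ (F : M → ℝ) (V : ∀ x : M, TangentSpace 𝓘(ℝ, Coord m) x) (c : ℝ),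
    ContMDiff 𝓘(ℝ, Coord m) 𝓘(ℝ, ℝ) ∞ F ∧ IsGradient g F V ∧ IsRicciSoliton g V c

variable (m M) in
/-- An almost contact metric structure `(φ, ξ, η, g)`. -/
structure AlmostContactMetric where
  /-- the Riemannian metric -/
  g : Metric m M
  /-- the structure endomorphism -/
  φ : ∀ x : M, TangentSpace 𝓘(ℝ, Coord m) x →L[ℝ] TangentSpace 𝓘(ℝ, Coord m) x
  /-- the Reeb field -/
  ξ : ∀ x : M, TangentSpace 𝓘(ℝ, Coord m) x
  /-- the contact form -/
  η : ∀ x : M, TangentSpace 𝓘(ℝ, Coord m) x →L[ℝ] ℝ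
  smooth_φ : ContMDiff 𝓘(ℝ, Coord m) (𝓘(ℝ, Coord m).prod 𝓘(ℝ, Coord m →L[ℝ] Coord m)) ∞
    (fun x => TotalSpace.mk' (Coord m →L[ℝ] Coord m)
      (E := fun x : M => TangentSpace 𝓘(ℝ, Coord m) x →L[ℝ] TangentSpace 𝓘(ℝ, Coord m) x) x (φ x))
  smooth_ξ : ContMDiff 𝓘(ℝ, Coord m) (𝓘(ℝ, Coord m).prod 𝓘(ℝ, Coord m)) ∞
    (fun x => TotalSpace.mk' (Coord m)
      (E := fun x : M => TangentSpace 𝓘(ℝ, Coord m) x) x (ξ x))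
  smooth_η : ContMDiff 𝓘(ℝ, Coord m) (𝓘(ℝ, Coord m).prod 𝓘(ℝ, Coord m →L[ℝ] ℝ)) ∞
    (fun x => TotalSpace.mk' (Coord m →L[ℝ] ℝ)
      (E := fun x : M => TangentSpace 𝓘(ℝ, Coord m) x →L[ℝ] Bundle.Trivial M ℝ x) x (η x))
  φ_sq : ∀ x v, φ x (φ x v) = -v + η x v • ξ x
  η_φ : ∀ x v, η x (φ x v) = 0
  φ_ξ : ∀ x, φ x (ξ x) = 0
  η_ξ : ∀ x, η x (ξ x) = 1
  g_φ : ∀ x u v, g.inner x (φ x u) (φ x v) = g.inner x u v - η x u * η x v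

/-- The derivative `ξ(h)` of a function along the Reeb field. -/
def AlmostContactMetric.reebDeriv (S : AlmostContactMetric m M) (h : M → ℝ) (x : M) : ℝ :=
  mvfderiv 𝓘(ℝ, Coord m) h x (S.ξ x)

/-- The function `ξ(f) + f²`. -/
def AlmostContactMetric.fTilde (S : AlmostContactMetric m M) (f : M → ℝ) (x : M) : ℝ :=
  S.reebDeriv f x + f x ^ 2

/-- `S` is normal: the torsion
`φ²[X, Y] + [φX, φY] - φ[φX, Y] - φ[X, φY] + 2 dη(X, Y) ξ` vanishes for all (local) vector fields,
where `2 dη(X, Y)` stands for `X(η(Y)) - Y(η(X)) - η([X, Y])`. -/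
def AlmostContactMetric.IsNormal (S : AlmostContactMetric m M) : Prop :=
  ∀ e ∈ atlas (Coord m) M, ∀ X Y : Coord m → Coord m,
    ContDiffOn ℝ ∞ X e.target → ContDiffOn ℝ ∞ Y e.target → ∀ y ∈ e.target,
      nijenhuis (chartEnd e S.φ) X Y y
        + dOne (chartForm e S.η) y (X y) (Y y) • chartVec e S.ξ y = 0

/-- `S` is an `f`-cosymplectic structure: it is normal, `dη = 0`, `dω = 2 f η ∧ ω` for the
fundamental form `ω(X, Y) = g(φX, Y)`, and `f` is a smooth function with `df ∧ η = 0`. -/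
structure IsFCosymplectic (S : AlmostContactMetric m M) (f : M → ℝ) : Prop where
  smooth_f : ContMDiff 𝓘(ℝ, Coord m) 𝓘(ℝ, ℝ) ∞ f
  df_wedge_η : ∀ (x : M) (u v : TangentSpace 𝓘(ℝ, Coord m) x),
    mvfderiv 𝓘(ℝ, Coord m) f x u * S.η x v - mvfderiv 𝓘(ℝ, Coord m) f x v * S.η x u = 0
  dη : ∀ e ∈ atlas (Coord m) M, ∀ y ∈ e.target, ∀ u v : Coord m,
    dOne (chartForm e S.η) y u v = 0
  dω : ∀ e ∈ atlas (Coord m) M, ∀ y ∈ e.target, ∀ u v w : Coord m,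
    dTwo (fundamentalForm (chartBilin e S.g.inner) (chartEnd e S.φ)) y u v w
      = 2 * f (e.symm y) * wedgeOneTwo (chartForm e S.η y)
          (fundamentalForm (chartBilin e S.g.inner) (chartEnd e S.φ) y) u v w
  normal : S.IsNormal

end Manifolds

/-- `M` is locally the product of a Kähler manifold and an interval: every point has an open
neighbourhood that is diffeomorphic, by some `Ψ`, to `V × (a, b)` with `(V, G, J)` Kähler, in such
a way that the metric of `M` corresponds to `G + dt²`, the field `ξ` to `∂/∂t`, and `φ` to `J` on
the first factor.  The Kähler factor is a coordinate domain, which is no restriction locally; and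
since a circle is locally an interval, this covers local products with a circle as well. -/
def IsLocallyKahlerProduct {n : ℕ} {M : Type*} [TopologicalSpace M]
    [ChartedSpace (Coord (2 * n + 1)) M] [IsManifold 𝓘(ℝ, Coord (2 * n + 1)) ∞ M]
    (S : AlmostContactMetric (2 * n + 1) M) : Prop :=
  ∀ p : M, ∃ (V : Set (Coord (2 * n)))
    (G : Coord (2 * n) → (Coord (2 * n) →L[ℝ] Coord (2 * n) →L[ℝ] ℝ))
    (J : Coord (2 * n) → (Coord (2 * n) →L[ℝ] Coord (2 * n)))
    (a b : ℝ) (Ψ : OpenPartialHomeomorph (Coord (2 * n) × ℝ) M),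
    IsKahler V G J ∧ Ψ.source = V ×ˢ Ioo a b ∧ p ∈ Ψ.target ∧
    ContMDiffOn 𝓘(ℝ, Coord (2 * n) × ℝ) 𝓘(ℝ, Coord (2 * n + 1)) ∞ Ψ Ψ.source ∧
    ContMDiffOn 𝓘(ℝ, Coord (2 * n + 1)) 𝓘(ℝ, Coord (2 * n) × ℝ) ∞ Ψ.symm Ψ.target ∧
    ∀ z ∈ Ψ.source,
      let dΨ : Coord (2 * n) × ℝ → TangentSpace 𝓘(ℝ, Coord (2 * n + 1)) (Ψ z) :=
        mfderiv 𝓘(ℝ, Coord (2 * n) × ℝ) 𝓘(ℝ, Coord (2 * n + 1)) Ψ z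
      (∀ (u v : Coord (2 * n)) (s t : ℝ),
        S.g.inner (Ψ z) (dΨ (u, s)) (dΨ (v, t)) = G z.1 u v + s * t) ∧
      dΨ (0, 1) = S.ξ (Ψ z) ∧
      ∀ (u : Coord (2 * n)) (s : ℝ), S.φ (Ψ z) (dΨ (u, s)) = dΨ (J z.1 u, 0)

end FCosymplectic

end

noncomputable section

namespace FCosymplectic

open Bundle Set
open scoped Manifold ContDiff Bundle

/-! ## Smooth functions -/

section SmoothFunctions

variable {V F H : Type*} [NormedAddCommGroup V] [NormedSpace ℝ V] [NormedAddCommGroup F]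
  [NormedSpace ℝ F] [NormedAddCommGroup H] [NormedSpace ℝ H]

/-! Write `c` for `ξ(f) + f²`, `m = 2n + 1`, and `T = Ric + (m - 1) c g`. From `df ∧ η = 0` and `dη
= 0` the differential of `ξ(f) + f²` is a multiple of `η`; the hypothesis that it is killed by `ξ`
makes it zero, so `c` is constant on the connected manifold (`fTilde_eq`).

Normality gives `L_ξ φ = 0`, and contracting `dω = 2f η ∧ ω` with `ξ` gives `L_ξ ω = 2f ω`; hence
`L_ξ g = 2f (g - η ⊗ η)`. Together with `dη = 0` this is `∇ξ = f (I - η ⊗ ξ)`. All the Ricci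
computations use only this equation and `df = (c - f²) η` (`IsReebOn`). They yield `R(X, Y)ξ = c
(η(X) Y - η(Y) X)`, so `T(ξ, ·) = 0`, and the second Bianchi identity gives `∇_ξ T = -2f T`.
Commuting covariant derivatives in `Hess F = r g - Ric` then produces the central identity
(`soliton_identity`) `f T(u, v) = c (dF(ξ) g(u, v) - dF(u) η(v))`.

If `c ≠ 0`, the choice `v = ξ` shows `dF = k η`, so `T = (μ - f k)(g - η ⊗ η)` with a constant `μ`.
The identity becomes the relation `f (μ - f k) = c k`; differentiating it along `ξ` forces `k = 0`,
then `μ = 0` and `T = 0` (`ric_eq_of_ne_zero`). If `c = 0`, then `f T = 0` and `df = -f² η`, so by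
uniqueness for a linear differential inequality `f` vanishes nowhere or identically
(`eq_zero_or_ne_zero`). In the former case again `T = 0`.

If `f` vanishes identically, the flow of `ξ` preserves `g` and `φ`. Flowing a leaf of `ker η` along
`ξ` gives product coordinates, and the leaf inherits a Kähler structure (`exists_kahler_product`).
The smooth flow is obtained by applying the inverse function theorem in a space of curves. -/

theorem _root_.ContDiffAt.fderiv_infty {g : V → F} {x : V} (h : ContDiffAt ℝ ∞ g x) :
    ContDiffAt ℝ ∞ (fderiv ℝ g) x :=
  h.fderiv_right (m := ∞) (by simp)

theorem _root_.ContDiffAt.differentiableAt_infty {g : V → F} {x : V} (h : ContDiffAt ℝ ∞ g x) :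
    DifferentiableAt ℝ g x :=
  h.differentiableAt (by simp)

theorem _root_.ContDiffAt.fderiv_fderiv_comm {g : V → F} {x : V} (h : ContDiffAt ℝ ∞ g x)
    (u v : V) : fderiv ℝ (fderiv ℝ g) x u v = fderiv ℝ (fderiv ℝ g) x v u := by
  have h2 : ContDiffAt ℝ 2 g x := h.of_le (WithTop.coe_le_coe.2 (le_top : (2 : ℕ∞) ≤ ⊤))
  exact (h2.isSymmSndFDerivAt (by simp)) u v

/-- Derivative of the evaluation of a field of linear maps on a vector field. -/
theorem fderiv_clm_apply_apply {A : V → (F →L[ℝ] H)} {Z : V → F} {x : V}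
    (hA : ContDiffAt ℝ ∞ A x) (hZ : ContDiffAt ℝ ∞ Z x) (w : V) :
    fderiv ℝ (fun y => A y (Z y)) x w = fderiv ℝ A x w (Z x) + A x (fderiv ℝ Z x w) := by
  rw [(hA.differentiableAt_infty.hasFDerivAt.clm_apply
    hZ.differentiableAt_infty.hasFDerivAt).fderiv]
  simp [add_comm]

theorem fderiv_clm_apply_const {A : V → (F →L[ℝ] H)} {x : V} (hA : ContDiffAt ℝ ∞ A x) (z : F)
    (w : V) : fderiv ℝ (fun y => A y z) x w = fderiv ℝ A x w z := by
  rw [fderiv_clm_apply_apply hA contDiffAt_const]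
  simp

theorem contDiffAt_clm_of_apply [FiniteDimensional ℝ F] {A : V → (F →L[ℝ] H)} {x : V}
    {n : ℕ∞ω} (h : ∀ v, ContDiffAt ℝ n (fun y => A y v) x) : ContDiffAt ℝ n A x := by
  let d := Module.finrank ℝ F
  have hd : d = Module.finrank ℝ (Fin d → ℝ) := (Module.finrank_fin_fun ℝ).symm
  let e₁ := ContinuousLinearEquiv.ofFinrankEq hd
  let e₂ := (e₁.arrowCongr (1 : H ≃L[ℝ] H)).trans (ContinuousLinearEquiv.piRing (Fin d))
  rw [← Function.id_comp A, ← e₂.symm_comp_self]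
  exact e₂.symm.contDiff.contDiffAt.comp x (contDiffAt_pi.mpr fun i => h _)

theorem fderiv_eq_of_eqOn {U : Set V} (hU : IsOpen U) {g k : V → F} (h : EqOn g k U) {x : V}
    (hx : x ∈ U) : fderiv ℝ g x = fderiv ℝ k x :=
  Filter.EventuallyEq.fderiv_eq (h.eventuallyEq_of_mem (hU.mem_nhds hx))

end SmoothFunctions

/-! ## Riemannian geometry on open subsets of a coordinate space -/

section Riemannian

variable {m : ℕ} {U : Set (Coord m)} {G : Coord m → (Coord m →L[ℝ] Coord m →L[ℝ] ℝ)} {y : Coord m}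

/-- `G` is a smooth Riemannian metric on the open set `U`. -/
structure IsMetricOn (U : Set (Coord m)) (G : Coord m → (Coord m →L[ℝ] Coord m →L[ℝ] ℝ)) :
    Prop where
  isOpen : IsOpen U
  smooth : ContDiffOn ℝ ∞ G U
  symm : ∀ y ∈ U, ∀ u v, G y u v = G y v u
  pos : ∀ y ∈ U, ∀ u, u ≠ 0 → 0 < G y u u

set_option synthInstance.maxHeartbeats 100000 in
lemma christoffel_add_left (a b u : Coord m) :
    christoffel G y (a + b) u = christoffel G y a u + christoffel G y b u := by
  simp only [christoffel, ← map_add, ← smul_add]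
  congr 2
  ext w
  simp
  ring

set_option synthInstance.maxHeartbeats 100000 in
lemma christoffel_smul_left (r : ℝ) (a u : Coord m) :
    christoffel G y (r • a) u = r • christoffel G y a u := by
  simp only [christoffel, ← map_smul]
  congr 1
  ext w
  simp
  ring

set_option synthInstance.maxHeartbeats 100000 in
lemma christoffel_add_right (a u v : Coord m) :
    christoffel G y a (u + v) = christoffel G y a u + christoffel G y a v := by
  simp only [christoffel, ← map_add, ← smul_add]
  congr 2
  ext w
  simp
  ring

set_option synthInstance.maxHeartbeats 100000 in
lemma christoffel_smul_right (r : ℝ) (a u : Coord m) :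
    christoffel G y a (r • u) = r • christoffel G y a u := by
  simp only [christoffel, ← map_smul]
  congr 1
  ext w
  simp
  ring

/-- The Christoffel symbol `Γ(a, ·)` as a linear map. -/
def chr (G : Coord m → (Coord m →L[ℝ] Coord m →L[ℝ] ℝ)) (y a : Coord m) : Coord m →L[ℝ] Coord m :=
  LinearMap.toContinuousLinearMap
    { toFun := fun u => christoffel G y a u
      map_add' := christoffel_add_right a
      map_smul' := fun r u => christoffel_smul_right r a u }

lemma chr_apply (a u : Coord m) : chr G y a u = christoffel G y a u := rfl

lemma chr_add (a b : Coord m) : chr G y (a + b) = chr G y a + chr G y b := by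
  ext1 u
  exact christoffel_add_left a b u

lemma chr_smul (r : ℝ) (a : Coord m) : chr G y (r • a) = r • chr G y a := by
  ext1 u
  exact christoffel_smul_left r a u

lemma chr_sub (a b : Coord m) : chr G y (a - b) = chr G y a - chr G y b := by
  rw [eq_sub_iff_add_eq, ← chr_add, sub_add_cancel]

namespace IsMetricOn

variable (hG : IsMetricOn U G) (hy : y ∈ U)
include hG hy

lemma contDiffAt : ContDiffAt ℝ ∞ G y :=
  hG.smooth.contDiffAt (hG.isOpen.mem_nhds hy)

lemma contDiffAt_left (u : Coord m) : ContDiffAt ℝ ∞ (fun z => G z u) y :=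
  (hG.contDiffAt hy).clm_apply contDiffAt_const

lemma contDiffAt_apply (u v : Coord m) : ContDiffAt ℝ ∞ (fun z => G z u v) y :=
  (hG.contDiffAt_left hy u).clm_apply contDiffAt_const

lemma ext_left {u v : Coord m} (h : ∀ w, G y u w = G y v w) : u = v := by
  by_contra hne
  have := hG.pos y hy (u - v) (sub_ne_zero.2 hne)
  simp [h] at this

/-- Positivity gives injectivity, and the dimensions agree. Without invertibility the `inverse` in
`christoffel` would take its default value `0`. -/
lemma isInvertible : (G y).IsInvertible := by
  have hfin : Module.finrank ℝ (Coord m) = Module.finrank ℝ (Coord m →L[ℝ] ℝ) := by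
    rw [← (LinearMap.toContinuousLinearMap (𝕜 := ℝ) (E := Coord m) (F' := ℝ)).finrank_eq]
    exact Subspace.dual_finrank_eq.symm
  have hinj : Function.Injective (G y) := fun u v huv => hG.ext_left hy fun w => by rw [huv]
  refine ⟨(LinearEquiv.ofInjectiveOfFinrankEq (G y).toLinearMap hinj
    hfin).toContinuousLinearEquiv, ?_⟩
  ext u v
  rfl

lemma fderiv_apply_apply (u v w : Coord m) :
    fderiv ℝ G y w u v = fderiv ℝ (fun z => G z u v) y w := by
  rw [fderiv_clm_apply_const (hG.contDiffAt_left hy u), fderiv_clm_apply_const (hG.contDiffAt hy)]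

lemma koszul (u v w : Coord m) : G y (chr G y u v) w = (1 / 2) * (fderiv ℝ (fun z => G z v w) y u
    + fderiv ℝ (fun z => G z u w) y v - fderiv ℝ (fun z => G z u v) y w) := by
  rw [chr_apply, christoffel, (hG.isInvertible hy).self_apply_inverse]
  simp [hG.fderiv_apply_apply hy]

lemma fderiv_symm (u v : Coord m) :
    fderiv ℝ (fun z => G z u v) y = fderiv ℝ (fun z => G z v u) y :=
  fderiv_eq_of_eqOn hG.isOpen (fun z hz => hG.symm z hz u v) hy

lemma chr_symm (u v : Coord m) : chr G y u v = chr G y v u := by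
  refine hG.ext_left hy fun w => ?_
  rw [hG.koszul hy, hG.koszul hy, hG.fderiv_symm hy u v]
  ring

/-- Metric compatibility `∇G = 0`: adding two Koszul formulas cancels all but one derivative. -/
lemma fderiv_metric (w u v : Coord m) : fderiv ℝ (fun z => G z u v) y w =
    G y (chr G y w u) v + G y u (chr G y w v) := by
  rw [hG.symm y hy u, hG.koszul hy, hG.koszul hy, hG.fderiv_symm hy v u,
    hG.fderiv_symm hy w v, hG.fderiv_symm hy w u]
  ring

lemma contDiffAt_chr_apply (a u : Coord m) : ContDiffAt ℝ ∞ (fun z => chr G z a u) y := by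
  have hi : ContDiffAt ℝ ∞ (fun z => (G z).inverse) y :=
    ((hG.isInvertible hy).contDiffAt_map_inverse).comp y (hG.contDiffAt hy)
  refine hi.clm_apply (contDiffAt_clm_of_apply fun w => ?_)
  have h : ContDiffAt ℝ ∞ (fun z => (1 / 2 : ℝ) * (fderiv ℝ (fun z => G z u w) z a
      + fderiv ℝ (fun z => G z a w) z u - fderiv ℝ (fun z => G z a u) z w)) y := by
    have hd : ∀ p q r : Coord m, ContDiffAt ℝ ∞ (fun z => fderiv ℝ (fun z => G z p q) z r) y :=
      fun p q r => (hG.contDiffAt_apply hy p q).fderiv_infty.clm_apply contDiffAt_const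
    exact contDiffAt_const.mul (((hd _ _ _).add (hd _ _ _)).sub (hd _ _ _))
  refine h.congr_of_eventuallyEq ?_
  filter_upwards [hG.isOpen.mem_nhds hy] with z hz
  simp [hG.fderiv_apply_apply hz]

lemma contDiffAt_chr (a : Coord m) : ContDiffAt ℝ ∞ (fun z => chr G z a) y :=
  contDiffAt_clm_of_apply fun u => hG.contDiffAt_chr_apply hy a u

end IsMetricOn

/-- The curvature `R(a, u)v` of `G` at `y`. -/
def curv (G : Coord m → (Coord m →L[ℝ] Coord m →L[ℝ] ℝ)) (y a u v : Coord m) : Coord m :=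
  fderiv ℝ (fun z => chr G z u v) y a - fderiv ℝ (fun z => chr G z v) y u a
    + chr G y a (chr G y u v) - chr G y u (chr G y a v)

/-- The curvature operator `a ↦ R(a, u)v`. -/
def curvLin (G : Coord m → (Coord m →L[ℝ] Coord m →L[ℝ] ℝ)) (y u v : Coord m) :
    Coord m →ₗ[ℝ] Coord m where
  toFun a := curv G y a u v
  map_add' a b := by simp [curv, chr_add]; abel
  map_smul' r a := by simp [curv, chr_smul, smul_sub, smul_add]

@[simp] lemma curvLin_apply (a u v : Coord m) : curvLin G y u v a = curv G y a u v := rfl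

lemma curv_smul_left (r : ℝ) (a u v : Coord m) :
    curv G y (r • a) u v = r • curv G y a u v := (curvLin G y u v).map_smul r a

lemma curv_sub_left (a b u v : Coord m) :
    curv G y (a - b) u v = curv G y a u v - curv G y b u v := (curvLin G y u v).map_sub a b

lemma trace_smul_sub (α : Coord m →ₗ[ℝ] ℝ) (u : Coord m) (r s : ℝ) :
    LinearMap.trace ℝ (Coord m) (s • (α.smulRight u - r • LinearMap.id)) = s * (α u - m * r) := by
  rw [map_smul, map_sub, LinearMap.trace_smulRight, map_smul, LinearMap.trace_id]
  simp [mul_comm]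

lemma sum_apply_single_eq_trace (L : Coord m →ₗ[ℝ] Coord m) :
    ∑ i : Fin m, (L (EuclideanSpace.single i 1)) i = LinearMap.trace ℝ (Coord m) L := by
  rw [LinearMap.trace_eq_sum_inner L (EuclideanSpace.basisFun (Fin m) ℝ)]
  simp [EuclideanSpace.inner_single_left]

namespace IsMetricOn

variable (hG : IsMetricOn U G) (hy : y ∈ U)
include hG hy

/-- The definition of `curv` differentiates `Γ(v, ·)` as a linear map, so linearity in `a` needs no
hypothesis on `G`. Symmetry of `Γ` turns it into the usual formula. -/
lemma curv_eq (a u v : Coord m) : curv G y a u v =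
    fderiv ℝ (fun z => chr G z u v) y a - fderiv ℝ (fun z => chr G z a v) y u
      + chr G y a (chr G y u v) - chr G y u (chr G y a v) := by
  rw [curv, ← fderiv_clm_apply_const (hG.contDiffAt_chr hy v) a u,
    fderiv_eq_of_eqOn hG.isOpen (fun z hz => hG.chr_symm hz v a) hy]

lemma curv_antisymm (a u v : Coord m) : curv G y a u v = -curv G y u a v := by
  rw [hG.curv_eq hy, hG.curv_eq hy]; abel

lemma curv_sub_middle (a u u' v : Coord m) :
    curv G y a (u - u') v = curv G y a u v - curv G y a u' v := by
  rw [hG.curv_antisymm hy, curv_sub_left, hG.curv_antisymm hy a u, hG.curv_antisymm hy a u']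
  abel

lemma curv_smul_middle (r : ℝ) (a u v : Coord m) :
    curv G y a (r • u) v = r • curv G y a u v := by
  rw [hG.curv_antisymm hy, curv_smul_left, hG.curv_antisymm hy a u, smul_neg]

lemma curvature_const (a u v : Coord m) :
    curvature G (fun _ => a) (fun _ => u) (fun _ => v) y = curv G y a u v := by
  have h0 : ∀ (p q : Coord m), cov G (fun _ => p) (fun _ => q) = fun z => chr G z p q := by
    intro p q
    ext1 z
    simp [cov, chr_apply]
  have hl : VectorField.lieBracket ℝ (fun _ : Coord m => a) (fun _ => u) = fun _ => 0 := by
    ext1 z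
    simp [VectorField.lieBracket]
  rw [curvature, hl, h0, h0, h0, hG.curv_eq hy]
  simp only [cov, ← chr_apply]
  have : chr G y 0 v = 0 := by simpa using congrArg (fun L => L v) (chr_smul (G := G) (y := y) 0 0)
  rw [this]
  simp
  abel

/-- The Ricci tensor is the trace of the curvature operator. -/
lemma ricci_eq_trace (u v : Coord m) :
    ricci G y u v = LinearMap.trace ℝ (Coord m) (curvLin G y u v) := by
  rw [← sum_apply_single_eq_trace, ricci]
  simp [hG.curvature_const hy]

lemma first_bianchi (a u v : Coord m) :
    curv G y a u v + curv G y u v a + curv G y v a u = 0 := by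
  have h : ∀ p q, fderiv ℝ (fun z => chr G z p q) y = fderiv ℝ (fun z => chr G z q p) y :=
    fun p q => fderiv_eq_of_eqOn hG.isOpen (fun z hz => hG.chr_symm hz p q) hy
  simp only [hG.curv_eq hy]
  rw [h a v, h u v, h u a, hG.chr_symm hy v u, hG.chr_symm hy u a, hG.chr_symm hy v a]
  abel

/-- Product rule for the metric evaluated on a vector field and a constant vector. -/
lemma fderiv_metric_apply {Z : Coord m → Coord m} (hZ : ContDiffAt ℝ ∞ Z y) (p w : Coord m) :
    fderiv ℝ (fun z => G z w (Z z)) y p = G y (chr G y p w) (Z y)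
      + G y w (fderiv ℝ Z y p + chr G y p (Z y)) := by
  rw [fderiv_clm_apply_apply (hG.contDiffAt_left hy w) hZ,
    ← fderiv_clm_apply_const (hG.contDiffAt_left hy w), hG.fderiv_metric hy, map_add]
  ring

/-- Product rule for the Christoffel symbol evaluated on a vector field. -/
lemma fderiv_chr_apply {Z : Coord m → Coord m} (hZ : ContDiffAt ℝ ∞ Z y) (p a : Coord m) :
    fderiv ℝ (fun z => chr G z a (Z z)) y p = fderiv ℝ (fun z => chr G z a (Z y)) y p
      + chr G y a (fderiv ℝ Z y p) := by
  rw [fderiv_clm_apply_apply (hG.contDiffAt_chr hy a) hZ,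
    ← fderiv_clm_apply_const (hG.contDiffAt_chr hy a)]

/-- Metric compatibility applied twice expresses the second derivatives of `G(v, w)` through `Γ`;
their symmetry in `a` and `u` is exactly the skewness of `R(a, u)`. -/
lemma curv_metric_antisymm (a u v w : Coord m) :
    G y (curv G y a u v) w = -G y v (curv G y a u w) := by
  have key : ∀ p q : Coord m, fderiv ℝ (fderiv ℝ (fun z => G z v w)) y p q =
      G y (chr G y p w) (chr G y q v) +
        G y w (fderiv ℝ (fun z => chr G z q v) y p + chr G y p (chr G y q v))
      + (G y (chr G y p v) (chr G y q w) +
        G y v (fderiv ℝ (fun z => chr G z q w) y p + chr G y p (chr G y q w))) := by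
    intro p q
    rw [← fderiv_clm_apply_const (hG.contDiffAt_apply hy v w).fderiv_infty]
    have h1 : EqOn (fun z => fderiv ℝ (fun z => G z v w) z q)
        (fun z => G z w (chr G z q v) + G z v (chr G z q w)) U := by
      intro z hz
      simpa only [hG.symm z hz w] using hG.fderiv_metric hz q v w
    have hs : ∀ b c : Coord m, DifferentiableAt ℝ (fun z => G z b (chr G z q c)) y := fun b c =>
      ((hG.contDiffAt_left hy b).clm_apply (hG.contDiffAt_chr_apply hy q c)).differentiableAt_infty
    rw [fderiv_eq_of_eqOn hG.isOpen h1 hy, fderiv_fun_add (hs w v) (hs v w), add_apply,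
      hG.fderiv_metric_apply hy (hG.contDiffAt_chr_apply hy q v),
      hG.fderiv_metric_apply hy (hG.contDiffAt_chr_apply hy q w)]
  have h := (hG.contDiffAt_apply hy v w).fderiv_fderiv_comm a u
  rw [key, key] at h
  rw [hG.symm y hy _ w, hG.curv_eq hy, hG.curv_eq hy]
  simp only [map_sub, map_add] at h ⊢
  have e1 := hG.symm y hy (chr G y a w) (chr G y u v)
  have e2 := hG.symm y hy (chr G y u w) (chr G y a v)
  linarith

/-- The usual octahedron argument: a combination of the first Bianchi identity for the four cyclic
orders of the arguments, simplified by the two skew-symmetries. -/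
lemma curv_pair_symm (a u v w : Coord m) :
    G y (curv G y a u v) w = G y (curv G y v w a) u := by
  have b : ∀ a u v w, G y (curv G y a u v) w + G y (curv G y u v a) w
      + G y (curv G y v a u) w = 0 := by
    intro a u v w
    have := congrArg (fun L => G y L w) (hG.first_bianchi hy a u v)
    simpa using this
  have s : ∀ a u v w, G y (curv G y a u v) w = -G y (curv G y a u w) v := by
    intro a u v w
    rw [hG.curv_metric_antisymm hy, hG.symm y hy v]
  have t : ∀ a u v w, G y (curv G y a u v) w = -G y (curv G y u a v) w := by
    intro a u v w
    rw [hG.curv_antisymm hy]; simp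
  have e1 := b a u v w
  have e2 := b u v w a
  have e3 := b v w a u
  have e4 := b w a u v
  linarith [s u v a w, s a u w v, s v w u a, s w a v u, t v a u w, s a v u w, t w u v a,
    s u w v a]

lemma contDiffAt_curv (a u v : Coord m) : ContDiffAt ℝ ∞ (fun z => curv G z a u v) y := by
  have hd : ∀ p q r : Coord m, ContDiffAt ℝ ∞ (fun z => fderiv ℝ (fun z => chr G z p q) z r) y :=
    fun p q r => (hG.contDiffAt_chr_apply hy p q).fderiv_infty.clm_apply contDiffAt_const
  have hc : ∀ p q r : Coord m, ContDiffAt ℝ ∞ (fun z => chr G z p (chr G z q r)) y :=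
    fun p q r => (hG.contDiffAt_chr hy p).clm_apply (hG.contDiffAt_chr_apply hy q r)
  refine ContDiffAt.congr_of_eventuallyEq
    ((((hd u v a).sub (hd a v u)).add (hc a u v)).sub (hc u a v)) ?_
  filter_upwards [hG.isOpen.mem_nhds hy] with z hz using hG.curv_eq hz a u v

lemma fderiv_curv (w a u v : Coord m) : fderiv ℝ (fun z => curv G z a u v) y w =
    fderiv ℝ (fderiv ℝ (fun z => chr G z u v)) y w a
    - fderiv ℝ (fderiv ℝ (fun z => chr G z a v)) y w u
    + (fderiv ℝ (fun z => chr G z a (chr G y u v)) y w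
      + chr G y a (fderiv ℝ (fun z => chr G z u v) y w))
    - (fderiv ℝ (fun z => chr G z u (chr G y a v)) y w
      + chr G y u (fderiv ℝ (fun z => chr G z a v) y w)) := by
  have hd : ∀ p q r : Coord m, ContDiffAt ℝ ∞ (fun z => fderiv ℝ (fun z => chr G z p q) z r) y :=
    fun p q r => (hG.contDiffAt_chr_apply hy p q).fderiv_infty.clm_apply contDiffAt_const
  have hc : ∀ p q r : Coord m, ContDiffAt ℝ ∞ (fun z => chr G z p (chr G z q r)) y :=
    fun p q r => (hG.contDiffAt_chr hy p).clm_apply (hG.contDiffAt_chr_apply hy q r)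
  rw [fderiv_eq_of_eqOn hG.isOpen (fun z hz => hG.curv_eq hz a u v) hy,
    fderiv_fun_sub (((hd u v a).sub (hd a v u)).add (hc a u v)).differentiableAt_infty
      (hc u a v).differentiableAt_infty,
    fderiv_fun_add ((hd u v a).sub (hd a v u)).differentiableAt_infty
      (hc a u v).differentiableAt_infty,
    fderiv_fun_sub (hd u v a).differentiableAt_infty (hd a v u).differentiableAt_infty,
    sub_apply, add_apply, sub_apply, hG.fderiv_chr_apply hy (hG.contDiffAt_chr_apply hy u v),
    hG.fderiv_chr_apply hy (hG.contDiffAt_chr_apply hy a v),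
    fderiv_clm_apply_const (hG.contDiffAt_chr_apply hy u v).fderiv_infty,
    fderiv_clm_apply_const (hG.contDiffAt_chr_apply hy a v).fderiv_infty]

/-- The second Bianchi identity. -/
lemma second_bianchi (w a u v : Coord m) :
    (fderiv ℝ (fun z => curv G z a u v) y w + chr G y w (curv G y a u v)
      - curv G y a u (chr G y w v))
    + (fderiv ℝ (fun z => curv G z u w v) y a + chr G y a (curv G y u w v)
      - curv G y u w (chr G y a v))
    + (fderiv ℝ (fun z => curv G z w a v) y u + chr G y u (curv G y w a v)
      - curv G y w a (chr G y u v)) = 0 := by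
  have hd : ∀ p, _ := fun p => (hG.contDiffAt_chr_apply hy p v).fderiv_fderiv_comm
  simp only [hG.fderiv_curv hy]
  rw [hd u a w, hd a u w, hd w u a]
  simp only [hG.curv_eq hy, map_add, map_sub]
  abel

end IsMetricOn

end Riemannian


/-! ## Metrics with a unit field `ξ` satisfying `∇ξ = f (I - η ⊗ ξ)` -/

section ReebLocal

variable {m : ℕ}

/-- The Ricci tensor as a trace. -/
def ric (G : Coord m → (Coord m →L[ℝ] Coord m →L[ℝ] ℝ)) (y u v : Coord m) : ℝ :=
  LinearMap.trace ℝ (Coord m) (curvLin G y u v)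

/-- `ξ` is a unit field with `∇ξ = f (I - η ⊗ ξ)`, where `η = G(ξ, ·)`, and `df = (c - f²) η`. -/
structure IsReebOn (U : Set (Coord m)) (G : Coord m → (Coord m →L[ℝ] Coord m →L[ℝ] ℝ))
    (ξ : Coord m → Coord m) (f : Coord m → ℝ) (c : ℝ) : Prop where
  metric : IsMetricOn U G
  smooth_ξ : ContDiffOn ℝ ∞ ξ U
  smooth_f : ContDiffOn ℝ ∞ f U
  unit : ∀ y ∈ U, G y (ξ y) (ξ y) = 1
  fderiv_ξ : ∀ y ∈ U, ∀ w, fderiv ℝ ξ y w = f y • (w - G y w (ξ y) • ξ y) - chr G y w (ξ y)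
  fderiv_f : ∀ y ∈ U, ∀ w, fderiv ℝ f y w = (c - f y ^ 2) * G y w (ξ y)

variable {U : Set (Coord m)} {G : Coord m → (Coord m →L[ℝ] Coord m →L[ℝ] ℝ)}
  {ξ : Coord m → Coord m} {f : Coord m → ℝ} {c : ℝ} {y : Coord m}

/-- The trace is linear, so it commutes with differentiation. Passing `L` explicitly lets later
computations supply the derivative as a composite of operators whose trace is known. -/
lemma IsMetricOn.fderiv_ric (hG : IsMetricOn U G) (hy : y ∈ U) (u v w : Coord m)
    (L : Coord m →ₗ[ℝ] Coord m) (hL : ∀ a, fderiv ℝ (fun z => curv G z a u v) y w = L a) :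
    fderiv ℝ (fun z => ric G z u v) y w = LinearMap.trace ℝ (Coord m) L := by
  have h1 : (fun z => ric G z u v)
      = fun z => ∑ i : Fin m, (EuclideanSpace.proj (𝕜 := ℝ) i : Coord m →L[ℝ] ℝ)
        (curv G z (EuclideanSpace.single i 1) u v) := by
    ext z
    rw [ric, ← sum_apply_single_eq_trace]
    simp
  have hd : ∀ a, DifferentiableAt ℝ (fun z => curv G z a u v) y := fun a =>
    (hG.contDiffAt_curv hy a u v).differentiableAt_infty
  have hi : ∀ i : Fin m, HasFDerivAt (fun z => (EuclideanSpace.proj (𝕜 := ℝ) i : Coord m →L[ℝ] ℝ)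
      (curv G z (EuclideanSpace.single i 1) u v)) ((EuclideanSpace.proj i : Coord m →L[ℝ] ℝ).comp
        (fderiv ℝ (fun z => curv G z (EuclideanSpace.single i 1) u v) y)) y := fun i =>
    (ContinuousLinearMap.hasFDerivAt _).comp y (hd _).hasFDerivAt
  rw [h1, (HasFDerivAt.fun_sum fun i _ => hi i).fderiv, ← sum_apply_single_eq_trace]
  simp [hL]

lemma IsMetricOn.ric_sub_left (hG : IsMetricOn U G) (hy : y ∈ U) (u u' v : Coord m) :
    ric G y (u - u') v = ric G y u v - ric G y u' v := by
  rw [ric, ric, ric, ← map_sub]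
  congr 1
  ext1 a
  exact hG.curv_sub_middle hy a u u' v

lemma IsMetricOn.ric_smul_left (hG : IsMetricOn U G) (hy : y ∈ U) (s : ℝ) (u v : Coord m) :
    ric G y (s • u) v = s * ric G y u v := by
  rw [ric, ric, ← smul_eq_mul, ← map_smul]
  congr 1
  ext1 a
  exact hG.curv_smul_middle hy s a u v

/-- Product rule for the curvature evaluated on a vector field in the second slot. -/
lemma IsMetricOn.fderiv_curv_middle (hG : IsMetricOn U G) (hy : y ∈ U) {Z : Coord m → Coord m}
    (hZ : ContDiffAt ℝ ∞ Z y) (a v w : Coord m) :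
    fderiv ℝ (fun z => curv G z a (Z z) v) y w =
      fderiv ℝ (fun z => curv G z a (Z y) v) y w + curv G y a (fderiv ℝ Z y w) v := by
  let A : Coord m → (Coord m →L[ℝ] Coord m) := fun z =>
    -LinearMap.toContinuousLinearMap (curvLin G z a v)
  have hA : ContDiffAt ℝ ∞ A y :=
    (contDiffAt_clm_of_apply fun u => hG.contDiffAt_curv hy u a v).neg
  have h : ∀ Z : Coord m → Coord m, EqOn (fun z => curv G z a (Z z) v) (fun z => A z (Z z)) U :=
    fun Z z hz => hG.curv_antisymm hz a (Z z) v
  rw [fderiv_eq_of_eqOn hG.isOpen (h Z) hy, fderiv_eq_of_eqOn hG.isOpen (h fun _ => Z y) hy,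
    fderiv_clm_apply_apply hA hZ, fderiv_clm_apply_const hA, hG.curv_antisymm hy]
  rfl

namespace IsReebOn

variable (h : IsReebOn U G ξ f c) (hy : y ∈ U)
include h hy

lemma contDiffAt_ξ : ContDiffAt ℝ ∞ ξ y :=
  h.smooth_ξ.contDiffAt (h.metric.isOpen.mem_nhds hy)

lemma contDiffAt_f : ContDiffAt ℝ ∞ f y :=
  h.smooth_f.contDiffAt (h.metric.isOpen.mem_nhds hy)

lemma contDiffAt_η (v : Coord m) : ContDiffAt ℝ ∞ (fun z => G z v (ξ z)) y :=
  (h.metric.contDiffAt_left hy v).clm_apply (h.contDiffAt_ξ hy)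

lemma fderiv_η (v w : Coord m) : fderiv ℝ (fun z => G z v (ξ z)) y w =
    f y * (G y w v - G y w (ξ y) * G y v (ξ y)) + G y (chr G y w v) (ξ y) := by
  rw [h.metric.fderiv_metric_apply hy (h.contDiffAt_ξ hy), h.fderiv_ξ y hy, sub_add_cancel,
    map_smul, map_sub, map_smul, h.metric.symm y hy v w]
  simp only [smul_eq_mul]
  ring

/-- Symmetry of the second derivative of `ξ`, with `∇ξ = f (I - η ⊗ ξ)` differentiated once more.
The term `-f²` of `df = (c - f²) η` cancels against the one from differentiating `ξ` inside `η ⊗ ξ`,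
which leaves only `c`. -/
lemma curv_ξ (a u : Coord m) :
    curv G y a u (ξ y) = c • (G y a (ξ y) • u - G y u (ξ y) • a) := by
  have hξ := h.contDiffAt_ξ hy
  have key : ∀ p q : Coord m, fderiv ℝ (fderiv ℝ ξ) y p q =
      (((c - f y ^ 2) * G y p (ξ y)) • (q - G y q (ξ y) • ξ y)
        + f y • (-((f y * (G y p q - G y p (ξ y) * G y q (ξ y)) + G y (chr G y p q) (ξ y)) • ξ y)
          - G y q (ξ y) • fderiv ℝ ξ y p))
      - (fderiv ℝ (fun z => chr G z q (ξ y)) y p + chr G y q (fderiv ℝ ξ y p)) := by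
    intro p q
    have e1 : HasFDerivAt (fun z => f z • (q - G z q (ξ z) • ξ z)) _ y :=
      (h.contDiffAt_f hy).differentiableAt_infty.hasFDerivAt.smul
        (((h.contDiffAt_η hy q).differentiableAt_infty.hasFDerivAt.smul
          hξ.differentiableAt_infty.hasFDerivAt).const_sub q)
    rw [← fderiv_clm_apply_const hξ.fderiv_infty,
      fderiv_eq_of_eqOn h.metric.isOpen (fun z hz => h.fderiv_ξ z hz q) hy,
      fderiv_fun_sub e1.differentiableAt
        ((h.metric.contDiffAt_chr hy q).clm_apply hξ).differentiableAt_infty, sub_apply, e1.fderiv,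
      h.metric.fderiv_chr_apply hy hξ]
    simp only [add_apply, smul_apply, neg_apply, ContinuousLinearMap.smulRight_apply,
      h.fderiv_η hy, h.fderiv_f y hy]
    module
  have hs := hξ.fderiv_fderiv_comm a u
  rw [key, key, h.fderiv_ξ y hy, h.fderiv_ξ y hy, h.metric.symm y hy a u,
    h.metric.chr_symm hy a u] at hs
  simp only [map_sub, map_smul, h.metric.chr_symm hy u a] at hs
  rw [h.metric.curv_eq hy]
  linear_combination (norm := module) -hs

lemma curv_ξ_middle (v z : Coord m) :
    curv G y v (ξ y) z = c • (G y v z • ξ y - G y z (ξ y) • v) := by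
  refine h.metric.ext_left hy fun w => ?_
  rw [h.metric.curv_pair_symm hy, h.metric.curv_metric_antisymm hy, h.curv_ξ hy]
  simp only [map_smul, map_sub, smul_apply, sub_apply, smul_eq_mul, h.metric.symm y hy (ξ y) w]
  ring

lemma ric_ξ_right (u : Coord m) : ric G y u (ξ y) = -(c * (m - 1)) * G y u (ξ y) := by
  have : curvLin G y u (ξ y) = c • ((((G y).flip (ξ y)).toLinearMap).smulRight u
      - G y u (ξ y) • LinearMap.id) := by
    ext1 a
    simp [h.curv_ξ hy]
  rw [ric, this, trace_smul_sub]
  simp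
  ring

lemma ric_ξ_left (v : Coord m) : ric G y (ξ y) v = -(c * (m - 1)) * G y v (ξ y) := by
  have : curvLin G y (ξ y) v = c • ((((G y).flip v).toLinearMap).smulRight (ξ y)
      - G y v (ξ y) • LinearMap.id) := by
    ext1 a
    simp [h.curv_ξ_middle hy]
  rw [ric, this, trace_smul_sub]
  simp [h.metric.symm y hy (ξ y) v]
  ring

/-- In covariant form, `(∇_ξ R)(a, u)v = -2f (R(a, u)v + c (G(u, v) a - G(a, v) u))`. The other two
terms of the second Bianchi identity contain `ξ` as an argument of `R`, and differentiating
`curv_ξ_middle` determines them. -/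
lemma fderiv_curv_ξ (a u v : Coord m) : fderiv ℝ (fun z => curv G z a u v) y (ξ y) =
    curv G y (chr G y (ξ y) a) u v + curv G y a (chr G y (ξ y) u) v
      - chr G y (ξ y) (curv G y a u v) + curv G y a u (chr G y (ξ y) v)
      - (2 * f y) • (curv G y a u v + c • (G y u v • a - G y a v • u)) := by
  have hG := h.metric
  have hξ := h.contDiffAt_ξ hy
  -- Here `ξ` is frozen at `y`, as the Bianchi identity requires; the difference from the moving `ξ`
  -- is `R(q, Dξ(p))v`, which brings in the factor `f`.
  have key : ∀ p q : Coord m, fderiv ℝ (fun z => curv G z q (ξ y) v) y p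
      + chr G y p (curv G y q (ξ y) v) - curv G y q (ξ y) (chr G y p v) =
      c • (G y (chr G y p q) v • ξ y - G y v (ξ y) • chr G y p q + (f y * G y q v) • p
        - (f y * G y p v) • q) - f y • curv G y q p v + curv G y q (chr G y p (ξ y)) v := by
    intro p q
    have e1 : HasFDerivAt (fun z => c • (G z q v • ξ z - G z v (ξ z) • q)) _ y :=
      (((hG.contDiffAt_apply hy q v).differentiableAt_infty.hasFDerivAt.smul
        hξ.differentiableAt_infty.hasFDerivAt).sub
        ((h.contDiffAt_η hy v).differentiableAt_infty.hasFDerivAt.smul_const q)).const_smul c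
    have e2 := hG.fderiv_curv_middle hy hξ q v p
    rw [fderiv_eq_of_eqOn hG.isOpen (fun z hz => h.curv_ξ_middle hz q v) hy, e1.fderiv,
      h.fderiv_ξ y hy, hG.curv_sub_middle hy, hG.curv_smul_middle hy, hG.curv_sub_middle hy,
      hG.curv_smul_middle hy, h.curv_ξ_middle hy] at e2
    rw [eq_sub_of_add_eq e2.symm, h.curv_ξ_middle hy, h.curv_ξ_middle hy]
    simp only [add_apply, smul_apply, sub_apply, ContinuousLinearMap.smulRight_apply,
      h.fderiv_η hy, h.fderiv_ξ y hy, hG.fderiv_metric hy, map_smul, map_sub]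
    module
  have hb := hG.second_bianchi hy a u (ξ y) v
  rw [key a u] at hb
  have e3 : fderiv ℝ (fun z => curv G z (ξ y) a v) y u
      = -fderiv ℝ (fun z => curv G z a (ξ y) v) y u := by
    rw [fderiv_eq_of_eqOn hG.isOpen (fun z hz => hG.curv_antisymm hz (ξ y) a v) hy, fderiv_fun_neg]
    rfl
  have e4 := key u a
  rw [hG.curv_antisymm hy (ξ y) a, hG.curv_antisymm hy (ξ y) a, e3, map_neg] at hb
  rw [hG.chr_symm hy u a, hG.curv_antisymm hy a (chr G y u (ξ y))] at e4
  rw [hG.curv_antisymm hy u a, hG.curv_antisymm hy u] at hb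
  rw [hG.chr_symm hy (ξ y) a, hG.chr_symm hy (ξ y) u, hG.curv_antisymm hy a (chr G y u (ξ y))]
  linear_combination (norm := module) hb + e4

/-- The tensor `Ric + (m - 1) c G` vanishes on `ξ` and scales along `ξ`. -/
lemma fderiv_ric_ξ (u v : Coord m) : fderiv ℝ (fun z => ric G z u v) y (ξ y) =
    ric G y (chr G y (ξ y) u) v + ric G y u (chr G y (ξ y) v)
      - 2 * f y * (ric G y u v + c * (m - 1) * G y u v) := by
  let Γ : Coord m →ₗ[ℝ] Coord m := (chr G y (ξ y)).toLinearMap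
  let R := curvLin G y u v
  rw [h.metric.fderiv_ric hy u v (ξ y) (R ∘ₗ Γ + curvLin G y (chr G y (ξ y) u) v - Γ ∘ₗ R
    + curvLin G y u (chr G y (ξ y) v) - (2 * f y) • (R - c • ((((G y).flip v).toLinearMap).smulRight u
      - G y u v • LinearMap.id)))
    (fun a => by
      rw [h.fderiv_curv_ξ hy]
      simp [R, Γ]
      module)]
  -- The connection terms form a commutator `[R, Γ]`, which has trace zero.
  have hc : LinearMap.trace ℝ (Coord m) (R ∘ₗ Γ) = LinearMap.trace ℝ (Coord m) (Γ ∘ₗ R) :=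
    LinearMap.trace_comp_comm' _ _
  rw [map_sub, map_add, map_sub, map_add, hc, map_smul, map_sub, trace_smul_sub]
  simp only [ric, R, smul_eq_mul, ContinuousLinearMap.coe_coe, ContinuousLinearMap.flip_apply]
  ring

end IsReebOn

/-- `F` satisfies the gradient Ricci soliton equation `Hess F + Ric = r G` on `U`. -/
structure IsSolitonOn (U : Set (Coord m)) (G : Coord m → (Coord m →L[ℝ] Coord m →L[ℝ] ℝ))
    (F : Coord m → ℝ) (r : ℝ) : Prop where
  smooth : ContDiffOn ℝ ∞ F U
  eq : ∀ y ∈ U, ∀ u v,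
    fderiv ℝ (fderiv ℝ F) y u v - fderiv ℝ F y (chr G y u v) + ric G y u v = r * G y u v

namespace IsReebOn

variable {F : Coord m → ℝ} {r : ℝ} (h : IsReebOn U G ξ f c) (hF : IsSolitonOn U G F r)
include h hF

/-- The soliton equation controls `Ric + (m - 1) c G` in the direction of `ξ`. -/
lemma soliton_identity (hy : y ∈ U) (u v : Coord m) :
    f y * (ric G y u v + c * (m - 1) * G y u v) =
      c * (fderiv ℝ F y (ξ y) * G y u v - fderiv ℝ F y u * G y v (ξ y)) := by
  have hG := h.metric
  have hξ := h.contDiffAt_ξ hy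
  have hFc : ∀ z ∈ U, ContDiffAt ℝ ∞ F z := fun z hz =>
    hF.smooth.contDiffAt (hG.isOpen.mem_nhds hz)
  have hd := (hFc y hy).fderiv_infty
  have hess : ∀ z ∈ U, ∀ u v, fderiv ℝ (fderiv ℝ F) z u v =
      fderiv ℝ F z (chr G z u v) - ric G z u v + r * G z u v := fun z hz u v => by
    linarith [hF.eq z hz u v]
  -- Regularity of the Ricci tensor is read off the soliton equation, all of whose other terms are
  -- smooth.
  have hric : ∀ u v : Coord m, DifferentiableAt ℝ (fun z => ric G z u v) y := by
    intro u v
    have e : EqOn (fun z => ric G z u v) (fun z => fderiv ℝ F z (chr G z u v)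
        - fderiv ℝ (fderiv ℝ F) z u v + r * G z u v) U := fun z hz => by
      have := hess z hz u v
      dsimp only
      linarith
    refine DifferentiableAt.congr_of_eventuallyEq ?_
      (e.eventuallyEq_of_mem (hG.isOpen.mem_nhds hy))
    exact (((hd.clm_apply (hG.contDiffAt_chr_apply hy u v)).sub
      ((hd.fderiv_infty.clm_apply contDiffAt_const).clm_apply contDiffAt_const)).add
      (contDiffAt_const.mul (hG.contDiffAt_apply hy u v))).differentiableAt_infty
  -- the derivative along `ξ` of the Hessian
  have third : ∀ w a b : Coord m, fderiv ℝ (fun z => fderiv ℝ (fderiv ℝ F) z a b) y w =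
      fderiv ℝ (fun z => fderiv ℝ (fderiv ℝ F) z w b) y a := by
    intro w a b
    have e : ∀ p, EqOn (fun z => fderiv ℝ (fderiv ℝ F) z p b)
        (fun z => fderiv ℝ (fun x => fderiv ℝ F x b) z p) U := fun p z hz =>
      (fderiv_clm_apply_const (hFc z hz).fderiv_infty b p).symm
    have hb : ContDiffAt ℝ ∞ (fun x => fderiv ℝ F x b) y := hd.clm_apply contDiffAt_const
    rw [fderiv_eq_of_eqOn hG.isOpen (e a) hy, fderiv_eq_of_eqOn hG.isOpen (e w) hy,
      fderiv_clm_apply_const hb.fderiv_infty, fderiv_clm_apply_const hb.fderiv_infty,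
      hb.fderiv_fderiv_comm]
  have lhs : fderiv ℝ (fun z => fderiv ℝ (fderiv ℝ F) z u v) y (ξ y) =
      fderiv ℝ (fderiv ℝ F) y (ξ y) (chr G y u v)
        + fderiv ℝ F y (fderiv ℝ (fun z => chr G z u v) y (ξ y))
        - fderiv ℝ (fun z => ric G z u v) y (ξ y)
        + r * (G y (chr G y (ξ y) u) v + G y u (chr G y (ξ y) v)) := by
    have d1 := (hd.clm_apply (hG.contDiffAt_chr_apply hy u v)).differentiableAt_infty
    have d2 := (hG.contDiffAt_apply hy u v).differentiableAt_infty
    rw [fderiv_eq_of_eqOn hG.isOpen (fun z hz => hess z hz u v) hy,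
      fderiv_fun_add (d1.fun_sub (hric u v)) (d2.const_mul r), fderiv_fun_sub d1 (hric u v),
      fderiv_const_mul d2, add_apply, sub_apply, smul_apply,
      fderiv_clm_apply_apply hd (hG.contDiffAt_chr_apply hy u v), hG.fderiv_metric hy,
      smul_eq_mul]
  -- The known value of `Ric(ξ, ·)` makes the covariant Hessian satisfy `Hess F(ξ, ·) = (r + c (m -
  -- 1)) η`, so its derivative along `u` involves only `∇ξ`.
  have rhs : fderiv ℝ (fun z => fderiv ℝ (fderiv ℝ F) z (ξ y) v) y u =
      fderiv ℝ (fderiv ℝ F) y u (chr G y v (ξ y))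
        + fderiv ℝ F y (fderiv ℝ (fun z => chr G z v (ξ y)) y u + chr G y v (fderiv ℝ ξ y u))
        + (r + c * (m - 1)) * fderiv ℝ (fun z => G z v (ξ z)) y u
        - fderiv ℝ (fderiv ℝ F) y (fderiv ℝ ξ y u) v := by
    have c1 : ContDiffAt ℝ ∞ (fun z => chr G z v (ξ z)) y :=
      (hG.contDiffAt_chr hy v).clm_apply hξ
    have d1 := (hd.clm_apply c1).differentiableAt_infty
    have d2 := (h.contDiffAt_η hy v).differentiableAt_infty
    have c3 : ContDiffAt ℝ ∞ (fun z => fderiv ℝ (fderiv ℝ F) z) y := hd.fderiv_infty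
    have e1 : EqOn (fun z => fderiv ℝ (fderiv ℝ F) z (ξ z) v) (fun z =>
        fderiv ℝ F z (chr G z v (ξ z)) + (r + c * (m - 1)) * G z v (ξ z)) U := fun z hz => by
      dsimp only
      rw [hess z hz, h.ric_ξ_left hz, hG.chr_symm hz, hG.symm z hz (ξ z)]
      ring
    have e2 := fderiv_clm_apply_const (c3.clm_apply hξ) v u
    rw [fderiv_clm_apply_apply c3 hξ, fderiv_eq_of_eqOn hG.isOpen e1 hy,
      fderiv_fun_add d1 (d2.const_mul _), fderiv_const_mul d2, add_apply, smul_apply,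
      fderiv_clm_apply_apply hd c1, hG.fderiv_chr_apply hy hξ, smul_eq_mul, add_apply] at e2
    rw [fderiv_clm_apply_const (c3.clm_apply contDiffAt_const), fderiv_clm_apply_const c3]
    linarith
  -- Commuting the two covariant derivatives of `dF` costs `dF(R(ξ, u)v)`; this curvature is the
  -- source of the right-hand side of the identity.
  have hc := hG.curv_eq hy (ξ y) u v
  rw [hG.curv_antisymm hy, h.curv_ξ_middle hy,
    fderiv_eq_of_eqOn hG.isOpen (fun z hz => hG.chr_symm hz (ξ y) v) hy] at hc
  have hc' := congrArg (fderiv ℝ F y) hc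
  have hlin : ric G y (fderiv ℝ ξ y u) v = f y * ric G y u v
      - f y * G y u (ξ y) * ric G y (ξ y) v - ric G y (chr G y u (ξ y)) v := by
    rw [h.fderiv_ξ y hy, hG.ric_sub_left hy, hG.ric_smul_left hy, hG.ric_sub_left hy,
      hG.ric_smul_left hy]
    ring
  have ht := third (ξ y) u v
  rw [lhs, rhs, h.fderiv_ric_ξ hy, h.fderiv_η hy, hess y hy, hess y hy, hess y hy, hlin,
    h.fderiv_ξ y hy, h.ric_ξ_left hy, h.ric_ξ_left hy, hG.chr_symm hy (ξ y) u,
    hG.chr_symm hy (ξ y) v, chr_sub, chr_smul, chr_sub, chr_smul] at ht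
  simp only [map_sub, map_add, map_smul, map_neg, smul_apply, sub_apply, smul_eq_mul]
    at ht hc'
  rw [hG.chr_symm hy (ξ y) v, hG.chr_symm hy u v] at ht hc'
  rw [hG.chr_symm hy (chr G y u (ξ y)) v, hG.symm y hy (ξ y)] at ht
  rw [hG.symm y hy (ξ y) v] at ht
  linarith

/-- If `c ≠ 0` then the potential of the soliton is constant, unless the dimension is `1`. -/
lemma ric_eq_of_ne_zero (hc : c ≠ 0) (hy : y ∈ U) (hm : 2 ≤ m) (u v : Coord m) :
    ric G y u v = -(c * (m - 1)) * G y u v := by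
  have hG := h.metric
  have hFc : ∀ z ∈ U, ContDiffAt ℝ ∞ F z := fun z hz =>
    hF.smooth.contDiffAt (hG.isOpen.mem_nhds hz)
  set μ : ℝ := r + c * (m - 1) with hμ
  set k : Coord m → ℝ := fun z => fderiv ℝ F z (ξ z) with hk
  have hks : ∀ z ∈ U, ContDiffAt ℝ ∞ k z := fun z hz =>
    (hFc z hz).fderiv_infty.clm_apply (h.contDiffAt_ξ hz)
  -- Take `v = ξ` in `soliton_identity`: the left side vanishes because `T(·, ξ) = 0`, and `c` can
  -- be divided out.
  have hdF : ∀ z ∈ U, ∀ w, fderiv ℝ F z w = k z * G z w (ξ z) := by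
    intro z hz w
    have := h.soliton_identity hF hz w (ξ z)
    rw [h.ric_ξ_right hz, h.unit z hz] at this
    have h0 : c * (k z * G z w (ξ z) - fderiv ℝ F z w) = 0 := by
      simp only [hk]; linarith
    linarith [(mul_eq_zero.1 h0).resolve_left hc]
  have hdk : ∀ z ∈ U, ∀ w, fderiv ℝ k z w = μ * G z w (ξ z) := by
    intro z hz w
    have e1 := fderiv_clm_apply_apply (hFc z hz).fderiv_infty (h.contDiffAt_ξ hz) w
    have e2 := hF.eq z hz w (ξ z)
    rw [h.ric_ξ_right hz] at e2
    rw [h.fderiv_ξ z hz, map_sub, hdF z hz (_ • _)] at e1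
    simp only [map_smul, map_sub, smul_apply, sub_apply, h.unit z hz, smul_eq_mul] at e1
    linear_combination e1 + e2
  -- For `dF = k η` and `dk = μ η` the Hessian is `μ η ⊗ η + f k (G - η ⊗ η)`.
  have hT : ∀ z ∈ U, ∀ a b, ric G z a b + c * (m - 1) * G z a b =
      (μ - f z * k z) * (G z a b - G z a (ξ z) * G z b (ξ z)) := by
    intro z hz a b
    have e1 : fderiv ℝ (fun x => fderiv ℝ F x b) z a = fderiv ℝ (fderiv ℝ F) z a b :=
      fderiv_clm_apply_const (hFc z hz).fderiv_infty b a
    rw [fderiv_eq_of_eqOn hG.isOpen (fun x hx => hdF x hx b) hz,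
      fderiv_fun_mul (hks z hz).differentiableAt_infty (h.contDiffAt_η hz b).differentiableAt_infty]
      at e1
    simp only [add_apply, smul_apply, smul_eq_mul, hdk z hz, h.fderiv_η hz] at e1
    have e2 := hF.eq z hz a b
    rw [hdF z hz] at e2
    linear_combination e1 + e2
  -- Compare `hT` with the soliton identity on a nonzero vector of `ker η`. Such a vector exists
  -- because `m ≥ 2`.
  have hβ : ∀ z ∈ U, f z * (μ - f z * k z) = c * k z := by
    intro z hz
    obtain ⟨a, ha, hne⟩ : ∃ a : Coord m, G z a (ξ z) = 0 ∧ a ≠ 0 := by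
      let L : Coord m →ₗ[ℝ] ℝ := ((G z).flip (ξ z)).toLinearMap
      have hker : 0 < Module.finrank ℝ (LinearMap.ker L) := by
        have h1 := LinearMap.finrank_range_add_finrank_ker L
        have h2 : Module.finrank ℝ (LinearMap.range L) ≤ 1 := by
          simpa using Submodule.finrank_le (LinearMap.range L)
        simp only [finrank_euclideanSpace, Fintype.card_fin] at h1
        omega
      obtain ⟨a, ha⟩ := (Module.finrank_pos_iff_exists_ne_zero (R := ℝ)).1 hker
      exact ⟨a, LinearMap.mem_ker.1 a.2, by simpa using ha⟩
    have e1 := h.soliton_identity hF hz a a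
    have e2 := hT z hz a a
    have e3 := hG.pos z hz a hne
    rw [ha] at e2 e1
    rw [e2] at e1
    have e4 : (f z * (μ - f z * k z) - c * k z) * G z a a = 0 := by
      simp only [hk] at e1 ⊢
      linear_combination e1
    linarith [(mul_eq_zero.1 e4).resolve_right e3.ne']
  -- Along `ξ` one has `f' = c - f²` and `k' = μ`. Differentiating `hβ` gives `-2f · f (μ - f k) - 2
  -- c f k = 0`, and `hβ` itself reduces this to `-4 c f k = 0`.
  have hfk : ∀ z ∈ U, f z * k z = 0 := by
    intro z hz
    have df := (h.contDiffAt_f hz).differentiableAt_infty.hasFDerivAt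
    have dk := (hks z hz).differentiableAt_infty.hasFDerivAt
    have e1 := (df.mul ((df.mul dk).const_sub μ)).fderiv
    have e2 := (dk.const_mul c).fderiv
    have e3 := fderiv_eq_of_eqOn hG.isOpen hβ hz
    have e4 := congrArg (fun L => L (ξ z)) (e1.symm.trans (e3.trans e2))
    simp only [add_apply, smul_apply, neg_apply, smul_eq_mul, h.fderiv_f z hz, hdk z hz,
      h.unit z hz, Pi.mul_apply] at e4
    have e5 := hβ z hz
    have e6 : c * (f z * k z) = 0 := by linear_combination (-1 / 4) * e4 - (f z / 2) * e5
    exact (mul_eq_zero.1 e6).resolve_left hc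
  have hk0 : EqOn k (fun _ => 0) U := by
    intro z hz
    have e1 := hβ z hz
    have e2 := hfk z hz
    have e3 : f z * (f z * μ) = 0 := by linear_combination f z * e1 + (f z ^ 2 + c) * e2
    have e4 : f z * μ = 0 := by
      rcases mul_eq_zero.1 e3 with h0 | h0
      · rw [h0, zero_mul]
      · exact h0
    have e5 : c * k z = 0 := by linear_combination e4 - f z * e2 - e1
    exact (mul_eq_zero.1 e5).resolve_left hc
  -- The derivative of `k` along `ξ` is `μ`, and `k` vanishes on all of `U`.
  have hμ0 : μ = 0 := by
    have e1 := hdk y hy (ξ y)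
    rw [fderiv_eq_of_eqOn hG.isOpen hk0 hy, h.unit y hy] at e1
    simpa using e1.symm
  have e1 := hT y hy u v
  rw [hμ0, hk0 hy] at e1
  linarith

omit hF in
/-- In dimension one `Ric = -(m - 1) c G` trivially. -/
lemma ric_eq_of_dim_one (hy : y ∈ U) (hm : m = 1) (u v : Coord m) :
    ric G y u v = -(c * (m - 1)) * G y u v := by
  have hne : ξ y ≠ 0 := by
    intro h0
    simpa [h0] using h.unit y hy
  have hfin : Module.finrank ℝ (Coord m) = 1 := by simp [hm]
  obtain ⟨s, rfl⟩ := (finrank_eq_one_iff_of_nonzero' (ξ y) hne).1 hfin u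
  rw [h.metric.ric_smul_left hy, h.ric_ξ_left hy, map_smul, smul_apply, smul_eq_mul,
    h.metric.symm y hy (ξ y)]
  ring

/-- A gradient Ricci soliton with a Reeb field as above satisfies `Ric = -(m - 1) c G` at the points
where `f` does not vanish, and everywhere if `c ≠ 0`. -/
theorem ric_eq (hm : 1 ≤ m) (hy : y ∈ U) (hcf : c ≠ 0 ∨ f y ≠ 0) (u v : Coord m) :
    ric G y u v = -(c * (m - 1)) * G y u v := by
  rcases eq_or_ne c 0 with rfl | hc
  · have hf := hcf.resolve_left (by simp)
    have := h.soliton_identity hF hy u v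
    simpa [hf] using this
  · rcases hm.lt_or_eq with hm | hm
    · exact h.ric_eq_of_ne_zero hF hc hy hm u v
    · exact h.ric_eq_of_dim_one hy hm.symm u v

end IsReebOn

end ReebLocal


/-! ## Almost contact metric structures on open subsets of a coordinate space -/

section ContactLocal

variable {m : ℕ}

/-- `(Φ, ξ, η, G)` is an `f`-cosymplectic structure on the open set `U`. -/
structure IsFCosymplecticOn (U : Set (Coord m)) (G : Coord m → (Coord m →L[ℝ] Coord m →L[ℝ] ℝ))
    (Φ : Coord m → (Coord m →L[ℝ] Coord m)) (ξ : Coord m → Coord m)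
    (η : Coord m → (Coord m →L[ℝ] ℝ)) (f : Coord m → ℝ) : Prop where
  metric : IsMetricOn U G
  smooth_Φ : ContDiffOn ℝ ∞ Φ U
  smooth_ξ : ContDiffOn ℝ ∞ ξ U
  smooth_η : ContDiffOn ℝ ∞ η U
  smooth_f : ContDiffOn ℝ ∞ f U
  Φ_sq : ∀ y ∈ U, ∀ v, Φ y (Φ y v) = -v + η y v • ξ y
  η_Φ : ∀ y ∈ U, ∀ v, η y (Φ y v) = 0
  Φ_ξ : ∀ y ∈ U, Φ y (ξ y) = 0
  η_ξ : ∀ y ∈ U, η y (ξ y) = 1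
  G_Φ : ∀ y ∈ U, ∀ u v, G y (Φ y u) (Φ y v) = G y u v - η y u * η y v
  df_wedge : ∀ y ∈ U, ∀ u v, fderiv ℝ f y u * η y v - fderiv ℝ f y v * η y u = 0
  dη : ∀ y ∈ U, ∀ u v, dOne η y u v = 0
  dω : ∀ y ∈ U, ∀ u v w, dTwo (fundamentalForm G Φ) y u v w
    = 2 * f y * wedgeOneTwo (η y) (fundamentalForm G Φ y) u v w
  normal : ∀ X Y : Coord m → Coord m, ContDiffOn ℝ ∞ X U → ContDiffOn ℝ ∞ Y U → ∀ y ∈ U,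
    nijenhuis Φ X Y y + dOne η y (X y) (Y y) • ξ y = 0

variable {U : Set (Coord m)} {G : Coord m → (Coord m →L[ℝ] Coord m →L[ℝ] ℝ)}
  {Φ : Coord m → (Coord m →L[ℝ] Coord m)} {ξ : Coord m → Coord m} {η : Coord m → (Coord m →L[ℝ] ℝ)}
  {f : Coord m → ℝ} {c : ℝ} {y : Coord m}

namespace IsFCosymplecticOn

variable (h : IsFCosymplecticOn U G Φ ξ η f) (hy : y ∈ U)
include h hy

lemma contDiffAt_ξ : ContDiffAt ℝ ∞ ξ y :=
  h.smooth_ξ.contDiffAt (h.metric.isOpen.mem_nhds hy)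

lemma contDiffAt_η : ContDiffAt ℝ ∞ η y :=
  h.smooth_η.contDiffAt (h.metric.isOpen.mem_nhds hy)

lemma contDiffAt_Φ : ContDiffAt ℝ ∞ Φ y :=
  h.smooth_Φ.contDiffAt (h.metric.isOpen.mem_nhds hy)

lemma contDiffAt_Φ_apply (v : Coord m) : ContDiffAt ℝ ∞ (fun z => Φ z v) y :=
  (h.contDiffAt_Φ hy).clm_apply contDiffAt_const

lemma metric_ξ (v : Coord m) : G y v (ξ y) = η y v := by
  have := h.G_Φ y hy v (ξ y)
  rw [h.Φ_ξ y hy, h.η_ξ y hy, map_zero] at this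
  linarith

lemma metric_Φ_skew (u v : Coord m) : G y (Φ y u) v = -G y u (Φ y v) := by
  have := h.G_Φ y hy (Φ y u) v
  rw [h.Φ_sq y hy, h.η_Φ y hy, map_add, map_neg, map_smul, add_apply, neg_apply, smul_apply,
    h.metric.symm y hy (ξ y), h.metric_ξ hy, h.η_Φ y hy] at this
  simp at this
  linarith

lemma fderiv_η_symm (u v : Coord m) : fderiv ℝ η y u v = fderiv ℝ η y v u := by
  have := h.dη y hy u v
  rw [dOne] at this
  linarith

lemma η_fderiv_ξ (w : Coord m) : η y (fderiv ℝ ξ y w) = -fderiv ℝ η y w (ξ y) := by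
  have e1 := fderiv_clm_apply_apply (h.contDiffAt_η hy) (h.contDiffAt_ξ hy) w
  rw [fderiv_eq_of_eqOn h.metric.isOpen (fun z hz => h.η_ξ z hz) hy] at e1
  simp at e1
  linarith

/-- `L_ξ Φ = 0`. -/
lemma lieDeriv_Φ (v : Coord m) :
    fderiv ℝ (fun z => Φ z v) y (ξ y) = fderiv ℝ ξ y (Φ y v) - Φ y (fderiv ℝ ξ y v) := by
  have hn := h.normal ξ (fun _ => v) h.smooth_ξ contDiffOn_const y hy
  have h0 : fderiv ℝ (fun z => Φ z (ξ z)) y = 0 := by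
    rw [fderiv_eq_of_eqOn h.metric.isOpen (fun z hz => h.Φ_ξ z hz) hy]
    simp
  rw [h.dη y hy, zero_smul, add_zero] at hn
  simp only [nijenhuis, VectorField.lieBracket, h0, h.Φ_ξ y hy, map_zero, fderiv_fun_const,
    Pi.zero_apply, zero_apply] at hn
  -- `A` is `(L_ξ Φ)v`. Normality on the pair `(ξ, v)` says `Φ A = 0`, while `η ∘ Φ = 0` and `dη =
  -- 0` give `η(A) = 0`; then `Φ² = -I + η ⊗ ξ` forces `A = 0`.
  set A := fderiv ℝ (fun z => Φ z v) y (ξ y) - fderiv ℝ ξ y (Φ y v) + Φ y (fderiv ℝ ξ y v) with hA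
  have hΦA : Φ y A = 0 := by
    rw [hA, map_add]
    simp only [zero_sub, map_neg, sub_self, map_zero, add_zero, sub_zero, map_sub] at hn ⊢
    rw [← neg_eq_zero, ← hn]
    abel
  have hηA : η y A = 0 := by
    have e1 := fderiv_clm_apply_apply (h.contDiffAt_η hy) (h.contDiffAt_Φ_apply hy v) (ξ y)
    rw [fderiv_eq_of_eqOn h.metric.isOpen (fun z hz => h.η_Φ z hz v) hy] at e1
    simp only [fderiv_fun_const, Pi.zero_apply, zero_apply] at e1
    rw [hA, map_add, map_sub, h.η_Φ y hy, h.η_fderiv_ξ hy, h.fderiv_η_symm hy (Φ y v)]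
    linarith
  have := h.Φ_sq y hy A
  rw [hΦA, hηA, map_zero, zero_smul, add_zero] at this
  have hA0 : A = 0 := neg_eq_zero.1 this.symm
  rw [hA] at hA0
  linear_combination (norm := module) hA0

/-- `L_ξ ω = 2 f ω`. -/
lemma lieDeriv_ω (u v : Coord m) : fderiv ℝ (fun z => G z (Φ z u) v) y (ξ y)
    + G y (Φ y (fderiv ℝ ξ y u)) v + G y (Φ y u) (fderiv ℝ ξ y v) = 2 * f y * G y (Φ y u) v := by
  have hG := h.metric
  -- Cartan's formula with `ω(ξ, ·) = 0`: the contraction of `dω` with `ξ` is `L_ξ ω`, and that of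
  -- `η ∧ ω` is `ω`. The terms `ev` and `ew` appear because `ξ` is frozen at `y` in `dTwo`.
  have hω := h.dω y hy (ξ y) u v
  have ev : ∀ w a : Coord m, fderiv ℝ (fun z => G z (Φ z (ξ y)) a) y w
      = -G y (Φ y (fderiv ℝ ξ y w)) a := by
    intro w a
    let A : Coord m → (Coord m →L[ℝ] ℝ) := fun z => ((G z).flip a).comp (Φ z)
    have hA : ContDiffAt ℝ ∞ A y := contDiffAt_clm_of_apply fun p =>
      ((hG.contDiffAt hy).clm_apply (h.contDiffAt_Φ_apply hy p)).clm_apply contDiffAt_const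
    have e1 := fderiv_clm_apply_apply hA (h.contDiffAt_ξ hy) w
    have e2 : EqOn (fun z => A z (ξ z)) (fun _ => 0) U := fun z hz => by
      simp [A, h.Φ_ξ z hz]
    rw [fderiv_eq_of_eqOn hG.isOpen e2 hy, ← fderiv_clm_apply_const hA] at e1
    simp only [fderiv_fun_const, Pi.zero_apply, zero_apply] at e1
    have e3 : (fun z => G z (Φ z (ξ y)) a) = fun z => A z (ξ y) := rfl
    rw [e3]
    have e4 : A y (fderiv ℝ ξ y w) = G y (Φ y (fderiv ℝ ξ y w)) a := rfl
    linarith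
  have ew : ∀ w a : Coord m, fderiv ℝ (fun z => G z (Φ z a) (ξ y)) y w
      = -fderiv ℝ (fun z => G z (Φ z (ξ y)) a) y w := by
    intro w a
    have e : EqOn (fun z => G z (Φ z a) (ξ y)) (fun z => -G z (Φ z (ξ y)) a) U := fun z hz => by
      dsimp only
      rw [h.metric_Φ_skew hz, hG.symm z hz]
    rw [fderiv_eq_of_eqOn hG.isOpen e hy, fderiv_fun_neg]
    rfl
  simp only [dTwo, fundamentalForm, wedgeOneTwo] at hω
  rw [ew, ev, ev, h.η_ξ y hy, h.Φ_ξ y hy, h.metric_Φ_skew hy v, h.Φ_ξ y hy,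
    h.metric_Φ_skew hy (fderiv ℝ ξ y v), hG.symm y hy (fderiv ℝ ξ y v)] at hω
  simp at hω
  linarith

/-- `L_ξ G = 2 f (G - η ⊗ η)`. -/
lemma lieDeriv_metric (u v : Coord m) : fderiv ℝ (fun z => G z u v) y (ξ y)
    + G y (fderiv ℝ ξ y u) v + G y u (fderiv ℝ ξ y v) = 2 * f y * (G y u v - η y u * η y v) := by
  have hG := h.metric
  have hξ := h.contDiffAt_ξ hy
  -- Since `ω = G(Φ·, ·)` and `L_ξ Φ = 0`, the formula for `L_ξ ω` settles the case of a first
  -- argument in the image of `Φ`. The remaining direction `ξ` is `e4`, which expresses `L_ξ η = 0`.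
  have e1 : ∀ a : Coord m, fderiv ℝ (fun z => G z (Φ y a) v) y (ξ y)
      + G y (fderiv ℝ ξ y (Φ y a)) v + G y (Φ y a) (fderiv ℝ ξ y v) =
      2 * f y * G y (Φ y a) v := by
    intro a
    have e2 := h.lieDeriv_ω hy a v
    have e3 : fderiv ℝ (fun z => G z (Φ z a) v) y (ξ y) =
        fderiv ℝ (fun z => G z (Φ y a) v) y (ξ y)
          + G y (fderiv ℝ (fun z => Φ z a) y (ξ y)) v := by
      have hs : ∀ b : Coord m → Coord m, EqOn (fun z => G z (b z) v) (fun z => G z v (b z)) U :=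
        fun b z hz => hG.symm z hz _ _
      rw [fderiv_eq_of_eqOn hG.isOpen (hs fun z => Φ z a) hy,
        fderiv_eq_of_eqOn hG.isOpen (hs fun z => Φ y a) hy,
        fderiv_clm_apply_apply (hG.contDiffAt_left hy v) (h.contDiffAt_Φ_apply hy a),
        fderiv_clm_apply_const (hG.contDiffAt_left hy v), hG.symm y hy _ v]
    rw [e3, h.lieDeriv_Φ hy, map_sub, sub_apply] at e2
    linarith
  have e4 : fderiv ℝ (fun z => G z (ξ y) v) y (ξ y) + G y (fderiv ℝ ξ y (ξ y)) v
      + G y (ξ y) (fderiv ℝ ξ y v) = 0 := by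
    have e5 := fderiv_clm_apply_apply (hG.contDiffAt_left hy v) hξ (ξ y)
    rw [fderiv_eq_of_eqOn hG.isOpen (fun z hz => h.metric_ξ hz v) hy,
      fderiv_clm_apply_const (h.contDiffAt_η hy), ← fderiv_clm_apply_const (hG.contDiffAt_left hy v),
      h.fderiv_η_symm hy] at e5
    rw [hG.fderiv_symm hy, hG.symm y hy _ v, hG.symm y hy (ξ y), h.metric_ξ hy, h.η_fderiv_ξ hy]
    linarith
  -- `Φ(-Φ u) = u - η(u) ξ` is the component of `u` in `ker η`.
  have e6 := e1 (-Φ y u)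
  rw [map_neg, h.Φ_sq y hy, neg_add, neg_neg] at e6
  have e7 : fderiv ℝ (fun z => G z (u + -(η y u • ξ y)) v) y (ξ y) =
      fderiv ℝ (fun z => G z u v) y (ξ y) - η y u * fderiv ℝ (fun z => G z (ξ y) v) y (ξ y) := by
    have e8 : (fun z => G z (u + -(η y u • ξ y)) v) = fun z => G z u v - η y u * G z (ξ y) v := by
      ext z
      simp
      ring
    have d1 := (hG.contDiffAt_apply hy u v).differentiableAt_infty
    have d2 := (hG.contDiffAt_apply hy (ξ y) v).differentiableAt_infty
    rw [e8, fderiv_fun_sub d1 (d2.const_mul _), fderiv_const_mul d2]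
    simp
  rw [e7] at e6
  simp only [map_add, map_neg, map_smul, add_apply, neg_apply, smul_apply, smul_eq_mul] at e6
  have e9 : G y (ξ y) v = η y v := by rw [hG.symm y hy, h.metric_ξ hy]
  rw [e9] at e6
  linear_combination e6 + η y u * e4

/-- `∇ξ = f (I - η ⊗ ξ)`. -/
lemma fderiv_ξ (w : Coord m) :
    fderiv ℝ ξ y w = f y • (w - G y w (ξ y) • ξ y) - chr G y w (ξ y) := by
  have hG := h.metric
  have hξ := h.contDiffAt_ξ hy
  -- `dη = 0` makes `G(∇ξ, ·)` symmetric, and twice its symmetric part is `L_ξ G`.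
  have key : ∀ v : Coord m, G y (fderiv ℝ ξ y w + chr G y w (ξ y)) v
      = f y * (G y w v - η y w * η y v) := by
    intro v
    have hη : ∀ a b : Coord m, fderiv ℝ η y a b = G y (chr G y a b) (ξ y)
        + G y b (fderiv ℝ ξ y a + chr G y a (ξ y)) := by
      intro a b
      rw [← fderiv_clm_apply_const (h.contDiffAt_η hy) b a, ← hG.fderiv_metric_apply hy hξ,
        fderiv_eq_of_eqOn hG.isOpen (fun z hz => h.metric_ξ hz b) hy]
    have e1 := h.fderiv_η_symm hy w v
    rw [hη, hη, hG.chr_symm hy v w] at e1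
    have e2 := h.lieDeriv_metric hy w v
    rw [hG.fderiv_metric hy, hG.chr_symm hy (ξ y) w, hG.chr_symm hy (ξ y) v] at e2
    rw [hG.symm y hy _ v]
    simp only [map_add] at e1 ⊢
    linarith [hG.symm y hy v (fderiv ℝ ξ y w), hG.symm y hy v (chr G y w (ξ y))]
  have : fderiv ℝ ξ y w + chr G y w (ξ y) = f y • (w - η y w • ξ y) := by
    refine hG.ext_left hy fun v => ?_
    rw [key]
    simp only [map_smul, map_sub, smul_apply, sub_apply, smul_eq_mul]
    rw [hG.symm y hy (ξ y), h.metric_ξ hy]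
  rw [h.metric_ξ hy, ← this, add_sub_cancel_right]

omit hy in
lemma isReebOn (hf : ∀ y ∈ U, fderiv ℝ f y (ξ y) + f y ^ 2 = c) : IsReebOn U G ξ f c where
  metric := h.metric
  smooth_ξ := h.smooth_ξ
  smooth_f := h.smooth_f
  unit y hy := by rw [h.metric_ξ hy, h.η_ξ y hy]
  fderiv_ξ y hy := h.fderiv_ξ hy
  fderiv_f y hy w := by
    have e1 := h.df_wedge y hy w (ξ y)
    rw [h.η_ξ y hy] at e1
    rw [h.metric_ξ hy, ← hf y hy]
    linarith

end IsFCosymplecticOn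

end ContactLocal


/-! ## Smooth flows of smooth vector fields -/

section Flow

universe u

set_option synthInstance.maxHeartbeats 200000

variable {K : Type*} [TopologicalSpace K] [CompactSpace K]

variable {L E F : Type*} [NormedAddCommGroup L] [NormedSpace ℝ L] [NormedAddCommGroup E]
  [NormedSpace ℝ E] [NormedAddCommGroup F] [NormedSpace ℝ F]

/-- A bilinear map applied pointwise to continuous families of vectors. -/
def pointwiseBilin (K : Type*) [TopologicalSpace K] [CompactSpace K] (b : L →L[ℝ] E →L[ℝ] F) :
    C(K, L) →L[ℝ] C(K, E) →L[ℝ] C(K, F) :=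
  LinearMap.mkContinuous₂
    (LinearMap.mk₂ ℝ (fun (A : C(K, L)) (γ : C(K, E)) =>
      (⟨fun s => b (A s) (γ s), (b.continuous.comp A.continuous).clm_apply γ.continuous⟩ : C(K, F)))
    (fun A B γ => by ext; simp) (fun r A γ => by ext; simp) (fun A γ δ => by ext; simp)
    (fun r A γ => by ext; simp)) ‖b‖ fun A γ => by
    rw [ContinuousMap.norm_le _ (by positivity)]
    intro s
    calc ‖b (A s) (γ s)‖ ≤ ‖b‖ * ‖A s‖ * ‖γ s‖ := b.le_opNorm₂ _ _
      _ ≤ ‖b‖ * ‖A‖ * ‖γ‖ := by gcongr <;> exact ContinuousMap.norm_coe_le_norm _ s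

/-- Composition of curves with a map of class `C¹` is differentiable. -/
lemma hasFDerivAt_postcomp {V : C(E, F)} {V' : C(E, E →L[ℝ] F)}
    (hV : ∀ x, HasFDerivAt V (V' x) x) (γ : C(K, E)) :
    HasFDerivAt (fun δ : C(K, E) => V.comp δ) (pointwiseBilin K (ContinuousLinearMap.id ℝ (E →L[ℝ] F)) (V'.comp γ)) γ := by
  rw [hasFDerivAt_iff_isLittleO_nhds_zero, Asymptotics.isLittleO_iff]
  intro ε hε
  have hcpt : IsCompact (range γ) := isCompact_range γ.continuous
  -- Uniform continuity of `V'` around the compact range of `γ` makes the mean value estimate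
  -- uniform in the parameter of the curve.
  have hu := hcpt.uniformContinuousAt_of_continuousAt V' (fun x _ => V'.continuous.continuousAt)
    (Metric.dist_mem_uniformity hε)
  obtain ⟨δ, hδ, hu⟩ := Metric.mem_uniformity_dist.1 hu
  filter_upwards [Metric.ball_mem_nhds (0 : C(K, E)) hδ] with k hk
  rw [ContinuousMap.norm_le _ (by positivity)]
  intro s
  have hks : ‖k s‖ ≤ ‖k‖ := ContinuousMap.norm_coe_le_norm k s
  have hk' : ‖k‖ < δ := by simpa using hk
  have hb : ∀ x ∈ Metric.ball (γ s) δ, ‖V' x - V' (γ s)‖ ≤ ε := by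
    intro x hx
    have h1 : dist (γ s) x < δ := by rwa [dist_comm]
    have h2 := hu h1 (mem_range_self s)
    rw [← dist_eq_norm, dist_comm]
    exact le_of_lt h2
  have hx : γ s + k s ∈ Metric.ball (γ s) δ := by
    simpa using hks.trans_lt hk'
  have := (convex_ball (γ s) δ).norm_image_sub_le_of_norm_hasFDerivWithin_le'
    (fun x _ => (hV x).hasFDerivWithinAt) hb (Metric.mem_ball_self hδ) hx
  simp only [add_sub_cancel_left] at this
  calc ‖_‖ = ‖V (γ s + k s) - V (γ s) - V' (γ s) (k s)‖ := by
        congr 1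
    _ ≤ ε * ‖k s‖ := this
    _ ≤ ε * ‖k‖ := by gcongr

/-- Composition of curves with a smooth map is smooth. -/
lemma contDiff_postcomp {E : Type u} [NormedAddCommGroup E] [NormedSpace ℝ E] (n : ℕ) :
    ∀ {F : Type u} [NormedAddCommGroup F] [NormedSpace ℝ F] (V : C(E, F)),
      ContDiff ℝ ∞ V → ContDiff ℝ n (fun δ : C(K, E) => V.comp δ) := by
  -- The derivative of postcomposition by `V` is postcomposition by `V'`, with values in `E →L[ℝ]
  -- F`. So the target has to vary in the induction, and a common universe keeps it in the same one.
  induction n with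
  | zero =>
    intro F _ _ V hV
    exact contDiff_zero.2 (ContinuousMap.continuous_postcomp V)
  | succ n ih =>
    intro F _ _ V hV
    have hV' : ContDiff ℝ ∞ (fderiv ℝ V) := hV.fderiv_right (m := ∞) (by simp)
    let V' : C(E, E →L[ℝ] F) := ⟨fderiv ℝ V, hV'.continuous⟩
    push_cast
    refine contDiff_succ_iff_hasFDerivAt.2 ⟨fun γ => pointwiseBilin K (ContinuousLinearMap.id ℝ (E →L[ℝ] F)) (V'.comp γ), ?_, ?_⟩
    · exact (pointwiseBilin K (ContinuousLinearMap.id ℝ (E →L[ℝ] F))).contDiff.comp (ih V' hV')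
    · exact hasFDerivAt_postcomp fun x => (hV.differentiable (by simp) x).hasFDerivAt

end Flow


/-! ### Integral curves as zeros of a smooth map on a space of curves. -/

section SmoothFlow

set_option synthInstance.maxHeartbeats 200000

variable {E : Type*} [NormedAddCommGroup E] [NormedSpace ℝ E] [CompleteSpace E]

/-- The extension of a curve on `[-1, 1]` to the real line. -/
def extendCurve (γ : C(Icc (-1 : ℝ) 1, E)) (r : ℝ) : E := γ (projIcc (-1) 1 (by norm_num) r)

omit [NormedSpace ℝ E] [CompleteSpace E] in
lemma continuous_extendCurve (γ : C(Icc (-1 : ℝ) 1, E)) : Continuous (extendCurve γ) :=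
  γ.continuous.comp continuous_projIcc

omit [NormedSpace ℝ E] [CompleteSpace E] in
lemma extendCurve_of_mem (γ : C(Icc (-1 : ℝ) 1, E)) {r : ℝ} (hr : r ∈ Icc (-1 : ℝ) 1) :
    extendCurve γ r = γ ⟨r, hr⟩ := by
  rw [extendCurve, projIcc_of_mem _ hr]

/-- Integration of a curve on `[-1, 1]` from `0`. -/
def integrateCurve (E : Type*) [NormedAddCommGroup E] [NormedSpace ℝ E] [CompleteSpace E] :
    C(Icc (-1 : ℝ) 1, E) →L[ℝ] C(Icc (-1 : ℝ) 1, E) :=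
  LinearMap.mkContinuous
    { toFun := fun γ => ⟨fun s => ∫ r in (0 : ℝ)..s, extendCurve γ r,
        (intervalIntegral.continuous_primitive
          (fun a b => (continuous_extendCurve γ).intervalIntegrable a b) 0).comp
          continuous_subtype_val⟩
      map_add' := fun γ δ => by
        ext s
        exact intervalIntegral.integral_add ((continuous_extendCurve γ).intervalIntegrable _ _)
          ((continuous_extendCurve δ).intervalIntegrable _ _)
      map_smul' := fun c γ => by
        ext s
        exact intervalIntegral.integral_smul c _ } 1 fun γ => by
    rw [ContinuousMap.norm_le _ (by positivity)]
    intro s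
    refine (intervalIntegral.norm_integral_le_of_norm_le_const (C := ‖γ‖)
      fun r _ => ContinuousMap.norm_coe_le_norm _ _).trans ?_
    rw [one_mul, sub_zero]
    exact mul_le_of_le_one_right (norm_nonneg _) (abs_le.2 s.2)

lemma integrateCurve_apply (γ : C(Icc (-1 : ℝ) 1, E)) (s : Icc (-1 : ℝ) 1) :
    integrateCurve E γ s = ∫ r in (0 : ℝ)..s, extendCurve γ r := rfl

/-- Constant curves. -/
def constCurve (E : Type*) [NormedAddCommGroup E] [NormedSpace ℝ E] :
    E →L[ℝ] C(Icc (-1 : ℝ) 1, E) :=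
  LinearMap.mkContinuous
    { toFun := fun x => ContinuousMap.const _ x
      map_add' := fun _ _ => rfl
      map_smul' := fun _ _ => rfl } 1 fun x => by
    rw [ContinuousMap.norm_le _ (by positivity)]
    intro s
    change ‖x‖ ≤ 1 * ‖x‖
    rw [one_mul]

/-- The map whose zeros are the rescaled integral curves of `V`. -/
def flowMap (V : C(E, E)) (z : ℝ × E × C(Icc (-1 : ℝ) 1, E)) : ℝ × E × C(Icc (-1 : ℝ) 1, E) :=
  (z.1, z.2.1, z.2.2 - constCurve E z.2.1 - z.1 • integrateCurve E (V.comp z.2.2))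

lemma contDiff_flowMap {V : C(E, E)} (hV : ContDiff ℝ ∞ V) : ContDiff ℝ ∞ (flowMap V) := by
  have hN : ContDiff ℝ ∞ (fun γ : C(Icc (-1 : ℝ) 1, E) => V.comp γ) :=
    contDiff_infty.2 fun n => contDiff_postcomp n V hV
  have h1 : ContDiff ℝ ∞ (fun z : ℝ × E × C(Icc (-1 : ℝ) 1, E) =>
      integrateCurve E (V.comp z.2.2)) :=
    (integrateCurve E).contDiff.comp (hN.comp (contDiff_snd.comp contDiff_snd))
  have h2 : ContDiff ℝ ∞ (fun z : ℝ × E × C(Icc (-1 : ℝ) 1, E) => constCurve E z.2.1) :=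
    (constCurve E).contDiff.comp (contDiff_fst.comp contDiff_snd)
  exact contDiff_fst.prodMk ((contDiff_fst.comp contDiff_snd).prodMk
    (((contDiff_snd.comp contDiff_snd).sub h2).sub (contDiff_fst.smul h1)))

/-- The derivative of `flowMap` at time zero. -/
def flowMapDeriv (w : C(Icc (-1 : ℝ) 1, E)) :
    (ℝ × E × C(Icc (-1 : ℝ) 1, E)) ≃L[ℝ] (ℝ × E × C(Icc (-1 : ℝ) 1, E)) :=
  ContinuousLinearEquiv.equivOfInverse
    ((ContinuousLinearMap.fst ℝ _ _).prod (((ContinuousLinearMap.fst ℝ _ _).comp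
      (ContinuousLinearMap.snd ℝ _ _)).prod ((ContinuousLinearMap.snd ℝ _ _).comp
        (ContinuousLinearMap.snd ℝ _ _) - (constCurve E).comp ((ContinuousLinearMap.fst ℝ _ _).comp
      (ContinuousLinearMap.snd ℝ _ _)) - (ContinuousLinearMap.fst ℝ _ _).smulRight w)))
    ((ContinuousLinearMap.fst ℝ _ _).prod (((ContinuousLinearMap.fst ℝ _ _).comp
      (ContinuousLinearMap.snd ℝ _ _)).prod ((ContinuousLinearMap.snd ℝ _ _).comp
        (ContinuousLinearMap.snd ℝ _ _) + (constCurve E).comp ((ContinuousLinearMap.fst ℝ _ _).comp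
      (ContinuousLinearMap.snd ℝ _ _)) + (ContinuousLinearMap.fst ℝ _ _).smulRight w)))
    (fun z => by
      ext <;> simp
      abel)
    (fun z => by
      ext <;> simp
      abel)

/-- At time scale `0` the integral term contributes only through its coefficient, so the derivative
is triangular with identities on the diagonal and the inverse function theorem applies. -/
lemma hasFDerivAt_flowMap {V : C(E, E)} (hV : ContDiff ℝ ∞ V) (p : E) :
    HasFDerivAt (flowMap V)
      (flowMapDeriv (integrateCurve E (V.comp (constCurve E p))) :
        (ℝ × E × C(Icc (-1 : ℝ) 1, E)) →L[ℝ] (ℝ × E × C(Icc (-1 : ℝ) 1, E)))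
      (0, p, constCurve E p) := by
  have hN : ContDiff ℝ ∞ (fun γ : C(Icc (-1 : ℝ) 1, E) => V.comp γ) :=
    contDiff_infty.2 fun n => contDiff_postcomp n V hV
  have h1 : ContDiff ℝ ∞ (fun z : ℝ × E × C(Icc (-1 : ℝ) 1, E) =>
      integrateCurve E (V.comp z.2.2)) :=
    (integrateCurve E).contDiff.comp (hN.comp (contDiff_snd.comp contDiff_snd))
  let z₀ : ℝ × E × C(Icc (-1 : ℝ) 1, E) := (0, p, constCurve E p)
  have d1 := (h1.differentiable (by simp) z₀).hasFDerivAt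
  have d0 : HasFDerivAt (fun z : ℝ × E × C(Icc (-1 : ℝ) 1, E) => z.1) (ContinuousLinearMap.fst ℝ _ _) z₀ :=
    hasFDerivAt_fst
  have d2 : HasFDerivAt (fun z : ℝ × E × C(Icc (-1 : ℝ) 1, E) => z.2) (ContinuousLinearMap.snd ℝ _ _) z₀ :=
    hasFDerivAt_snd
  have d3 := d2.fst
  have d4 := d2.snd
  have d5 := (constCurve E).hasFDerivAt.comp z₀ d3
  have := d0.prodMk (d3.prodMk ((d4.sub d5).sub (d0.smul d1)))
  refine this.congr_fderiv ?_
  ext z <;> simp [flowMapDeriv, z₀]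

/-- Rescaled integral curves of a smooth vector field depend smoothly on the time scale and on the
initial point. -/
theorem exists_contDiffOn_curves {V : C(E, E)} (hV : ContDiff ℝ ∞ V) (p : E) :
    ∃ ε > 0, ∃ Γ : ℝ × E → C(Icc (-1 : ℝ) 1, E),
      ContDiffOn ℝ ∞ Γ (Ioo (-ε) ε ×ˢ Metric.ball p ε) ∧
      ∀ q ∈ Ioo (-ε) ε ×ˢ Metric.ball p ε,
        Γ q = constCurve E q.2 + q.1 • integrateCurve E (V.comp (Γ q)) := by
  let z₀ : ℝ × E × C(Icc (-1 : ℝ) 1, E) := (0, p, constCurve E p)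
  have hH := contDiff_flowMap hV
  have hz₀ : flowMap V z₀ = (0, p, 0) := by simp [flowMap, z₀]
  let P := (hH.contDiffAt (x := z₀)).toOpenPartialHomeomorph (flowMap V)
    (hasFDerivAt_flowMap hV p) (by simp)
  have hP : ∀ z, P z = flowMap V z := fun z => rfl
  have hs₀ : z₀ ∈ P.source := ContDiffAt.mem_toOpenPartialHomeomorph_source _ _ _
  have ht₀ : (0, p, 0) ∈ P.target := hz₀ ▸ P.map_source hs₀
  have hsymm : P.symm (0, p, 0) = z₀ := by
    rw [← hz₀]
    exact P.left_inv hs₀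
  -- Smoothness of the local inverse is needed on a whole neighbourhood, so the derivative must stay
  -- invertible near `z₀`.
  have hinv : ∀ᶠ z in nhds z₀, fderiv ℝ (flowMap V) z ∈
      range ((↑) : ((ℝ × E × C(Icc (-1 : ℝ) 1, E)) ≃L[ℝ] (ℝ × E × C(Icc (-1 : ℝ) 1, E))) →
        ((ℝ × E × C(Icc (-1 : ℝ) 1, E)) →L[ℝ] (ℝ × E × C(Icc (-1 : ℝ) 1, E)))) := by
    have hc : ContinuousAt (fderiv ℝ (flowMap V)) z₀ :=
      (hH.continuous_fderiv (by simp)).continuousAt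
    refine hc.eventually_mem ?_
    rw [(hasFDerivAt_flowMap hV p).fderiv]
    exact ContinuousLinearEquiv.nhds _
  have hcont : ContinuousAt (fun q : ℝ × E => (q.1, q.2, (0 : C(Icc (-1 : ℝ) 1, E)))) (0, p) := by
    fun_prop
  have hev : ∀ᶠ q : ℝ × E in nhds (0, p), (q.1, q.2, (0 : C(Icc (-1 : ℝ) 1, E))) ∈ P.target ∧
      fderiv ℝ (flowMap V) (P.symm (q.1, q.2, 0)) ∈
      range ((↑) : ((ℝ × E × C(Icc (-1 : ℝ) 1, E)) ≃L[ℝ] (ℝ × E × C(Icc (-1 : ℝ) 1, E))) →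
        ((ℝ × E × C(Icc (-1 : ℝ) 1, E)) →L[ℝ] (ℝ × E × C(Icc (-1 : ℝ) 1, E)))) := by
    have hw : ∀ᶠ w in nhds ((0 : ℝ), p, (0 : C(Icc (-1 : ℝ) 1, E))), w ∈ P.target ∧
        fderiv ℝ (flowMap V) (P.symm w) ∈
      range ((↑) : ((ℝ × E × C(Icc (-1 : ℝ) 1, E)) ≃L[ℝ] (ℝ × E × C(Icc (-1 : ℝ) 1, E))) →
        ((ℝ × E × C(Icc (-1 : ℝ) 1, E)) →L[ℝ] (ℝ × E × C(Icc (-1 : ℝ) 1, E)))) :=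
      (P.open_target.eventually_mem ht₀).and
        ((P.continuousAt_symm ht₀).eventually (hsymm.symm ▸ hinv))
    exact hcont.eventually hw
  obtain ⟨ε, hε, hb⟩ := Metric.eventually_nhds_iff_ball.1 hev
  have hsub : ∀ q ∈ Ioo (-ε) ε ×ˢ Metric.ball p ε, q ∈ Metric.ball ((0 : ℝ), p) ε := by
    rintro ⟨t, x⟩ ⟨ht, hx⟩
    rw [← ball_prod_same, mem_prod]
    refine ⟨?_, hx⟩
    rw [Real.ball_eq_Ioo]
    simpa using ht
  -- The curve with time scale `t` and initial point `x` is the last component of the preimage of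
  -- `(t, x, 0)`.
  refine ⟨ε, hε, fun q => (P.symm (q.1, q.2, 0)).2.2, ?_, ?_⟩
  · intro q hq
    obtain ⟨h1, e, he⟩ := hb q (hsub q hq)
    have hd : HasFDerivAt P (e : (ℝ × E × C(Icc (-1 : ℝ) 1, E)) →L[ℝ]
        (ℝ × E × C(Icc (-1 : ℝ) 1, E))) (P.symm (q.1, q.2, 0)) := by
      rw [he]
      exact (hH.differentiable (by simp) _).hasFDerivAt
    have h2 : ContDiffAt ℝ ∞ P.symm (q.1, q.2, 0) := P.contDiffAt_symm h1 hd hH.contDiffAt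
    have h3 : ContDiffAt ℝ ∞ (fun q : ℝ × E => (q.1, q.2, (0 : C(Icc (-1 : ℝ) 1, E)))) q :=
      contDiffAt_fst.prodMk (contDiffAt_snd.prodMk contDiffAt_const)
    exact (contDiffAt_snd.snd.comp q (h2.comp q h3)).contDiffWithinAt
  · intro q hq
    have h1 := P.right_inv (hb q (hsub q hq)).1
    rw [hP, flowMap] at h1
    have e1 := congrArg (fun z => z.1) h1
    have e2 := congrArg (fun z => z.2.1) h1
    have e3 := congrArg (fun z => z.2.2) h1
    dsimp only at e1 e2 e3 ⊢
    rw [e1, e2, sub_sub, sub_eq_zero] at e3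
    exact e3

end SmoothFlow


/-! ### From rescaled integral curves to a local flow. -/

section LocalFlow

variable {E : Type*} [NormedAddCommGroup E] [NormedSpace ℝ E]

section Complete

variable [CompleteSpace E]

lemma norm_integrateCurve_le (γ : C(Icc (-1 : ℝ) 1, E)) : ‖integrateCurve E γ‖ ≤ ‖γ‖ := by
  rw [ContinuousMap.norm_le _ (norm_nonneg _)]
  intro s
  rw [integrateCurve_apply]
  refine (intervalIntegral.norm_integral_le_of_norm_le_const (C := ‖γ‖)
    fun r _ => ContinuousMap.norm_coe_le_norm _ _).trans ?_
  rw [sub_zero]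
  exact mul_le_of_le_one_right (norm_nonneg _) (abs_le.2 s.2)

/-- The Picard operator contracts by the factor `|t| L < 1`. -/
lemma curve_unique {V : C(E, E)} {L : NNReal} (hL : LipschitzWith L V) {t : ℝ} (ht : |t| * L < 1)
    {x : E} {β γ : C(Icc (-1 : ℝ) 1, E)}
    (hβ : β = constCurve E x + t • integrateCurve E (V.comp β))
    (hγ : γ = constCurve E x + t • integrateCurve E (V.comp γ)) : β = γ := by
  have h1 : β - γ = t • integrateCurve E (V.comp β - V.comp γ) := by
    conv_lhs => rw [hβ, hγ]
    rw [map_sub, smul_sub]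
    abel
  have h2 : ‖V.comp β - V.comp γ‖ ≤ L * ‖β - γ‖ := by
    rw [ContinuousMap.norm_le _ (by positivity)]
    intro s
    have := hL.dist_le_mul (β s) (γ s)
    rw [dist_eq_norm, dist_eq_norm] at this
    exact this.trans (mul_le_mul_of_nonneg_left (ContinuousMap.norm_coe_le_norm (β - γ) s) L.2)
  have h3 : ‖β - γ‖ ≤ |t| * L * ‖β - γ‖ := by
    conv_lhs => rw [h1, norm_smul, Real.norm_eq_abs]
    rw [mul_assoc]
    exact mul_le_mul_of_nonneg_left ((norm_integrateCurve_le _).trans h2) (abs_nonneg t)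
  have h4 : ‖β - γ‖ = 0 := by
    by_contra h
    have : 0 < ‖β - γ‖ := lt_of_le_of_ne (norm_nonneg _) (Ne.symm h)
    nlinarith
  exact sub_eq_zero.1 (norm_eq_zero.1 h4)

/-- The curve `r ↦ γ (σ r)`. -/
def rescaleCurve (γ : C(Icc (-1 : ℝ) 1, E)) (σ : ℝ) : C(Icc (-1 : ℝ) 1, E) :=
  ⟨fun r => extendCurve γ (σ * r),
    (continuous_extendCurve γ).comp (continuous_const.mul continuous_subtype_val)⟩

lemma mul_mem_Icc {σ r : ℝ} (hσ : σ ∈ Icc (-1 : ℝ) 1) (hr : r ∈ Icc (-1 : ℝ) 1) :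
    σ * r ∈ Icc (-1 : ℝ) 1 := by
  rw [mem_Icc, ← abs_le] at *
  rw [abs_mul]
  exact mul_le_one₀ hσ (abs_nonneg r) hr

/-- Substitution `u ↦ σ u` in the integral. With `curve_unique` it identifies the curve of time
scale `σ t` as a reparametrised part of the curve of time scale `t`, so evaluation at `1` defines a
flow. -/
lemma rescaleCurve_eq {V : C(E, E)} {t : ℝ} {x : E} {γ : C(Icc (-1 : ℝ) 1, E)}
    (hγ : γ = constCurve E x + t • integrateCurve E (V.comp γ)) {σ : ℝ}
    (hσ : σ ∈ Icc (-1 : ℝ) 1) :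
    rescaleCurve γ σ
      = constCurve E x + (σ * t) • integrateCurve E (V.comp (rescaleCurve γ σ)) := by
  ext r
  have hr := mul_mem_Icc hσ r.2
  have e1 : rescaleCurve γ σ r = γ ⟨σ * r, hr⟩ := extendCurve_of_mem γ hr
  have e2 := DFunLike.congr_fun hγ ⟨σ * r, hr⟩
  rw [e1, e2]
  change x + t • (∫ u in (0 : ℝ)..σ * r, extendCurve (V.comp γ) u)
    = x + (σ * t) • ∫ u in (0 : ℝ)..r, extendCurve (V.comp (rescaleCurve γ σ)) u
  have e3 : ∫ u in (0 : ℝ)..r, extendCurve (V.comp (rescaleCurve γ σ)) u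
      = ∫ u in (0 : ℝ)..r, extendCurve (V.comp γ) (σ * u) := by
    refine intervalIntegral.integral_congr fun u hu => ?_
    have hu' : u ∈ Icc (-1 : ℝ) 1 :=
      (uIcc_subset_Icc (by norm_num : (0 : ℝ) ∈ Icc (-1 : ℝ) 1) r.2) hu
    change extendCurve (V.comp (rescaleCurve γ σ)) u = extendCurve (V.comp γ) (σ * u)
    rw [extendCurve_of_mem _ hu']
    rfl
  rw [e3, mul_comm σ t, mul_smul, intervalIntegral.smul_integral_comp_mul_left, mul_zero]

/-- A Lipschitz smooth vector field has a smooth flow near each point. -/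
theorem exists_smooth_flow_of_lipschitz {V : C(E, E)} (hV : ContDiff ℝ ∞ V) {L : NNReal}
    (hL : LipschitzWith L V) (p : E) :
    ∃ ε > 0, ∃ θ : ℝ × E → E, ContDiffOn ℝ ∞ θ (Ioo (-ε) ε ×ˢ Metric.ball p ε) ∧
      (∀ x ∈ Metric.ball p ε, θ (0, x) = x) ∧
      ∀ t ∈ Ioo (-ε) ε, ∀ x ∈ Metric.ball p ε,
        HasDerivAt (fun s => θ (s, x)) (V (θ (t, x))) t := by
  obtain ⟨ε₀, hε₀, Γ, hΓ, hΓV⟩ := exists_contDiffOn_curves hV p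
  have hLpos : (0 : ℝ) < L + 1 := by positivity
  -- `L + 1` rather than `L` keeps the denominator positive and gives `|t| L < 1`.
  set ε := min ε₀ (1 / (L + 1)) with hε
  have hεpos : 0 < ε := lt_min hε₀ (by positivity)
  have hεL : ∀ t ∈ Ioo (-ε) ε, |t| * L < 1 := by
    intro t ht
    have h1 : |t| < 1 / (L + 1) := (abs_lt.2 ht).trans_le (min_le_right _ _)
    rw [lt_div_iff₀ hLpos] at h1
    nlinarith [abs_nonneg t]
  have hsub : Ioo (-ε) ε ×ˢ Metric.ball p ε ⊆ Ioo (-ε₀) ε₀ ×ˢ Metric.ball p ε₀ := by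
    have : ε ≤ ε₀ := min_le_left _ _
    exact prod_mono (Ioo_subset_Ioo (by linarith) this) (Metric.ball_subset_ball this)
  have one_mem : (1 : ℝ) ∈ Icc (-1 : ℝ) 1 := by norm_num
  let e : C(Icc (-1 : ℝ) 1, E) →L[ℝ] E := ContinuousMap.evalCLM ℝ ⟨1, one_mem⟩
  have he : ∀ γ, e γ = γ ⟨1, one_mem⟩ := fun γ => rfl
  have key : ∀ t₀ ∈ Ioo (-ε) ε, ∀ x ∈ Metric.ball p ε, ∀ σ ∈ Icc (-1 : ℝ) 1,
      e (Γ (σ * t₀, x)) = extendCurve (Γ (t₀, x)) σ := by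
    intro t₀ ht₀ x hx σ hσ
    have hσt : σ * t₀ ∈ Ioo (-ε) ε := by
      rw [mem_Ioo, ← abs_lt, abs_mul] at *
      exact lt_of_le_of_lt (mul_le_of_le_one_left (abs_nonneg _) (abs_le.2 hσ)) ht₀
    have h1 := rescaleCurve_eq (hΓV (t₀, x) (hsub ⟨ht₀, hx⟩)) hσ
    have h2 := curve_unique hL (hεL _ hσt) (hΓV (σ * t₀, x) (hsub ⟨hσt, hx⟩)) h1
    rw [h2, he]
    change extendCurve (Γ (t₀, x)) (σ * 1) = _
    rw [mul_one]
  refine ⟨ε, hεpos, fun q => e (Γ q), e.contDiff.comp_contDiffOn (hΓ.mono hsub), ?_, ?_⟩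
  · intro x hx
    have h0 : ((0 : ℝ), x) ∈ Ioo (-ε) ε ×ˢ Metric.ball p ε := ⟨⟨by linarith, hεpos⟩, hx⟩
    change e (Γ (0, x)) = x
    rw [hΓV _ (hsub h0), zero_smul, add_zero]
    rfl
  · intro t ht x hx
    -- A time scale strictly between `|t|` and `ε`: near `t` the flow is read off the single curve
    -- `Γ (t₀, x)` at the interior parameter `t / t₀`.
    set t₀ := (|t| + ε) / 2 with ht₀
    have htε : |t| < ε := abs_lt.2 ht
    have h0 : 0 < t₀ := by have := abs_nonneg t; linarith
    have htt : |t| < t₀ := by linarith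
    have ht₀' : t₀ ∈ Ioo (-ε) ε := ⟨by linarith, by linarith⟩
    set γ := Γ (t₀, x) with hγ
    have hmem : ∀ u, |u| < t₀ → u / t₀ ∈ Icc (-1 : ℝ) 1 := by
      intro u hu
      rw [mem_Icc, ← abs_le, abs_div, abs_of_pos h0, div_le_one h0]
      exact hu.le
    have hθ : ∀ u, |u| < t₀ → e (Γ (u, x)) = extendCurve γ (u / t₀) := by
      intro u hu
      have := key t₀ ht₀' x hx (u / t₀) (hmem u hu)
      rwa [div_mul_cancel₀ _ h0.ne'] at this
    have hint : ∀ u, |u| < t₀ → e (Γ (u, x))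
        = x + t₀ • ∫ r in (0 : ℝ)..u / t₀, extendCurve (V.comp γ) r := by
      intro u hu
      rw [hθ u hu, extendCurve_of_mem _ (hmem u hu)]
      exact DFunLike.congr_fun (hΓV (t₀, x) (hsub ⟨ht₀', hx⟩)) ⟨u / t₀, hmem u hu⟩
    have hd1 : HasDerivAt (fun s => ∫ r in (0 : ℝ)..s, extendCurve (V.comp γ) r)
        (extendCurve (V.comp γ) (t / t₀)) (t / t₀) :=
      (continuous_extendCurve _).integral_hasStrictDerivAt 0 (t / t₀) |>.hasDerivAt
    have hd2 : HasDerivAt (fun u : ℝ => u / t₀) (1 / t₀) t := (hasDerivAt_id t).div_const t₀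
    have hd3 := ((hd1.scomp t hd2).const_smul t₀).const_add x
    have hev : (fun u => e (Γ (u, x))) =ᶠ[nhds t] fun u =>
        x + t₀ • ∫ r in (0 : ℝ)..u / t₀, extendCurve (V.comp γ) r := by
      have : ∀ᶠ u in nhds t, |u| < t₀ := continuous_abs.continuousAt.eventually_lt
        continuousAt_const htt
      filter_upwards [this] with u hu using hint u hu
    refine (hd3.congr_of_eventuallyEq hev).congr_deriv ?_
    rw [smul_smul, mul_one_div_cancel h0.ne', one_smul]
    change extendCurve (V.comp γ) (t / t₀) = V (e (Γ (t, x)))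
    rw [hθ t htt]
    rfl

end Complete

variable [FiniteDimensional ℝ E]

/-- A smooth vector field on an open set has a smooth flow near each point. -/
theorem exists_smooth_flow {U : Set E} (hU : IsOpen U) {V : E → E} (hV : ContDiffOn ℝ ∞ V U)
    {p : E} (hp : p ∈ U) :
    ∃ ε > 0, ∃ θ : ℝ × E → E, ContDiffOn ℝ ∞ θ (Ioo (-ε) ε ×ˢ Metric.ball p ε) ∧
      (∀ x ∈ Metric.ball p ε, θ (0, x) = x) ∧
      (∀ t ∈ Ioo (-ε) ε, ∀ x ∈ Metric.ball p ε, θ (t, x) ∈ U) ∧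
      ∀ t ∈ Ioo (-ε) ε, ∀ x ∈ Metric.ball p ε,
        HasDerivAt (fun s => θ (s, x)) (V (θ (t, x))) t := by
  have : CompleteSpace E := FiniteDimensional.complete ℝ E
  obtain ⟨δ, hδ, hδU⟩ := Metric.isOpen_iff.1 hU p hp
  -- The cut-off makes the field compactly supported, hence globally Lipschitz, without changing it
  -- on the ball of radius `δ / 3`, where the flow is kept for short times.
  let χ : ContDiffBump p := ⟨δ / 3, δ / 2, by linarith, by linarith⟩
  let W : E → E := fun x => χ x • V x
  have hW : ContDiff ℝ ∞ W := by
    rw [contDiff_iff_contDiffAt]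
    intro x
    by_cases hx : x ∈ U
    · exact χ.contDiff.contDiffAt.smul (hV.contDiffAt (hU.mem_nhds hx))
    · have hx' : x ∉ tsupport χ := by
        intro h
        rw [χ.tsupport_eq] at h
        exact hx (hδU ((Metric.closedBall_subset_ball (by change δ / 2 < δ; linarith)) h))
      have hev : W =ᶠ[nhds x] fun _ => 0 := by
        have := notMem_tsupport_iff_eventuallyEq.1 hx'
        filter_upwards [this] with z hz
        simp [W, hz]
      exact contDiffAt_const.congr_of_eventuallyEq hev
  have hWc : HasCompactSupport W := χ.hasCompactSupport.smul_right
  obtain ⟨L, hL⟩ := hW.lipschitzWith_of_hasCompactSupport hWc (by simp)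
  obtain ⟨ε₀, hε₀, θ, hθ, hθ0, hθd⟩ := exists_smooth_flow_of_lipschitz (V := ⟨W, hW.continuous⟩)
    hW hL p
  have hpm : ((0 : ℝ), p) ∈ Ioo (-ε₀) ε₀ ×ˢ Metric.ball p ε₀ :=
    ⟨⟨by linarith, hε₀⟩, Metric.mem_ball_self hε₀⟩
  have hc : ContinuousAt θ (0, p) := hθ.continuousOn.continuousAt
    ((isOpen_Ioo.prod Metric.isOpen_ball).mem_nhds hpm)
  have hev : ∀ᶠ q in nhds ((0 : ℝ), p), θ q ∈ Metric.ball p (δ / 3) := by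
    refine hc.eventually_mem (Metric.isOpen_ball.mem_nhds ?_)
    rw [hθ0 p (Metric.mem_ball_self hε₀)]
    exact Metric.mem_ball_self (by linarith)
  obtain ⟨ε₁, hε₁, hb⟩ := Metric.eventually_nhds_iff_ball.1 hev
  have hle0 : min ε₀ ε₁ ≤ ε₀ := min_le_left _ _
  have hsub : Ioo (-min ε₀ ε₁) (min ε₀ ε₁) ×ˢ Metric.ball p (min ε₀ ε₁)
      ⊆ Ioo (-ε₀) ε₀ ×ˢ Metric.ball p ε₀ :=
    prod_mono (Ioo_subset_Ioo (by linarith) hle0) (Metric.ball_subset_ball hle0)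
  have hball : ∀ t ∈ Ioo (-min ε₀ ε₁) (min ε₀ ε₁), ∀ x ∈ Metric.ball p (min ε₀ ε₁),
      θ (t, x) ∈ Metric.ball p (δ / 3) := by
    intro t ht x hx
    refine hb _ ?_
    rw [← ball_prod_same, mem_prod]
    refine ⟨?_, Metric.ball_subset_ball (min_le_right _ _) hx⟩
    rw [Real.ball_eq_Ioo]
    have : min ε₀ ε₁ ≤ ε₁ := min_le_right _ _
    exact ⟨by linarith [ht.1], by linarith [ht.2]⟩
  refine ⟨min ε₀ ε₁, lt_min hε₀ hε₁, θ, hθ.mono hsub,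
    fun x hx => hθ0 x (Metric.ball_subset_ball hle0 hx), fun t ht x hx => ?_, fun t ht x hx => ?_⟩
  · exact hδU (Metric.ball_subset_ball (by linarith) (hball t ht x hx))
  · have h1 := hθd t (hsub ⟨ht, hx⟩ : (t, x) ∈ _).1 x (hsub ⟨ht, hx⟩ : (t, x) ∈ _).2
    have h2 : χ (θ (t, x)) = 1 :=
      χ.one_of_mem_closedBall (Metric.ball_subset_closedBall (hball t ht x hx))
    have h3 : W (θ (t, x)) = V (θ (t, x)) := by simp [W, h2]
    exact h3 ▸ h1

end LocalFlow

/-! ## Leaves of the contact distribution -/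

section ChainRule

variable {E F H : Type*} [NormedAddCommGroup E] [NormedSpace ℝ E] [NormedAddCommGroup F]
  [NormedSpace ℝ F] [FiniteDimensional ℝ F] [NormedAddCommGroup H] [NormedSpace ℝ H]

omit [FiniteDimensional ℝ F] in
lemma fderiv_clm_comp_apply {A : F → (F →L[ℝ] H)} {σ b : E → F} {z : E}
    (hA : ContDiffAt ℝ ∞ A (σ z)) (hσ : ContDiffAt ℝ ∞ σ z) (hb : ContDiffAt ℝ ∞ b z) (w : E) :
    fderiv ℝ (fun x => A (σ x) (b x)) z w
      = fderiv ℝ (fun y => A y (b z)) (σ z) (fderiv ℝ σ z w) + A (σ z) (fderiv ℝ b z w) := by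
  have hAσ : ContDiffAt ℝ ∞ (fun x => A (σ x)) z := hA.comp z hσ
  rw [fderiv_clm_apply_apply hAσ hb, fderiv_clm_apply_const hA]
  congr 2
  exact congrArg (fun L => L w)
    (fderiv_comp z hA.differentiableAt_infty hσ.differentiableAt_infty)

lemma fderiv_bilin_comp_apply {B : F → (F →L[ℝ] F →L[ℝ] ℝ)} {σ a b : E → F} {z : E}
    (hB : ContDiffAt ℝ ∞ B (σ z)) (hσ : ContDiffAt ℝ ∞ σ z) (ha : ContDiffAt ℝ ∞ a z)
    (hb : ContDiffAt ℝ ∞ b z) (w : E) :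
    fderiv ℝ (fun x => B (σ x) (a x) (b x)) z w
      = fderiv ℝ (fun y => B y (a z) (b z)) (σ z) (fderiv ℝ σ z w)
        + B (σ z) (fderiv ℝ a z w) (b z) + B (σ z) (a z) (fderiv ℝ b z w) := by
  have hBσ : ContDiffAt ℝ ∞ (fun x => B (σ x)) z := hB.comp z hσ
  rw [fderiv_clm_apply_apply (hBσ.clm_apply ha) hb,
    ← fderiv_clm_apply_const (hBσ.clm_apply ha)]
  let A : F → (F →L[ℝ] ℝ) := fun y => (B y).flip (b z)
  have hA : ContDiffAt ℝ ∞ A (σ z) := contDiffAt_clm_of_apply fun u =>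
    (hB.clm_apply contDiffAt_const).clm_apply contDiffAt_const
  have := fderiv_clm_comp_apply hA hσ ha w
  exact congrArg (· + _) this

end ChainRule

/-! ### The Kähler structure of a leaf of `ker η`. -/

section Leaf

variable {k m : ℕ}

/-- Tensoriality of the torsion: the derivatives of `X` and `Y` cancel, so it may be computed on
constant fields. -/
lemma nijenhuis_eq {Φ : Coord m → (Coord m →L[ℝ] Coord m)} {X Y : Coord m → Coord m} {y : Coord m}
    (hΦ : ContDiffAt ℝ ∞ Φ y) (hX : ContDiffAt ℝ ∞ X y) (hY : ContDiffAt ℝ ∞ Y y) :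
    nijenhuis Φ X Y y = fderiv ℝ (fun z => Φ z (Y y)) y (Φ y (X y))
      - fderiv ℝ (fun z => Φ z (X y)) y (Φ y (Y y))
      + Φ y (fderiv ℝ (fun z => Φ z (X y)) y (Y y))
      - Φ y (fderiv ℝ (fun z => Φ z (Y y)) y (X y)) := by
  simp only [nijenhuis, VectorField.lieBracket, fderiv_clm_apply_apply hΦ hX,
    fderiv_clm_apply_apply hΦ hY, fderiv_clm_apply_const hΦ, map_sub, map_add]
  abel

variable {V : Set (Coord k)} {σ : Coord k → Coord m} {J : Coord k → (Coord k →L[ℝ] Coord k)}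
  {U : Set (Coord m)} {G : Coord m → (Coord m →L[ℝ] Coord m →L[ℝ] ℝ)}
  {Φ : Coord m → (Coord m →L[ℝ] Coord m)} {ξ : Coord m → Coord m} {η : Coord m → (Coord m →L[ℝ] ℝ)}
  {f : Coord m → ℝ}

/-- The pull-back of a field of bilinear forms. -/
def pullBilin (σ : Coord k → Coord m) (G : Coord m → (Coord m →L[ℝ] Coord m →L[ℝ] ℝ))
    (z : Coord k) : Coord k →L[ℝ] Coord k →L[ℝ] ℝ :=
  (G (σ z)).bilinearComp (fderiv ℝ σ z) (fderiv ℝ σ z)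

lemma pullBilin_apply (z u v : Coord k) :
    pullBilin σ G z u v = G (σ z) (fderiv ℝ σ z u) (fderiv ℝ σ z v) := rfl

/-- A leaf of the contact distribution of a structure with `f = 0` is a Kähler manifold. -/
theorem IsFCosymplecticOn.isKahler_pullBilin (h : IsFCosymplecticOn U G Φ ξ η f)
    (hf : ∀ y ∈ U, f y = 0) (hV : IsOpen V) (hσ : ContDiffOn ℝ ∞ σ V) (hσU : MapsTo σ V U)
    (hJ : ContDiffOn ℝ ∞ J V) (hσinj : ∀ z ∈ V, Function.Injective (fderiv ℝ σ z))
    (hη : ∀ z ∈ V, ∀ u, η (σ z) (fderiv ℝ σ z u) = 0)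
    (hΦJ : ∀ z ∈ V, ∀ u, Φ (σ z) (fderiv ℝ σ z u) = fderiv ℝ σ z (J z u)) :
    IsKahler V (pullBilin σ G) J := by
  have hσc : ∀ z ∈ V, ContDiffAt ℝ ∞ σ z := fun z hz => hσ.contDiffAt (hV.mem_nhds hz)
  have hdσ : ∀ z ∈ V, ∀ u, ContDiffAt ℝ ∞ (fun x => fderiv ℝ σ x u) z := fun z hz u =>
    (hσc z hz).fderiv_infty.clm_apply contDiffAt_const
  have hJc : ∀ z ∈ V, ContDiffAt ℝ ∞ J z := fun z hz => hJ.contDiffAt (hV.mem_nhds hz)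
  have hsq : ∀ z ∈ V, ∀ u, J z (J z u) = -u := by
    intro z hz u
    refine hσinj z hz ?_
    rw [← hΦJ z hz, ← hΦJ z hz, h.Φ_sq _ (hσU hz), hη z hz, map_neg, zero_smul, add_zero]
  have hherm : ∀ z ∈ V, ∀ u v, pullBilin σ G z (J z u) (J z v) = pullBilin σ G z u v := by
    intro z hz u v
    simp only [pullBilin_apply]
    rw [← hΦJ z hz, ← hΦJ z hz, h.G_Φ _ (hσU hz), hη z hz, zero_mul, sub_zero]
  refine ⟨hV, ?_, ?_, ?_, hJ, hsq, hherm, ?_, ?_⟩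
  · intro z hz
    refine (contDiffAt_clm_of_apply fun u => contDiffAt_clm_of_apply fun v => ?_).contDiffWithinAt
    have h1 : ContDiffAt ℝ ∞ (fun x => G (σ x)) z :=
      (h.metric.contDiffAt (hσU hz)).comp z (hσc z hz)
    exact (h1.clm_apply (hdσ z hz u)).clm_apply (hdσ z hz v)
  · intro z hz u v
    exact h.metric.symm _ (hσU hz) _ _
  · intro z hz u hu
    refine h.metric.pos _ (hσU hz) _ fun h0 => hu (hσinj z hz ?_)
    exact h0.trans (map_zero _).symm
  · intro X Y hX hY z hz
    rw [nijenhuis_eq (hJc z hz) (hX.contDiffAt (hV.mem_nhds hz))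
      (hY.contDiffAt (hV.mem_nhds hz))]
    set u := X z
    set v := Y z
    have hΦc := h.contDiffAt_Φ (hσU hz)
    have hd : ∀ b w : Coord k, fderiv ℝ (fun x => fderiv ℝ σ x b) z w
        = fderiv ℝ (fun x => fderiv ℝ σ x w) z b := by
      intro b w
      rw [fderiv_clm_apply_const (hσc z hz).fderiv_infty,
        fderiv_clm_apply_const (hσc z hz).fderiv_infty, (hσc z hz).fderiv_fderiv_comm]
    -- This is the derivative of `Φ ∘ dσ = dσ ∘ J`. In the torsion the second derivatives of `σ`
    -- cancel by symmetry, so `dσ` carries the torsion of `J` to that of `Φ`.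
    have key : ∀ w b : Coord k,
        fderiv ℝ (fun y => Φ y (fderiv ℝ σ z b)) (σ z) (fderiv ℝ σ z w)
          = fderiv ℝ σ z (fderiv ℝ (fun x => J x b) z w)
            + fderiv ℝ (fun x => fderiv ℝ σ x w) z (J z b)
            - Φ (σ z) (fderiv ℝ (fun x => fderiv ℝ σ x b) z w) := by
      intro w b
      have e1 := fderiv_clm_comp_apply hΦc (hσc z hz) (hdσ z hz b) w
      have e2 := fderiv_clm_apply_apply (hσc z hz).fderiv_infty
        ((hJc z hz).clm_apply (contDiffAt_const (c := b))) w
      rw [fderiv_eq_of_eqOn hV (fun x hx => hΦJ x hx b) hz, e2,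
        ← fderiv_clm_apply_const (hσc z hz).fderiv_infty, hd] at e1
      rw [eq_sub_iff_add_eq, ← e1]
      abel
    have hN := nijenhuis_eq hΦc (contDiffAt_const (c := fderiv ℝ σ z u))
      (contDiffAt_const (c := fderiv ℝ σ z v))
    have hN0 := h.normal (fun _ => fderiv ℝ σ z u) (fun _ => fderiv ℝ σ z v) contDiffOn_const
      contDiffOn_const _ (hσU hz)
    rw [h.dη _ (hσU hz), zero_smul, add_zero, hN, hΦJ z hz, hΦJ z hz, key, key, key, key] at hN0
    refine hσinj z hz ?_
    rw [map_zero, ← hN0]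
    simp only [map_add, map_sub, hΦJ z hz]
    rw [hd (J z v) (J z u), hd v u]
    abel
  · intro z hz a b c
    let B : Coord m → (Coord m →L[ℝ] Coord m →L[ℝ] ℝ) := fun y => (G y).comp (Φ y)
    have hB : ContDiffAt ℝ ∞ B (σ z) :=
      (h.metric.contDiffAt (hσU hz)).clm_comp (h.contDiffAt_Φ (hσU hz))
    have hBa : ∀ u v, B (σ z) u v = -B (σ z) v u := by
      intro u v
      change G (σ z) (Φ (σ z) u) v = -G (σ z) (Φ (σ z) v) u
      rw [h.metric_Φ_skew (hσU hz), h.metric.symm _ (hσU hz)]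
    have hd : ∀ u v w : Coord k, fderiv ℝ (fun x => fundamentalForm (pullBilin σ G) J x u v) z w
        = fderiv ℝ (fun y => fundamentalForm G Φ y (fderiv ℝ σ z u) (fderiv ℝ σ z v)) (σ z)
            (fderiv ℝ σ z w)
          + B (σ z) (fderiv ℝ (fderiv ℝ σ) z w u) (fderiv ℝ σ z v)
          + B (σ z) (fderiv ℝ σ z u) (fderiv ℝ (fderiv ℝ σ) z w v) := by
      intro u v w
      have e1 := fderiv_bilin_comp_apply hB (hσc z hz) (hdσ z hz u) (hdσ z hz v) w
      have e2 : EqOn (fun x => fundamentalForm (pullBilin σ G) J x u v)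
          (fun x => B (σ x) (fderiv ℝ σ x u) (fderiv ℝ σ x v)) V := by
        intro x hx
        change G (σ x) (fderiv ℝ σ x (J x u)) (fderiv ℝ σ x v)
          = G (σ x) (Φ (σ x) (fderiv ℝ σ x u)) (fderiv ℝ σ x v)
        rw [hΦJ x hx]
      rw [fderiv_eq_of_eqOn hV e2 hz, e1, fderiv_clm_apply_const (hσc z hz).fderiv_infty,
        fderiv_clm_apply_const (hσc z hz).fderiv_infty]
      rfl
    have hω := h.dω _ (hσU hz) (fderiv ℝ σ z a) (fderiv ℝ σ z b) (fderiv ℝ σ z c)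
    rw [hf _ (hσU hz), mul_zero, zero_mul, dTwo] at hω
    rw [dTwo, hd, hd, hd]
    -- The six terms with second derivatives of `σ` cancel in pairs, since `ω` is skew and these
    -- derivatives are symmetric; what remains is the pull-back of `dω = 0`.
    have hs : ∀ u v, fderiv ℝ (fderiv ℝ σ) z u v = fderiv ℝ (fderiv ℝ σ) z v u :=
      fun u v => (hσc z hz).fderiv_fderiv_comm u v
    rw [hs b a, hs c a, hs c b, hBa (fderiv ℝ (fderiv ℝ σ) z a b),
      hBa (fderiv ℝ (fderiv ℝ σ) z a c), hBa (fderiv ℝ (fderiv ℝ σ) z b c)]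
    linarith

end Leaf

/-! ### A potential of the contact form and the map that flows its zero level along the Reeb field.
-/

section LocalProduct

variable {k m : ℕ}

lemma eq_of_fderiv_snd_eq_zero {E H : Type*} [NormedAddCommGroup E] [NormedSpace ℝ E]
    [NormedAddCommGroup H] [NormedSpace ℝ H] {A : E × ℝ → H} {z : E} {a b : ℝ}
    (hA : ∀ t ∈ Ioo a b, DifferentiableAt ℝ A (z, t))
    (hA' : ∀ t ∈ Ioo a b, fderiv ℝ A (z, t) (0, 1) = 0) {s t : ℝ} (hs : s ∈ Ioo a b)
    (ht : t ∈ Ioo a b) : A (z, s) = A (z, t) := by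
  have hd : ∀ t ∈ Ioo a b, HasDerivAt (fun r => A (z, r)) 0 t := by
    intro t ht
    have h1 : HasDerivAt (fun r : ℝ => (z, r)) ((0 : E), (1 : ℝ)) t :=
      (hasDerivAt_const t z).prodMk (hasDerivAt_id t)
    have := (hA t ht).hasFDerivAt.comp_hasDerivAt t h1
    rwa [hA' t ht] at this
  exact isOpen_Ioo.is_const_of_deriv_eq_zero isPreconnected_Ioo (f := fun r => A (z, r))
    (fun t ht => (hd t ht).differentiableAt.differentiableWithinAt) (fun t ht => (hd t ht).deriv)
    hs ht

namespace IsFCosymplecticOn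

variable {U : Set (Coord m)} {G : Coord m → (Coord m →L[ℝ] Coord m →L[ℝ] ℝ)}
  {Φ : Coord m → (Coord m →L[ℝ] Coord m)} {ξ : Coord m → Coord m} {η : Coord m → (Coord m →L[ℝ] ℝ)}
  {f : Coord m → ℝ} {p : Coord m}

/-- The Poincaré lemma on a ball, for `dη = 0`. The level sets of `τ` are the leaves of `ker η`, so
Frobenius' theorem is not needed. -/
lemma exists_potential (h : IsFCosymplecticOn U G Φ ξ η f) (hp : p ∈ U) :
    ∃ r > 0, Metric.ball p r ⊆ U ∧ ∃ τ : Coord m → ℝ, ContDiffOn ℝ ∞ τ (Metric.ball p r) ∧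
      (∀ x ∈ Metric.ball p r, HasFDerivAt τ (η x) x) ∧ τ p = 0 := by
  obtain ⟨r, hr, hrU⟩ := Metric.isOpen_iff.1 h.metric.isOpen p hp
  obtain ⟨τ, hτ⟩ := (convex_ball p r).exists_forall_hasFDerivAt_of_fderiv_symmetric
    Metric.isOpen_ball
    (fun x hx => (h.contDiffAt_η (hrU hx)).differentiableAt_infty.differentiableWithinAt)
    (fun a ha x y => h.fderiv_η_symm (hrU ha) x y)
  refine ⟨r, hr, hrU, fun x => τ x - τ p, ?_, fun x hx => (hτ x hx).sub_const _, sub_self _⟩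
  rw [contDiffOn_infty_iff_fderiv_of_isOpen Metric.isOpen_ball]
  refine ⟨fun x hx => ((hτ x hx).sub_const _).differentiableAt.differentiableWithinAt, ?_⟩
  exact (h.smooth_η.mono hrU).congr fun x hx => ((hτ x hx).sub_const _).fderiv

end IsFCosymplecticOn

lemma exists_ker_parametrization (α : Coord (k + 1) →L[ℝ] ℝ) (hα : α ≠ 0) :
    ∃ ι : Coord k →L[ℝ] Coord (k + 1), Function.Injective ι ∧ ∀ u, α (ι u) = 0 := by
  have hα' : (α : Coord (k + 1) →ₗ[ℝ] ℝ) ≠ 0 := fun h0 => hα (by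
    ext u
    exact congrArg (fun L : Coord (k + 1) →ₗ[ℝ] ℝ => L u) h0)
  have h1 : Module.finrank ℝ (LinearMap.ker (α : Coord (k + 1) →ₗ[ℝ] ℝ)) + 1
      = Module.finrank ℝ (Coord (k + 1)) :=
    Module.Dual.finrank_ker_add_one_of_ne_zero hα'
  have h2 : Module.finrank ℝ (Coord k)
      = Module.finrank ℝ (LinearMap.ker (α : Coord (k + 1) →ₗ[ℝ] ℝ)) := by
    rw [finrank_euclideanSpace_fin] at h1 ⊢
    omega
  let e := LinearEquiv.ofFinrankEq _ _ h2
  refine ⟨LinearMap.toContinuousLinearMap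
    ((LinearMap.ker (α : Coord (k + 1) →ₗ[ℝ] ℝ)).subtype ∘ₗ e.toLinearMap), ?_, ?_⟩
  · intro u v huv
    exact e.injective (Subtype.ext huv)
  · intro u
    exact (e u).2

namespace IsFCosymplecticOn

variable {U : Set (Coord (k + 1))}
  {G : Coord (k + 1) → (Coord (k + 1) →L[ℝ] Coord (k + 1) →L[ℝ] ℝ)}
  {Φ : Coord (k + 1) → (Coord (k + 1) →L[ℝ] Coord (k + 1))} {ξ : Coord (k + 1) → Coord (k + 1)}
  {η : Coord (k + 1) → (Coord (k + 1) →L[ℝ] ℝ)} {f : Coord (k + 1) → ℝ} {p : Coord (k + 1)}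

/-- Flowing out of a leaf of the contact distribution along the Reeb field. -/
lemma exists_adapted_map (h : IsFCosymplecticOn U G Φ ξ η f) (hp : p ∈ U) :
    ∃ δ > 0, ∃ Ψ : Coord k × ℝ → Coord (k + 1), Ψ 0 = p ∧
      ContDiffOn ℝ ∞ Ψ (Metric.ball 0 δ) ∧ MapsTo Ψ (Metric.ball 0 δ) U ∧
      (∀ q ∈ Metric.ball (0 : Coord k × ℝ) δ, fderiv ℝ Ψ q (0, 1) = ξ (Ψ q)) ∧
      (∀ q ∈ Metric.ball (0 : Coord k × ℝ) δ, ∀ w, η (Ψ q) (fderiv ℝ Ψ q w) = w.2) ∧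
      Function.Injective (fderiv ℝ Ψ 0) := by
  obtain ⟨r, hr, hrU, τ, hτ, hτη, hτp⟩ := h.exists_potential hp
  have hpr : p ∈ Metric.ball p r := Metric.mem_ball_self hr
  obtain ⟨ε, hε, θ, hθ, hθ0, hθU, hθd⟩ := exists_smooth_flow Metric.isOpen_ball
    (h.smooth_ξ.mono hrU) hpr
  obtain ⟨ι, hι, hηι⟩ := exists_ker_parametrization (η p) (fun h0 => by
    have := h.η_ξ p hp
    rw [h0] at this
    simp at this)
  -- The point `p + ι z` is flowed for the time `t - τ(p + ι z)`. As `τ` grows at unit speed along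
  -- the flow, it takes the value `t` at the image; the slice `t = 0` thus lies in the leaf `τ = 0`,
  -- although `p + ι z` need not.
  let c : Coord k × ℝ → ℝ × Coord (k + 1) := fun q => (q.2 - τ (p + ι q.1), p + ι q.1)
  have hc0 : c 0 = (0, p) := by simp [c, hτp]
  set B := Ioo (-ε) ε ×ˢ Metric.ball p ε with hB
  have hBo : IsOpen B := isOpen_Ioo.prod Metric.isOpen_ball
  have hx : ContDiff ℝ ∞ (fun q : Coord k × ℝ => p + ι q.1) :=
    contDiff_const.add (ι.contDiff.comp contDiff_fst)
  have hcs : ∀ q : Coord k × ℝ, p + ι q.1 ∈ Metric.ball p r → ContDiffAt ℝ ∞ c q := by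
    intro q hq
    have h1 : ContDiffAt ℝ ∞ τ (p + ι q.1) := hτ.contDiffAt (Metric.isOpen_ball.mem_nhds hq)
    exact (contDiffAt_snd.sub (h1.comp q hx.contDiffAt)).prodMk hx.contDiffAt
  have h0r : p + ι (0 : Coord k × ℝ).1 ∈ Metric.ball p r := by simpa using hr
  have hc0s := hcs 0 h0r
  have hev : ∀ᶠ q in nhds (0 : Coord k × ℝ), p + ι q.1 ∈ Metric.ball p r ∧ c q ∈ B := by
    refine (hx.continuous.continuousAt.eventually_mem (Metric.isOpen_ball.mem_nhds h0r)).and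
      (hc0s.continuousAt.eventually_mem (hBo.mem_nhds ?_))
    rw [hc0]
    exact ⟨⟨by linarith, hε⟩, Metric.mem_ball_self hε⟩
  obtain ⟨δ, hδ, hb⟩ := Metric.eventually_nhds_iff_ball.1 hev
  have hθs : ∀ q ∈ B, ContDiffAt ℝ ∞ θ q := fun q hq => hθ.contDiffAt (hBo.mem_nhds hq)
  have hΨs : ∀ q ∈ Metric.ball (0 : Coord k × ℝ) δ, ContDiffAt ℝ ∞ (fun q => θ (c q)) q :=
    fun q hq => (hθs _ (hb q hq).2).comp q (hcs q (hb q hq).1)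
  have hτθ : ∀ t ∈ Ioo (-ε) ε, ∀ x ∈ Metric.ball p ε, x ∈ Metric.ball p r →
      τ (θ (t, x)) = τ x + t := by
    intro t ht x hx hxr
    have hd : ∀ s ∈ Ioo (-ε) ε, HasDerivAt (fun s => τ (θ (s, x)) - s) 0 s := by
      intro s hs
      have h1 := (hτη _ (hθU s hs x hx)).comp_hasDerivAt s (hθd s hs x hx)
      rw [h.η_ξ _ (hrU (hθU s hs x hx))] at h1
      have h2 := h1.sub (hasDerivAt_id s)
      rwa [sub_self] at h2
    have h0 : (0 : ℝ) ∈ Ioo (-ε) ε := ⟨by linarith, hε⟩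
    have := isOpen_Ioo.is_const_of_deriv_eq_zero isPreconnected_Ioo
      (f := fun s => τ (θ (s, x)) - s)
      (fun s hs => (hd s hs).differentiableAt.differentiableWithinAt)
      (fun s hs => (hd s hs).deriv) ht h0
    rw [hθ0 x hx] at this
    linarith
  have hΨτ : ∀ q ∈ Metric.ball (0 : Coord k × ℝ) δ, τ (θ (c q)) = q.2 := by
    intro q hq
    obtain ⟨h1, h2⟩ := hb q hq
    rw [hτθ _ h2.1 _ h2.2 h1]
    ring
  have hΨU : ∀ q ∈ Metric.ball (0 : Coord k × ℝ) δ, θ (c q) ∈ Metric.ball p r := fun q hq =>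
    hθU _ (hb q hq).2.1 _ (hb q hq).2.2
  have hη : ∀ q ∈ Metric.ball (0 : Coord k × ℝ) δ, ∀ w,
      η (θ (c q)) (fderiv ℝ (fun q => θ (c q)) q w) = w.2 := by
    intro q hq w
    have h1 := (hτη _ (hΨU q hq)).comp q (hΨs q hq).differentiableAt_infty.hasFDerivAt
    have h2 : fderiv ℝ (fun q => τ (θ (c q))) q = fderiv ℝ (fun q : Coord k × ℝ => q.2) q :=
      fderiv_eq_of_eqOn Metric.isOpen_ball (fun q hq => hΨτ q hq) hq
    have h3 : fderiv ℝ (fun q => τ (θ (c q))) q = (η (θ (c q))).comp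
      (fderiv ℝ (fun q => θ (c q)) q) := h1.fderiv
    have h4 := congrArg (fun L => L w) (h3.symm.trans h2)
    rw [fderiv_snd] at h4
    exact h4
  have h0δ : (0 : Coord k × ℝ) ∈ Metric.ball 0 δ := Metric.mem_ball_self hδ
  refine ⟨δ, hδ, fun q => θ (c q), ?_, fun q hq => (hΨs q hq).contDiffWithinAt,
    fun q hq => hrU (hΨU q hq), ?_, hη, ?_⟩
  · change θ (c 0) = p
    rw [hc0, hθ0 p (Metric.mem_ball_self hε)]
  · intro q hq
    obtain ⟨h1, h2⟩ := hb q hq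
    have e1 := (hθd _ h2.1 _ h2.2)
    have e2 : HasDerivAt (fun t : ℝ => t - τ (p + ι q.1)) 1 q.2 :=
      (hasDerivAt_id q.2).sub_const _
    have e3 := e1.scomp q.2 e2
    have e4 : HasDerivAt (fun t : ℝ => (q.1, t)) ((0 : Coord k), (1 : ℝ)) q.2 :=
      (hasDerivAt_const q.2 q.1).prodMk (hasDerivAt_id q.2)
    have e5 := (hΨs q hq).differentiableAt_infty.hasFDerivAt.comp_hasDerivAt q.2 e4
    have e6 := e5.unique e3
    rw [one_smul] at e6
    exact e6
  · rw [injective_iff_map_eq_zero]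
    intro w hw
    -- Applying `η` to `dΨ w = 0` kills the time component. What is left is `ι w.1`, because `θ(0,
    -- ·)` is the identity and `η p ∘ ι = 0`.
    have hw2 : w.2 = 0 := by
      rw [← hη 0 h0δ w]
      rw [hw, map_zero]
    have hBm : ((0 : ℝ), p) ∈ B := ⟨⟨by linarith, hε⟩, Metric.mem_ball_self hε⟩
    have dθ := (hθs _ hBm).differentiableAt_infty.hasFDerivAt
    have dx : HasFDerivAt (fun q : Coord k × ℝ => p + ι q.1)
        (ι.comp (ContinuousLinearMap.fst ℝ (Coord k) ℝ)) 0 :=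
      (ι.hasFDerivAt.comp (0 : Coord k × ℝ) hasFDerivAt_fst).const_add p
    have dτ : HasFDerivAt (fun q : Coord k × ℝ => τ (p + ι q.1))
        ((η p).comp (ι.comp (ContinuousLinearMap.fst ℝ (Coord k) ℝ))) 0 := by
      have hpe : p = p + ι (0 : Coord k × ℝ).1 := by simp
      have := hτη p hpr
      rw [hpe] at this
      have := this.comp (0 : Coord k × ℝ) dx
      rwa [← hpe] at this
    have dc : HasFDerivAt c _ 0 := ((hasFDerivAt_snd (𝕜 := ℝ)).sub dτ).prodMk dx
    have dΨ := (hc0.symm ▸ dθ : HasFDerivAt θ _ (c 0)).comp (0 : Coord k × ℝ) dc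
    have e1 : fderiv ℝ (θ ∘ c) 0 w = fderiv ℝ θ (0, p) (w.2 - η p (ι w.1), ι w.1) := by
      rw [dΨ.fderiv, hc0]
      rfl
    have e2 : fderiv ℝ (θ ∘ c) 0 w = 0 := hw
    have e3 : fderiv ℝ θ (0, p) (0, ι w.1) = 0 := by
      rw [← e2, e1, hw2, hηι, sub_zero]
    have e4 : HasFDerivAt (fun x : Coord (k + 1) => θ (0, x)) ((fderiv ℝ θ (0, p)).comp
        (ContinuousLinearMap.inr ℝ ℝ (Coord (k + 1)))) p :=
      dθ.comp p (hasFDerivAt_prodMk_right (0 : ℝ) p)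
    have e5 : fderiv ℝ (fun x : Coord (k + 1) => θ (0, x)) p = fderiv ℝ (fun x => x) p :=
      fderiv_eq_of_eqOn Metric.isOpen_ball (fun x hx => hθ0 x hx) (Metric.mem_ball_self hε)
    rw [e4.fderiv] at e5
    have e6 := congrArg (fun L => L (ι w.1)) e5
    simp only [ContinuousLinearMap.comp_apply, ContinuousLinearMap.inr_apply, fderiv_fun_id,
      ContinuousLinearMap.id_apply] at e6
    rw [e3] at e6
    have hw1 : w.1 = 0 := hι (by rw [← e6, map_zero])
    exact Prod.ext hw1 hw2

end IsFCosymplecticOn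

end LocalProduct

/-! ### Adapted coordinates and the local splitting for `f = 0`. -/

section LocalProduct

variable {k : ℕ} {U : Set (Coord (k + 1))}
  {G : Coord (k + 1) → (Coord (k + 1) →L[ℝ] Coord (k + 1) →L[ℝ] ℝ)}
  {Φ : Coord (k + 1) → (Coord (k + 1) →L[ℝ] Coord (k + 1))} {ξ : Coord (k + 1) → Coord (k + 1)}
  {η : Coord (k + 1) → (Coord (k + 1) →L[ℝ] ℝ)} {f : Coord (k + 1) → ℝ} {p : Coord (k + 1)}

lemma ball_zero_prod (δ : ℝ) :
    Metric.ball (0 : Coord k × ℝ) δ = Metric.ball 0 δ ×ˢ Ioo (-δ) δ := by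
  rw [← Prod.mk_zero_zero, ← ball_prod_same, Real.ball_eq_Ioo, zero_sub, zero_add]

namespace IsFCosymplecticOn

/-- Coordinates in which the Reeb field is `∂/∂t` and the contact form is `dt`. -/
lemma exists_adapted_coordinates (h : IsFCosymplecticOn U G Φ ξ η f) (hp : p ∈ U) :
    ∃ δ > 0, ∃ P : OpenPartialHomeomorph (Coord k × ℝ) (Coord (k + 1)),
      P.source = Metric.ball 0 δ ×ˢ Ioo (-δ) δ ∧ p ∈ P.target ∧
      ContDiffOn ℝ ∞ P P.source ∧ ContDiffOn ℝ ∞ P.symm P.target ∧ MapsTo P P.source U ∧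
      (∀ q ∈ P.source, fderiv ℝ P q (0, 1) = ξ (P q)) ∧
      (∀ q ∈ P.source, ∀ w, η (P q) (fderiv ℝ P q w) = w.2) ∧
      ∀ q ∈ P.source, (fderiv ℝ P q).IsInvertible := by
  obtain ⟨δ, hδ, Ψ, hΨ0, hΨ, hΨU, hΨξ, hΨη, hinj⟩ := h.exists_adapted_map hp
  have h0 : (0 : Coord k × ℝ) ∈ Metric.ball 0 δ := Metric.mem_ball_self hδ
  have hc : ∀ q ∈ Metric.ball (0 : Coord k × ℝ) δ, ContDiffAt ℝ ∞ Ψ q := fun q hq =>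
    hΨ.contDiffAt (Metric.isOpen_ball.mem_nhds hq)
  have hrank : Module.finrank ℝ (Coord k × ℝ) = Module.finrank ℝ (Coord (k + 1)) := by
    simp
  let e : (Coord k × ℝ) ≃L[ℝ] Coord (k + 1) := (LinearEquiv.ofInjectiveOfFinrankEq
    (fderiv ℝ Ψ 0).toLinearMap hinj hrank).toContinuousLinearEquiv
  have he : (e : (Coord k × ℝ) →L[ℝ] Coord (k + 1)) = fderiv ℝ Ψ 0 :=
    ContinuousLinearMap.ext fun _ => rfl
  have hd : HasFDerivAt Ψ (e : (Coord k × ℝ) →L[ℝ] Coord (k + 1)) 0 := by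
    rw [he]
    exact (hc 0 h0).differentiableAt_infty.hasFDerivAt
  let P := (hc 0 h0).toOpenPartialHomeomorph Ψ hd (by simp)
  have hs0 : (0 : Coord k × ℝ) ∈ P.source := ContDiffAt.mem_toOpenPartialHomeomorph_source _ _ _
  have hinv : ∀ᶠ q in nhds (0 : Coord k × ℝ), fderiv ℝ Ψ q ∈
      range ((↑) : ((Coord k × ℝ) ≃L[ℝ] Coord (k + 1)) → _) := by
    refine (hc 0 h0).fderiv_infty.continuousAt.eventually_mem ?_
    rw [← he]
    exact ContinuousLinearEquiv.nhds _
  obtain ⟨δ', hδ', hb⟩ := Metric.eventually_nhds_iff_ball.1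
    ((hinv.and (P.open_source.mem_nhds hs0)).and (Metric.isOpen_ball.mem_nhds h0))
  let Q := P.restrOpen (Metric.ball 0 δ') Metric.isOpen_ball
  have hQ : ∀ q, Q q = Ψ q := fun q => rfl
  have hQ' : (Q : Coord k × ℝ → Coord (k + 1)) = Ψ := rfl
  have hQs : Q.source = Metric.ball 0 δ' := by
    rw [OpenPartialHomeomorph.restrOpen_source]
    exact inter_eq_right.2 fun q hq => (hb q hq).1.2
  refine ⟨δ', hδ', Q, by rw [hQs, ball_zero_prod], ?_, ?_, ?_, ?_, ?_, ?_, ?_⟩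
  · have := Q.map_source (x := 0) (by rw [hQs]; exact Metric.mem_ball_self hδ')
    rwa [hQ, hΨ0] at this
  · intro q hq
    rw [hQs] at hq
    exact (hc q (hb q hq).2).contDiffWithinAt
  · intro y hy
    have hq := Q.map_target hy
    rw [hQs] at hq
    obtain ⟨e', he'⟩ := (hb _ hq).1.1
    refine (Q.contDiffAt_symm hy (f₀' := e') ?_ (hc _ (hb _ hq).2)).contDiffWithinAt
    rw [he']
    exact (hc _ (hb _ hq).2).differentiableAt_infty.hasFDerivAt
  · intro q hq
    rw [hQs] at hq
    exact hΨU (hb q hq).2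
  · intro q hq
    rw [hQs] at hq
    exact hΨξ q (hb q hq).2
  · intro q hq
    rw [hQs] at hq
    exact hΨη q (hb q hq).2
  · intro q hq
    rw [hQs] at hq
    obtain ⟨e', he'⟩ := (hb _ hq).1.1
    exact ⟨e', he'⟩

/-- If `f = 0`, then locally the structure is the product of a Kähler structure and an
interval. -/
theorem exists_kahler_product (h : IsFCosymplecticOn U G Φ ξ η f) (hf : ∀ y ∈ U, f y = 0)
    (hp : p ∈ U) :
    ∃ (V : Set (Coord k)) (G' : Coord k → (Coord k →L[ℝ] Coord k →L[ℝ] ℝ))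
      (J : Coord k → (Coord k →L[ℝ] Coord k)) (a b : ℝ)
      (P : OpenPartialHomeomorph (Coord k × ℝ) (Coord (k + 1))),
      IsKahler V G' J ∧ P.source = V ×ˢ Ioo a b ∧ p ∈ P.target ∧
      ContDiffOn ℝ ∞ P P.source ∧ ContDiffOn ℝ ∞ P.symm P.target ∧ MapsTo P P.source U ∧
      ∀ q ∈ P.source, (∀ (u v : Coord k) (s t : ℝ),
        G (P q) (fderiv ℝ P q (u, s)) (fderiv ℝ P q (v, t)) = G' q.1 u v + s * t) ∧
        fderiv ℝ P q (0, 1) = ξ (P q) ∧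
        ∀ (u : Coord k) (s : ℝ), Φ (P q) (fderiv ℝ P q (u, s)) = fderiv ℝ P q (J q.1 u, 0) := by
  obtain ⟨δ, hδ, P, hPs, hpP, hP, hPsymm, hPU, hPξ, hPη, hPi⟩ := h.exists_adapted_coordinates hp
  have hc : ∀ q ∈ P.source, ContDiffAt ℝ ∞ P q := fun q hq =>
    hP.contDiffAt (P.open_source.mem_nhds hq)
  have hdP : ∀ q ∈ P.source, ∀ w, ContDiffAt ℝ ∞ (fun x => fderiv ℝ P x w) q := fun q hq w =>
    (hc q hq).fderiv_infty.clm_apply contDiffAt_const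
  have hG := h.metric
  have h0δ : (0 : ℝ) ∈ Ioo (-δ) δ := ⟨by linarith, hδ⟩
  have hmem : ∀ z ∈ Metric.ball (0 : Coord k) δ, ∀ t ∈ Ioo (-δ) δ, (z, t) ∈ P.source :=
    fun z hz t ht => by
      rw [hPs]
      exact ⟨hz, ht⟩
  -- Symmetry of mixed derivatives: a coordinate field `dP(u, 0)` is invariant under the flow of `ξ
  -- = dP(0, 1)`.
  have hinv : ∀ u : Coord k, ∀ q ∈ P.source,
      fderiv ℝ (fun x => fderiv ℝ P x (u, 0)) q (0, 1)
        = fderiv ℝ ξ (P q) (fderiv ℝ P q (u, 0)) := by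
    intro u q hq
    rw [fderiv_clm_apply_const (hc q hq).fderiv_infty, (hc q hq).fderiv_fderiv_comm,
      ← fderiv_clm_apply_const (hc q hq).fderiv_infty,
      fderiv_eq_of_eqOn P.open_source (fun x hx => hPξ x hx) hq]
    exact congrArg (fun L => L (u, (0 : ℝ))) (fderiv_comp q
      (h.contDiffAt_ξ (hPU hq)).differentiableAt_infty (hc q hq).differentiableAt_infty)
  -- For `f = 0` the field `ξ` is Killing, so inner products of flow-invariant fields do not depend
  -- on `t`.
  have hconst : ∀ X Y : Coord k × ℝ → Coord (k + 1),
      (∀ q ∈ P.source, ContDiffAt ℝ ∞ X q) → (∀ q ∈ P.source, ContDiffAt ℝ ∞ Y q) →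
      (∀ q ∈ P.source, fderiv ℝ X q (0, 1) = fderiv ℝ ξ (P q) (X q)) →
      (∀ q ∈ P.source, fderiv ℝ Y q (0, 1) = fderiv ℝ ξ (P q) (Y q)) →
      ∀ z ∈ Metric.ball (0 : Coord k) δ, ∀ t ∈ Ioo (-δ) δ,
        G (P (z, t)) (X (z, t)) (Y (z, t)) = G (P (z, 0)) (X (z, 0)) (Y (z, 0)) := by
    intro X Y hX hY hXξ hYξ z hz t ht
    refine eq_of_fderiv_snd_eq_zero (A := fun q => G (P q) (X q) (Y q)) (a := -δ) (b := δ)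
      (fun s hs => ?_) (fun s hs => ?_) ht h0δ
    · have hq := hmem z hz s hs
      have h1 : ContDiffAt ℝ ∞ (fun q => G (P q)) (z, s) :=
        (hG.contDiffAt (hPU hq)).comp (z, s) (hc _ hq)
      exact ((h1.clm_apply (hX _ hq)).clm_apply (hY _ hq)).differentiableAt_infty
    · have hq := hmem z hz s hs
      rw [fderiv_bilin_comp_apply (hG.contDiffAt (hPU hq)) (hc _ hq) (hX _ hq) (hY _ hq),
        hPξ _ hq, hXξ _ hq, hYξ _ hq, h.lieDeriv_metric (hPU hq), hf _ (hPU hq)]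
      ring
  let σ : Coord k → Coord (k + 1) := fun z => P (z, 0)
  have hι : ∀ z : Coord k, HasFDerivAt (fun z : Coord k => (z, (0 : ℝ)))
      (ContinuousLinearMap.inl ℝ (Coord k) ℝ) z := fun z => hasFDerivAt_prodMk_left z 0
  have hιs : ContDiff ℝ ∞ (fun z : Coord k => (z, (0 : ℝ))) := contDiff_id.prodMk contDiff_const
  have hdσ : ∀ z ∈ Metric.ball (0 : Coord k) δ, ∀ u, fderiv ℝ σ z u = fderiv ℝ P (z, 0) (u, 0) := by
    intro z hz u
    have := (hc _ (hmem z hz 0 h0δ)).differentiableAt_infty.hasFDerivAt.comp z (hι z)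
    exact congrArg (fun L => L u) this.fderiv
  -- `J` is `Φ` on the slice `t = 0`. Taking the first component loses nothing there, because `η ∘ Φ
  -- = 0` makes the time component vanish.
  let J : Coord k → (Coord k →L[ℝ] Coord k) := fun z =>
    (ContinuousLinearMap.fst ℝ (Coord k) ℝ).comp ((fderiv ℝ P (z, 0)).inverse.comp
      ((Φ (P (z, 0))).comp ((fderiv ℝ P (z, 0)).comp (ContinuousLinearMap.inl ℝ (Coord k) ℝ))))
  have hJ0 : ∀ z ∈ Metric.ball (0 : Coord k) δ, ∀ u,
      Φ (P (z, 0)) (fderiv ℝ P (z, 0) (u, 0)) = fderiv ℝ P (z, 0) (J z u, 0) := by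
    intro z hz u
    have hq := hmem z hz 0 h0δ
    set w := (fderiv ℝ P (z, 0)).inverse (Φ (P (z, 0)) (fderiv ℝ P (z, 0) (u, 0))) with hw
    have e1 : fderiv ℝ P (z, 0) w = Φ (P (z, 0)) (fderiv ℝ P (z, 0) (u, 0)) :=
      (hPi _ hq).self_apply_inverse _
    have e2 : w.2 = 0 := by
      rw [← hPη _ hq w, e1, h.η_Φ _ (hPU hq)]
    have e3 : J z u = w.1 := rfl
    rw [e3, ← e1, ← e2]
  have hJ : ∀ z ∈ Metric.ball (0 : Coord k) δ, ∀ t ∈ Ioo (-δ) δ, ∀ u,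
      Φ (P (z, t)) (fderiv ℝ P (z, t) (u, 0)) = fderiv ℝ P (z, t) (J z u, 0) := by
    intro z hz t ht u
    -- The defect `X` is flow-invariant since `L_ξ Φ = 0`. Its length is therefore constant in `t`,
    -- and it is zero at `t = 0`.
    let X : Coord k × ℝ → Coord (k + 1) := fun q =>
      Φ (P q) (fderiv ℝ P q (u, 0)) - fderiv ℝ P q (J z u, 0)
    have hΦ1 : ∀ q ∈ P.source, ContDiffAt ℝ ∞ (fun q => Φ (P q) (fderiv ℝ P q (u, 0))) q := by
      intro q hq
      have h1 : ContDiffAt ℝ ∞ (fun q => Φ (P q)) q :=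
        (h.contDiffAt_Φ (hPU hq)).comp q (hc _ hq)
      exact h1.clm_apply (hdP q hq _)
    have hX : ∀ q ∈ P.source, ContDiffAt ℝ ∞ X q := fun q hq => (hΦ1 q hq).sub (hdP q hq _)
    have hXξ : ∀ q ∈ P.source, fderiv ℝ X q (0, 1) = fderiv ℝ ξ (P q) (X q) := by
      intro q hq
      have e1 : fderiv ℝ X q = fderiv ℝ (fun q => Φ (P q) (fderiv ℝ P q (u, 0))) q
          - fderiv ℝ (fun q => fderiv ℝ P q (J z u, 0)) q :=
        fderiv_fun_sub (hΦ1 q hq).differentiableAt_infty (hdP q hq _).differentiableAt_infty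
      rw [e1, sub_apply, hinv _ q hq, fderiv_clm_comp_apply (h.contDiffAt_Φ (hPU hq)) (hc q hq)
        (hdP q hq _), hinv _ q hq, hPξ q hq, h.lieDeriv_Φ (hPU hq), map_sub]
      abel
    have h0 : X (z, 0) = 0 := sub_eq_zero.2 (hJ0 z hz u)
    have h1 := hconst X X hX hX hXξ hXξ z hz t ht
    rw [h0, map_zero] at h1
    by_contra hne
    exact (hG.pos _ (hPU (hmem z hz t ht)) (X (z, t)) (sub_ne_zero.2 hne)).ne' h1
  have hσU : MapsTo σ (Metric.ball 0 δ) U := fun z hz => hPU (hmem z hz 0 h0δ)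
  refine ⟨Metric.ball 0 δ, pullBilin σ G, J, -δ, δ, P, ?_, hPs, hpP, hP, hPsymm, hPU, ?_⟩
  · refine h.isKahler_pullBilin hf Metric.isOpen_ball ?_ hσU ?_ ?_ ?_ ?_
    · intro z hz
      exact ((hc _ (hmem z hz 0 h0δ)).comp z hιs.contDiffAt).contDiffWithinAt
    · intro z hz
      have hq := hmem z hz 0 h0δ
      have d1 : ContDiffAt ℝ ∞ (fun z : Coord k => fderiv ℝ P (z, 0)) z :=
        (hc _ hq).fderiv_infty.comp z hιs.contDiffAt
      have d2 : ContDiffAt ℝ ∞ (fun z : Coord k => (fderiv ℝ P (z, 0)).inverse) z :=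
        ContDiffAt.comp (g := ContinuousLinearMap.inverse) z (hPi _ hq).contDiffAt_map_inverse d1
      have d3 : ContDiffAt ℝ ∞ (fun z : Coord k => Φ (P (z, 0))) z :=
        (h.contDiffAt_Φ (hPU hq)).comp z ((hc _ hq).comp z hιs.contDiffAt)
      exact (contDiffAt_const.clm_comp (d2.clm_comp (d3.clm_comp
        (d1.clm_comp contDiffAt_const)))).contDiffWithinAt
    · intro z hz u v huv
      rw [hdσ z hz, hdσ z hz] at huv
      obtain ⟨e, he⟩ := hPi _ (hmem z hz 0 h0δ)
      rw [← he] at huv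
      exact congrArg Prod.fst (e.injective huv)
    · intro z hz u
      rw [hdσ z hz]
      exact hPη _ (hmem z hz 0 h0δ) _
    · intro z hz u
      rw [hdσ z hz, hdσ z hz]
      exact hJ0 z hz u
  · rintro ⟨z, t⟩ hq
    have hzt := hq
    rw [hPs] at hzt
    obtain ⟨hz, ht⟩ := hzt
    have hsplit : ∀ (u : Coord k) (s : ℝ), fderiv ℝ P (z, t) (u, s)
        = fderiv ℝ P (z, t) (u, 0) + s • ξ (P (z, t)) := by
      intro u s
      rw [← hPξ _ hq, ← map_smul, ← map_add]
      simp
    have hor : ∀ u : Coord k, G (P (z, t)) (fderiv ℝ P (z, t) (u, 0)) (ξ (P (z, t))) = 0 := by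
      intro u
      rw [h.metric_ξ (hPU hq), hPη _ hq]
    refine ⟨fun u v s r => ?_, hPξ _ hq, fun u s => ?_⟩
    · have e1 := hconst _ _ (fun q hq => hdP q hq (u, 0)) (fun q hq => hdP q hq (v, 0))
        (hinv u) (hinv v) z hz t ht
      rw [pullBilin_apply, hdσ z hz, hdσ z hz, ← e1, hsplit u s, hsplit v r]
      simp only [map_add, map_smul, add_apply, smul_apply, smul_eq_mul, hor]
      rw [hG.symm _ (hPU hq) (ξ _), hor, h.metric_ξ (hPU hq), h.η_ξ _ (hPU hq)]
      ring
    · rw [hsplit, map_add, map_smul, h.Φ_ξ _ (hPU hq), smul_zero, add_zero]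
      exact hJ z hz t ht u

end IsFCosymplecticOn

end LocalProduct

/-! ## Tensor fields in a chart -/

section ChartCalculus

variable {m : ℕ} {M : Type*} [TopologicalSpace M] [ChartedSpace (Coord m) M]
  [IsManifold 𝓘(ℝ, Coord m) ∞ M] {e : OpenPartialHomeomorph M (Coord m)} {y : Coord m}

lemma isManifold_one : IsManifold 𝓘(ℝ, Coord m) 1 M :=
  IsManifold.of_le (n := ∞) (by simp)

lemma coframe_frame (he : e ∈ atlas (Coord m) M) (hy : y ∈ e.target) (v : Coord m) :
    coframe e y (frame e y v) = v := by
  have := isManifold_one (m := m) (M := M)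
  exact congrArg (fun L => L v)
    ((mdifferentiable_of_mem_atlas (I := 𝓘(ℝ, Coord m)) he).comp_symm_deriv hy)

lemma frame_coframe (he : e ∈ atlas (Coord m) M) (hy : y ∈ e.target)
    (w : TangentSpace 𝓘(ℝ, Coord m) (e.symm y)) : frame e y (coframe e y w) = w := by
  have := isManifold_one (m := m) (M := M)
  have h := (mdifferentiable_of_mem_atlas (I := 𝓘(ℝ, Coord m)) he).symm_comp_deriv
    (e.map_target hy)
  rw [e.right_inv hy] at h
  exact congrArg (fun L => L w) h

lemma contMDiffOn_chart_symm (he : e ∈ atlas (Coord m) M) :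
    ContMDiffOn 𝓘(ℝ, Coord m) 𝓘(ℝ, Coord m) ∞ e.symm e.target :=
  contMDiffOn_symm_of_mem_maximalAtlas (IsManifold.subset_maximalAtlas he)

lemma contMDiffAt_chart_symm (he : e ∈ atlas (Coord m) M) (hy : y ∈ e.target) :
    ContMDiffAt 𝓘(ℝ, Coord m) 𝓘(ℝ, Coord m) ∞ e.symm y :=
  (contMDiffOn_chart_symm he).contMDiffAt (e.open_target.mem_nhds hy)

/-- The frame field is the tangent map of `e.symm` applied to a constant section. Smoothness of all
components in a chart is deduced from it. -/
lemma contMDiffAt_frame (he : e ∈ atlas (Coord m) M) (hy : y ∈ e.target) (v : Coord m) :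
    ContMDiffAt 𝓘(ℝ, Coord m) (𝓘(ℝ, Coord m).prod 𝓘(ℝ, Coord m)) ∞
      (fun z => TotalSpace.mk' (Coord m) (E := fun x : M => TangentSpace 𝓘(ℝ, Coord m) x)
        (e.symm z) (frame e z v)) y := by
  have := isManifold_one (m := m) (M := M)
  have h1 := (contMDiffOn_chart_symm he).contMDiffOn_tangentMapWithin (m := ∞) (by simp)
    e.open_target.uniqueMDiffOn
  have h2 : ContMDiffAt 𝓘(ℝ, Coord m) (𝓘(ℝ, Coord m).prod 𝓘(ℝ, Coord m)) ∞
      (fun z : Coord m => TotalSpace.mk' (Coord m)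
        (E := fun x : Coord m => TangentSpace 𝓘(ℝ, Coord m) x) z v) y :=
    contMDiffAt_vectorSpace_iff_contDiffAt.2 contDiffAt_const
  have h3 := (h1.contMDiffAt (x := TotalSpace.mk' (Coord m)
    (E := fun x : Coord m => TangentSpace 𝓘(ℝ, Coord m) x) y v) (by
      refine (e.open_target.preimage ?_).mem_nhds hy
      exact FiberBundle.continuous_proj (Coord m) _)).comp y h2
  refine h3.congr_of_eventuallyEq ?_
  filter_upwards [e.open_target.mem_nhds hy] with z hz
  have : mfderivWithin 𝓘(ℝ, Coord m) 𝓘(ℝ, Coord m) e.symm e.target z = frame e z :=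
    mfderivWithin_of_isOpen e.open_target hz
  change _ = TotalSpace.mk' (Coord m) (E := fun x : M => TangentSpace 𝓘(ℝ, Coord m) x) (e.symm z)
    (mfderivWithin 𝓘(ℝ, Coord m) 𝓘(ℝ, Coord m) e.symm e.target z v)
  rw [this]
  rfl

lemma fderiv_comp_chart_symm {h : M → ℝ} (hh : ContMDiff 𝓘(ℝ, Coord m) 𝓘(ℝ, ℝ) ∞ h)
    (he : e ∈ atlas (Coord m) M) (hy : y ∈ e.target) (v : Coord m) :
    fderiv ℝ (fun z => h (e.symm z)) y v = mvfderiv 𝓘(ℝ, Coord m) h (e.symm y) (frame e y v) := by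
  have h1 := mvfderiv_comp_apply (I := 𝓘(ℝ, Coord m)) (I' := 𝓘(ℝ, Coord m)) (g := h) (f := e.symm) y
    (hh.mdifferentiable (by simp) _) ((contMDiffAt_chart_symm he hy).mdifferentiableAt (by simp)) v
  rw [← mfderiv_eq_fderiv]
  exact h1

lemma contDiffOn_comp_chart_symm {h : M → ℝ} (hh : ContMDiff 𝓘(ℝ, Coord m) 𝓘(ℝ, ℝ) ∞ h)
    (he : e ∈ atlas (Coord m) M) : ContDiffOn ℝ ∞ (fun z => h (e.symm z)) e.target :=
  (hh.comp_contMDiffOn (contMDiffOn_chart_symm he)).contDiffOn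

omit [IsManifold 𝓘(ℝ, Coord m) ∞ M] in
lemma chartBilin_apply
    (g : ∀ x : M, TangentSpace 𝓘(ℝ, Coord m) x →L[ℝ] TangentSpace 𝓘(ℝ, Coord m) x →L[ℝ] ℝ)
    (u v : Coord m) :
    chartBilin e g y u v = g (e.symm y) (frame e y u) (frame e y v) := rfl

omit [IsManifold 𝓘(ℝ, Coord m) ∞ M] in
lemma contDiffAt_real_of_section {b : Coord m → M} {a : Coord m → ℝ}
    (h : ContMDiffAt 𝓘(ℝ, Coord m) (𝓘(ℝ, Coord m).prod 𝓘(ℝ, ℝ)) ∞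
      (fun z => TotalSpace.mk' ℝ (E := Bundle.Trivial M ℝ) (b z) (a z)) y) :
    ContDiffAt ℝ ∞ a y := by
  rw [contMDiffAt_totalSpace] at h
  exact h.2.contDiffAt

lemma contMDiffAt_metric_apply (g : Metric m M) {b : Coord m → M}
    {v w : ∀ z, TangentSpace 𝓘(ℝ, Coord m) (b z)}
    (hb : ContMDiffAt 𝓘(ℝ, Coord m) 𝓘(ℝ, Coord m) ∞ b y)
    (hv : ContMDiffAt 𝓘(ℝ, Coord m) (𝓘(ℝ, Coord m).prod 𝓘(ℝ, Coord m)) ∞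
      (fun z => TotalSpace.mk' (Coord m) (E := fun x : M => TangentSpace 𝓘(ℝ, Coord m) x)
        (b z) (v z)) y)
    (hw : ContMDiffAt 𝓘(ℝ, Coord m) (𝓘(ℝ, Coord m).prod 𝓘(ℝ, Coord m)) ∞
      (fun z => TotalSpace.mk' (Coord m) (E := fun x : M => TangentSpace 𝓘(ℝ, Coord m) x)
        (b z) (w z)) y) : ContDiffAt ℝ ∞ (fun z => g.inner (b z) (v z) (w z)) y := by
  refine contDiffAt_real_of_section (b := b) ?_
  apply ContMDiffAt.clm_bundle_apply₂ (F₁ := Coord m) (F₂ := Coord m)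
  · exact g.contMDiff.contMDiffAt.comp y hb
  · exact hv
  · exact hw

lemma contDiffAt_chartBilin_apply (g : Metric m M) (he : e ∈ atlas (Coord m) M)
    (hy : y ∈ e.target) (u v : Coord m) :
    ContDiffAt ℝ ∞ (fun z => chartBilin e g.inner z u v) y :=
  contMDiffAt_metric_apply g (v := fun z => frame e z u) (w := fun z => frame e z v)
    (contMDiffAt_chart_symm he hy) (contMDiffAt_frame he hy u) (contMDiffAt_frame he hy v)

lemma isMetricOn_chartBilin (g : Metric m M) (he : e ∈ atlas (Coord m) M) :
    IsMetricOn e.target (chartBilin e g.inner) := by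
  refine ⟨e.open_target, fun y hy => ?_, fun y _ u v => ?_, fun y hy u hu => ?_⟩
  · exact (contDiffAt_clm_of_apply fun u => contDiffAt_clm_of_apply fun v =>
      contDiffAt_chartBilin_apply g he hy u v).contDiffWithinAt
  · rw [chartBilin_apply, chartBilin_apply, g.symm]
  · rw [chartBilin_apply]
    refine g.pos _ _ fun h0 => hu ?_
    rw [← coframe_frame he hy u]
    exact (congrArg (coframe e y) h0).trans (map_zero _)

/-- `Z = G⁻¹(G(Z, ·))`: smoothness can be tested after lowering the index, which turns vector-valued
components into scalar ones. -/
lemma IsMetricOn.contDiffAt_of_apply {U : Set (Coord m)}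
    {G : Coord m → (Coord m →L[ℝ] Coord m →L[ℝ] ℝ)} (hG : IsMetricOn U G) (hy : y ∈ U)
    {Z : Coord m → Coord m} (hZ : ∀ v, ContDiffAt ℝ ∞ (fun z => G z (Z z) v) y) :
    ContDiffAt ℝ ∞ Z y := by
  have h1 : ContDiffAt ℝ ∞ (fun z => G z (Z z)) y := contDiffAt_clm_of_apply hZ
  have h2 : ContDiffAt ℝ ∞ (fun z => (G z).inverse) y :=
    ((hG.isInvertible hy).contDiffAt_map_inverse).comp y (hG.contDiffAt hy)
  refine (h2.clm_apply h1).congr_of_eventuallyEq ?_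
  filter_upwards [hG.isOpen.mem_nhds hy] with z hz
  exact ((hG.isInvertible hz).inverse_apply_self (Z z)).symm

end ChartCalculus

/-! ### The contact structure and the soliton equation read in a chart. -/

section ChartStructure

variable {m : ℕ} {M : Type*} [TopologicalSpace M] [ChartedSpace (Coord m) M]
  [IsManifold 𝓘(ℝ, Coord m) ∞ M] {e : OpenPartialHomeomorph M (Coord m)}
  {S : AlmostContactMetric m M} {f : M → ℝ}

lemma AlmostContactMetric.metric_ξ (S : AlmostContactMetric m M) (x : M)
    (v : TangentSpace 𝓘(ℝ, Coord m) x) : S.g.inner x (S.ξ x) v = S.η x v := by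
  have := S.g_φ x (S.ξ x) v
  rw [S.φ_ξ, S.η_ξ, map_zero, one_mul] at this
  exact (sub_eq_zero.1 (by simpa using this.symm))

/-- In a chart, an `f`-cosymplectic structure is an `f`-cosymplectic structure on an open set. -/
theorem IsFCosymplectic.isFCosymplecticOn (hS : IsFCosymplectic S f)
    (he : e ∈ atlas (Coord m) M) :
    IsFCosymplecticOn e.target (chartBilin e S.g.inner) (chartEnd e S.φ) (chartVec e S.ξ)
      (chartForm e S.η) (fun y => f (e.symm y)) := by
  have hG := isMetricOn_chartBilin S.g he
  have hη : ∀ y ∈ e.target, ContDiffAt ℝ ∞ (chartForm e S.η) y := fun y hy =>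
    contDiffAt_clm_of_apply fun v => contDiffAt_real_of_section (b := e.symm) (by
      apply ContMDiffAt.clm_bundle_apply (F₁ := Coord m) (F₂ := ℝ)
      · exact S.smooth_η.contMDiffAt.comp y (contMDiffAt_chart_symm he hy)
      · exact contMDiffAt_frame he hy v)
  refine ⟨hG, ?_, ?_, fun y hy => (hη y hy).contDiffWithinAt,
    contDiffOn_comp_chart_symm hS.smooth_f he, ?_, ?_, ?_, ?_, ?_, ?_, hS.dη e he, hS.dω e he,
    hS.normal e he⟩
  · intro y hy
    refine (contDiffAt_clm_of_apply fun u => hG.contDiffAt_of_apply hy fun v => ?_).contDiffWithinAt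
    have h1 : ContDiffAt ℝ ∞ (fun z => S.g.inner (e.symm z) (S.φ (e.symm z) (frame e z u))
        (frame e z v)) y := by
      refine contMDiffAt_metric_apply S.g (contMDiffAt_chart_symm he hy) ?_
        (contMDiffAt_frame he hy v)
      apply ContMDiffAt.clm_bundle_apply (F₁ := Coord m) (F₂ := Coord m)
      · exact S.smooth_φ.contMDiffAt.comp y (contMDiffAt_chart_symm he hy)
      · exact contMDiffAt_frame he hy u
    refine h1.congr_of_eventuallyEq ?_
    filter_upwards [e.open_target.mem_nhds hy] with z hz
    rw [chartBilin_apply, chartEnd]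
    exact congrArg (fun w => S.g.inner (e.symm z) w (frame e z v)) (frame_coframe he hz _)
  · intro y hy
    refine (hG.contDiffAt_of_apply hy fun v => ?_).contDiffWithinAt
    refine ((hη y hy).clm_apply (contDiffAt_const (c := v))).congr_of_eventuallyEq ?_
    filter_upwards [e.open_target.mem_nhds hy] with z hz
    rw [chartBilin_apply, chartVec, frame_coframe he hz, S.metric_ξ]
    rfl
  · intro y hy v
    change coframe e y (S.φ (e.symm y) (frame e y (coframe e y (S.φ (e.symm y) (frame e y v)))))
      = -v + S.η (e.symm y) (frame e y v) • coframe e y (S.ξ (e.symm y))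
    rw [frame_coframe he hy, S.φ_sq, map_add, map_neg, map_smul, coframe_frame he hy]
  · intro y hy v
    change S.η (e.symm y) (frame e y (coframe e y (S.φ (e.symm y) (frame e y v)))) = 0
    rw [frame_coframe he hy, S.η_φ]
  · intro y hy
    change coframe e y (S.φ (e.symm y) (frame e y (coframe e y (S.ξ (e.symm y))))) = 0
    rw [frame_coframe he hy, S.φ_ξ, map_zero]
  · intro y hy
    change S.η (e.symm y) (frame e y (coframe e y (S.ξ (e.symm y)))) = 1
    rw [frame_coframe he hy, S.η_ξ]
  · intro y hy u v
    change S.g.inner (e.symm y) (frame e y (coframe e y (S.φ (e.symm y) (frame e y u))))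
      (frame e y (coframe e y (S.φ (e.symm y) (frame e y v)))) = _
    rw [frame_coframe he hy, frame_coframe he hy, S.g_φ]
    rfl
  · intro y hy u v
    rw [fderiv_comp_chart_symm hS.smooth_f he hy, fderiv_comp_chart_symm hS.smooth_f he hy]
    exact hS.df_wedge_η _ _ _

/-- The identity `(1/2) L_{grad F} G = Hess F`: metric compatibility rewrites `G(DZ, ·)` as a
derivative of `dF` plus Christoffel terms. -/
lemma half_lieDerivMetric_gradient {U : Set (Coord m)}
    {G : Coord m → (Coord m →L[ℝ] Coord m →L[ℝ] ℝ)} (hG : IsMetricOn U G) {F : Coord m → ℝ}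
    (hF : ContDiffOn ℝ ∞ F U) {Z : Coord m → Coord m}
    (hZ : ∀ y ∈ U, ∀ v, G y (Z y) v = fderiv ℝ F y v) {y : Coord m} (hy : y ∈ U) (u v : Coord m) :
    (1 / 2 : ℝ) * lieDerivMetric G Z y u v
      = fderiv ℝ (fderiv ℝ F) y u v - fderiv ℝ F y (chr G y u v) := by
  have hFc : ∀ y ∈ U, ContDiffAt ℝ ∞ F y := fun y hy => hF.contDiffAt (hG.isOpen.mem_nhds hy)
  have hZc : ContDiffAt ℝ ∞ Z y := hG.contDiffAt_of_apply hy fun w => by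
    refine ((hFc y hy).fderiv_infty.clm_apply (contDiffAt_const (c := w))).congr_of_eventuallyEq ?_
    filter_upwards [hG.isOpen.mem_nhds hy] with z hz using hZ z hz w
  have key : ∀ p w : Coord m, G y (fderiv ℝ Z y p) w = fderiv ℝ (fderiv ℝ F) y p w
      - G y (chr G y p (Z y)) w - G y (Z y) (chr G y p w) := by
    intro p w
    have e1 := hG.fderiv_metric_apply hy hZc p w
    have e2 : EqOn (fun z => G z w (Z z)) (fun z => fderiv ℝ F z w) U := fun z hz => by
      dsimp only
      rw [hG.symm z hz, hZ z hz]
    rw [fderiv_eq_of_eqOn hG.isOpen e2 hy, fderiv_clm_apply_const (hFc y hy).fderiv_infty,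
      hG.symm y hy _ (Z y), hG.symm y hy w, map_add, add_apply] at e1
    linarith
  rw [lieDerivMetric, hG.fderiv_apply_apply hy, hG.fderiv_metric hy, hG.symm y hy u
    (fderiv ℝ Z y v), key, key, (hFc y hy).fderiv_fderiv_comm v u, ← hZ y hy, hG.chr_symm hy v u,
    hG.chr_symm hy (Z y), hG.chr_symm hy (Z y), hG.symm y hy u]
  ring

/-- In a chart, a gradient Ricci soliton solves the soliton equation for the Hessian. -/
theorem isSolitonOn_chart {g : Metric m M} {F : M → ℝ}
    {V : ∀ x : M, TangentSpace 𝓘(ℝ, Coord m) x} {c : ℝ}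
    (hF : ContMDiff 𝓘(ℝ, Coord m) 𝓘(ℝ, ℝ) ∞ F) (hV : IsGradient g F V)
    (hc : IsRicciSoliton g V c) (he : e ∈ atlas (Coord m) M) :
    IsSolitonOn e.target (chartBilin e g.inner) (fun y => F (e.symm y)) c where
  smooth := contDiffOn_comp_chart_symm hF he
  eq y hy u v := by
    have hG := isMetricOn_chartBilin g he
    have hZ : ∀ y ∈ e.target, ∀ v, chartBilin e g.inner y (chartVec e V y) v
        = fderiv ℝ (fun z => F (e.symm z)) y v := by
      intro y hy v
      rw [chartBilin_apply, chartVec, frame_coframe he hy, hV, fderiv_comp_chart_symm hF he hy]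
    have h1 := hc e he y hy u v
    rw [half_lieDerivMetric_gradient hG (contDiffOn_comp_chart_symm hF he) hZ hy,
      hG.ricci_eq_trace hy] at h1
    exact sub_eq_zero.1 h1

end ChartStructure

/-! ## Global structure -/

section LocalConstancy

variable {m : ℕ} {U : Set (Coord m)} {G : Coord m → (Coord m →L[ℝ] Coord m →L[ℝ] ℝ)}
  {Φ : Coord m → (Coord m →L[ℝ] Coord m)} {ξ : Coord m → Coord m} {η : Coord m → (Coord m →L[ℝ] ℝ)}
  {f : Coord m → ℝ} {y : Coord m}

/-- With `c = 0` the equation `df = -f · (f η)` is linear in `f` with the locally bounded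
coefficient `A = f η`. Along segments from `y`, Grönwall's inequality propagates the zero. -/
lemma IsReebOn.eventually_eq_zero (h : IsReebOn U G ξ f 0) (hy : y ∈ U) (hf : f y = 0) :
    ∀ᶠ z in nhds y, f z = 0 := by
  have hG := h.metric
  have hU := hG.isOpen.mem_nhds hy
  let A : Coord m → (Coord m →L[ℝ] ℝ) := fun z => f z • G z (ξ z)
  have hA : ContinuousAt A y := by
    have h1 := (h.smooth_f.contDiffAt hU).continuousAt
    have h2 := ((hG.contDiffAt hy).clm_apply (h.smooth_ξ.contDiffAt hU)).continuousAt
    exact h1.smul h2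
  set C := ‖A y‖ + 1 with hC
  have hev : ∀ᶠ z in nhds y, z ∈ U ∧ ‖A z‖ < C :=
    (h.metric.isOpen.eventually_mem hy).and (hA.norm.eventually_lt continuousAt_const (by linarith))
  obtain ⟨δ, hδ, hb⟩ := Metric.eventually_nhds_iff_ball.1 hev
  filter_upwards [Metric.ball_mem_nhds y hδ] with z hz
  have hseg : ∀ t ∈ Icc (0 : ℝ) 1, y + t • (z - y) ∈ Metric.ball y δ := by
    intro t ht
    rw [mem_ball_iff_norm] at hz ⊢
    rw [add_sub_cancel_left, norm_smul, Real.norm_eq_abs, abs_of_nonneg ht.1]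
    exact (mul_le_of_le_one_left (norm_nonneg _) ht.2).trans_lt hz
  have hd : ∀ t ∈ Icc (0 : ℝ) 1, HasDerivAt (fun t : ℝ => f (y + t • (z - y)))
      (-(f (y + t • (z - y))) * A (y + t • (z - y)) (z - y)) t := by
    intro t ht
    have hm := (hb _ (hseg t ht)).1
    have h1 : HasDerivAt (fun t : ℝ => y + t • (z - y)) (z - y) t := by
      simpa using ((hasDerivAt_id t).smul_const (z - y)).const_add y
    have h2 := ((h.smooth_f.contDiffAt (hG.isOpen.mem_nhds hm)).differentiableAt_infty).hasFDerivAt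
      |>.comp_hasDerivAt t h1
    refine h2.congr_deriv ?_
    rw [h.fderiv_f _ hm, hG.symm _ hm]
    simp only [A, smul_apply, smul_eq_mul]
    ring
  have := eq_zero_of_abs_deriv_le_mul_abs_self_of_eq_zero_right (K := C * ‖z - y‖)
    (fun t ht => (hd t ht).continuousAt.continuousWithinAt)
    (fun t ht => (hd t (Ico_subset_Icc_self ht)).hasDerivWithinAt) (by simpa using hf)
    (fun t ht => by
      rw [norm_mul, norm_neg, mul_comm]
      refine mul_le_mul_of_nonneg_right (((A _).le_opNorm _).trans ?_) (norm_nonneg _)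
      exact mul_le_mul_of_nonneg_right (hb _ (hseg t (Ico_subset_Icc_self ht))).2.le
        (norm_nonneg _)) 1 (by norm_num)
  simpa using this

namespace IsFCosymplecticOn

variable (h : IsFCosymplecticOn U G Φ ξ η f)
include h

lemma contDiffAt_f (hy : y ∈ U) : ContDiffAt ℝ ∞ f y :=
  h.smooth_f.contDiffAt (h.metric.isOpen.mem_nhds hy)

lemma contDiffAt_reebDeriv (hy : y ∈ U) : ContDiffAt ℝ ∞ (fun z => fderiv ℝ f z (ξ z)) y :=
  (h.contDiffAt_f hy).fderiv_infty.clm_apply (h.contDiffAt_ξ hy)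

lemma fderiv_f (hy : y ∈ U) (w : Coord m) : fderiv ℝ f y w = fderiv ℝ f y (ξ y) * η y w := by
  have := h.df_wedge y hy w (ξ y)
  rw [h.η_ξ y hy] at this
  linarith

/-- Differentiating `df = ξ(f) η` and using `dη = 0` gives `d(ξ(f)) ∧ η = 0`. -/
lemma fderiv_reebDeriv (hy : y ∈ U) (w : Coord m) : fderiv ℝ (fun z => fderiv ℝ f z (ξ z)) y w
    = fderiv ℝ (fun z => fderiv ℝ f z (ξ z)) y (ξ y) * η y w := by
  have key : ∀ u v, fderiv ℝ (fderiv ℝ f) y u v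
      = fderiv ℝ (fun z => fderiv ℝ f z (ξ z)) y u * η y v
        + fderiv ℝ f y (ξ y) * fderiv ℝ η y u v := by
    intro u v
    rw [← fderiv_clm_apply_const (h.contDiffAt_f hy).fderiv_infty,
      fderiv_eq_of_eqOn h.metric.isOpen (fun z hz => h.fderiv_f hz v) hy,
      ← fderiv_clm_apply_const (h.contDiffAt_η hy),
      fderiv_fun_mul (h.contDiffAt_reebDeriv hy).differentiableAt_infty
        ((h.contDiffAt_η hy).clm_apply contDiffAt_const).differentiableAt_infty]
    simp only [add_apply, smul_apply, smul_eq_mul]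
    ring
  have h1 := (h.contDiffAt_f hy).fderiv_fderiv_comm w (ξ y)
  rw [key, key, h.fderiv_η_symm hy w, h.η_ξ y hy] at h1
  linarith

lemma fderiv_fTilde (hy : y ∈ U) (w : Coord m) :
    fderiv ℝ (fun z => fderiv ℝ f z (ξ z) + f z ^ 2) y w
      = fderiv ℝ (fun z => fderiv ℝ f z (ξ z) + f z ^ 2) y (ξ y) * η y w := by
  have h1 : ∀ w, fderiv ℝ (fun z => fderiv ℝ f z (ξ z) + f z ^ 2) y w
      = fderiv ℝ (fun z => fderiv ℝ f z (ξ z)) y w + 2 * f y * fderiv ℝ f y w := by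
    intro w
    rw [fderiv_fun_add (h.contDiffAt_reebDeriv hy).differentiableAt_infty
      ((h.contDiffAt_f hy).pow 2).differentiableAt_infty,
      fderiv_fun_pow 2 (h.contDiffAt_f hy).differentiableAt_infty]
    simp
  rw [h1, h1, h.fderiv_reebDeriv hy, h.fderiv_f hy]
  ring

end IsFCosymplecticOn

end LocalConstancy

lemma eventually_of_chart {X H : Type*} [TopologicalSpace X] [TopologicalSpace H]
    {e : OpenPartialHomeomorph X H} {x : X} {P : X → Prop} (hx : x ∈ e.source)
    (h : ∀ᶠ z in nhds (e x), P (e.symm z)) : ∀ᶠ x' in nhds x, P x' := by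
  filter_upwards [(e.continuousAt hx).eventually h, e.open_source.mem_nhds hx] with x' h1 h2
  rwa [e.left_inv h2] at h1

/-! ### Constancy of `ξ(f) + f²` and the alternative for `f`. -/

section Global

variable {m : ℕ} {M : Type*} [TopologicalSpace M] [ChartedSpace (Coord m) M]
  [IsManifold 𝓘(ℝ, Coord m) ∞ M] {S : AlmostContactMetric m M} {f : M → ℝ}
  {e : OpenPartialHomeomorph M (Coord m)} {y : Coord m}

lemma reebDeriv_chart {h : M → ℝ} (hh : ContMDiff 𝓘(ℝ, Coord m) 𝓘(ℝ, ℝ) ∞ h)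
    (he : e ∈ atlas (Coord m) M) (hy : y ∈ e.target) :
    S.reebDeriv h (e.symm y) = fderiv ℝ (fun z => h (e.symm z)) y (chartVec e S.ξ y) := by
  rw [fderiv_comp_chart_symm hh he hy, chartVec, frame_coframe he hy]
  rfl

lemma fTilde_chart (hS : IsFCosymplectic S f) (he : e ∈ atlas (Coord m) M) (hy : y ∈ e.target) :
    S.fTilde f (e.symm y)
      = fderiv ℝ (fun z => f (e.symm z)) y (chartVec e S.ξ y) + f (e.symm y) ^ 2 := by
  rw [AlmostContactMetric.fTilde, reebDeriv_chart hS.smooth_f he hy]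

lemma contMDiff_fTilde (hS : IsFCosymplectic S f) :
    ContMDiff 𝓘(ℝ, Coord m) 𝓘(ℝ, ℝ) ∞ (S.fTilde f) := by
  intro x
  let e := chartAt (Coord m) x
  have he : e ∈ atlas (Coord m) M := chart_mem_atlas (Coord m) x
  have hx : x ∈ e.source := mem_chart_source (Coord m) x
  have h := hS.isFCosymplecticOn he
  have hy := e.map_source hx
  have h1 := ((h.contDiffAt_reebDeriv hy).add ((h.contDiffAt_f hy).pow 2)).contMDiffAt
  have h2 : ContMDiffAt 𝓘(ℝ, Coord m) 𝓘(ℝ, Coord m) ∞ e x :=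
    (contMDiffOn_of_mem_maximalAtlas (IsManifold.subset_maximalAtlas he)).contMDiffAt
      (e.open_source.mem_nhds hx)
  refine (h1.comp x h2).congr_of_eventuallyEq ?_
  filter_upwards [e.open_source.mem_nhds hx] with z hz
  have := fTilde_chart hS he (e.map_source hz)
  rw [e.left_inv hz] at this
  rw [this]
  simp [e.left_inv hz]

/-- By `fderiv_fTilde` the differential is determined by its value on `ξ`, which is zero; local
constancy then spreads by connectedness. -/
lemma fTilde_eq [ConnectedSpace M] (hS : IsFCosymplectic S f)
    (hf : ∀ x, S.reebDeriv (S.fTilde f) x = 0) (x x' : M) : S.fTilde f x = S.fTilde f x' := by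
  refine IsLocallyConstant.apply_eq_of_preconnectedSpace ?_ x x'
  rw [IsLocallyConstant.iff_eventually_eq]
  intro x
  let e := chartAt (Coord m) x
  have he : e ∈ atlas (Coord m) M := chart_mem_atlas (Coord m) x
  have hx : x ∈ e.source := mem_chart_source (Coord m) x
  have h := hS.isFCosymplecticOn he
  refine eventually_of_chart hx ?_
  obtain ⟨r, hr, hb⟩ := Metric.isOpen_iff.1 e.open_target _ (e.map_source hx)
  have hd : ∀ z ∈ e.target, fderiv ℝ (fun z => S.fTilde f (e.symm z)) z = 0 := by
    intro z hz
    ext w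
    have e1 : fderiv ℝ (fun z => S.fTilde f (e.symm z)) z
        = fderiv ℝ (fun z => fderiv ℝ (fun z => f (e.symm z)) z (chartVec e S.ξ z)
          + f (e.symm z) ^ 2) z :=
      fderiv_eq_of_eqOn e.open_target (fun z hz => fTilde_chart hS he hz) hz
    have e2 := reebDeriv_chart (S := S) (contMDiff_fTilde hS) he hz
    rw [hf, e1] at e2
    rw [e1, h.fderiv_fTilde hz, ← e2, zero_mul]
    rfl
  have hdiff := contDiffOn_comp_chart_symm (contMDiff_fTilde hS) he
  filter_upwards [Metric.ball_mem_nhds (e x) hr] with z hz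
  have := Metric.isOpen_ball.is_const_of_fderiv_eq_zero (convex_ball (e x) r).isPreconnected
    ((hdiff.mono hb).differentiableOn (by simp)) (fun z hz => hd z (hb hz)) hz
    (Metric.mem_ball_self hr)
  rw [this, e.left_inv hx]

lemma isReebOn_chart (hS : IsFCosymplectic S f) {c : ℝ} (hc : ∀ x, S.fTilde f x = c)
    (he : e ∈ atlas (Coord m) M) :
    IsReebOn e.target (chartBilin e S.g.inner) (chartVec e S.ξ) (fun y => f (e.symm y)) c :=
  (hS.isFCosymplecticOn he).isReebOn fun y hy => by rw [← fTilde_chart hS he hy, hc]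

/-- If `ξ(f) + f² = 0`, then `f` vanishes identically or nowhere. -/
lemma eq_zero_or_ne_zero [ConnectedSpace M] (hS : IsFCosymplectic S f)
    (hc : ∀ x, S.fTilde f x = 0) : (∀ x, f x = 0) ∨ ∀ x, f x ≠ 0 := by
  by_contra! hcon
  obtain ⟨⟨x₁, h₁⟩, x₀, h₀⟩ := hcon
  have hclosed : IsClosed {x | f x = 0} := isClosed_eq hS.smooth_f.continuous continuous_const
  -- The zero set is closed by continuity and open by the Grönwall argument, so connectedness
  -- decides.
  have hopen : IsOpen {x | f x = 0} := by
    rw [isOpen_iff_mem_nhds]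
    intro x hx
    have hxs := mem_chart_source (Coord m) x
    have he := chart_mem_atlas (Coord m) x
    refine eventually_of_chart hxs ((isReebOn_chart hS hc he).eventually_eq_zero
      ((chartAt (Coord m) x).map_source hxs) ?_)
    rw [(chartAt (Coord m) x).left_inv hxs]
    exact hx
  have := (show IsClopen {x | f x = 0} from ⟨hclosed, hopen⟩).eq_univ ⟨x₀, h₀⟩
  exact h₁ (this ▸ mem_univ x₁ : x₁ ∈ {x | f x = 0})

lemma ricciEqSmul_of_soliton (hS : IsFCosymplectic S f) {c : ℝ} (hc : ∀ x, S.fTilde f x = c)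
    (hsol : IsGradientRicciSoliton S.g) (hm : 1 ≤ m) (hcf : ∀ x, c ≠ 0 ∨ f x ≠ 0) :
    RicciEqSmul S.g (fun _ => -(c * (m - 1))) := by
  intro e he y hy u v
  obtain ⟨F, V, r, hF, hV, hr⟩ := hsol
  rw [(isMetricOn_chartBilin S.g he).ricci_eq_trace hy]
  exact (isReebOn_chart hS hc he).ric_eq (isSolitonOn_chart hF hV hr he) hm hy (hcf _) u v

end Global

/-! ### The local product structure on the manifold. -/

section Product

variable {n : ℕ} {M : Type*} [TopologicalSpace M] [ChartedSpace (Coord (2 * n + 1)) M]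
  [IsManifold 𝓘(ℝ, Coord (2 * n + 1)) ∞ M] {S : AlmostContactMetric (2 * n + 1) M} {f : M → ℝ}

/-- A cosymplectic manifold is locally the product of a Kähler manifold and an interval. -/
theorem isLocallyKahlerProduct (hS : IsFCosymplectic S f) (hf : ∀ x, f x = 0) :
    IsLocallyKahlerProduct S := by
  intro p
  let e := chartAt (Coord (2 * n + 1)) p
  have he : e ∈ atlas (Coord (2 * n + 1)) M := chart_mem_atlas _ p
  have hp : p ∈ e.source := mem_chart_source _ p
  obtain ⟨V, G, J, a, b, P, hK, hs, hpP, hP, hPsymm, hPU, hprod⟩ :=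
    (hS.isFCosymplecticOn he).exists_kahler_product (fun y _ => hf _) (e.map_source hp)
  have hsrc : (P.trans e.symm).source = P.source := inter_eq_left.2 hPU
  refine ⟨V, G, J, a, b, P.trans e.symm, hK, hsrc.trans hs, ?_, ?_, ?_, ?_⟩
  · exact ⟨hp, hpP⟩
  · rw [hsrc]
    exact (contMDiffOn_chart_symm he).comp hP.contMDiffOn hPU
  · have h1 : ContMDiffOn 𝓘(ℝ, Coord (2 * n + 1)) 𝓘(ℝ, Coord (2 * n + 1)) ∞ e e.source :=
      contMDiffOn_of_mem_maximalAtlas (IsManifold.subset_maximalAtlas he)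
    exact hPsymm.contMDiffOn.comp (h1.mono inter_subset_left) fun x hx => hx.2
  · intro q hq
    rw [hsrc] at hq
    have hqU := hPU hq
    obtain ⟨h1, h2, h3⟩ := hprod q hq
    have hd : ∀ w : Coord (2 * n) × ℝ, mfderiv 𝓘(ℝ, Coord (2 * n) × ℝ) 𝓘(ℝ, Coord (2 * n + 1))
        (P.trans e.symm) q w = frame e (P q) (fderiv ℝ P q w) := by
      intro w
      have hc : MDifferentiableAt 𝓘(ℝ, Coord (2 * n) × ℝ) 𝓘(ℝ, Coord (2 * n + 1)) P q :=
        (hP.contDiffAt (P.open_source.mem_nhds hq)).differentiableAt_infty.mdifferentiableAt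
      have := mfderiv_comp_apply (I := 𝓘(ℝ, Coord (2 * n) × ℝ))
        (I' := 𝓘(ℝ, Coord (2 * n + 1))) (I'' := 𝓘(ℝ, Coord (2 * n + 1))) (g := e.symm) (f := P) q
        ((contMDiffAt_chart_symm he hqU).mdifferentiableAt (by simp)) hc w
      rw [mfderiv_eq_fderiv] at this
      exact this
    refine ⟨fun u v s t => ?_, ?_, fun u s => ?_⟩
    · rw [← h1 u v s t, hd, hd]
      rfl
    · rw [hd, h2]
      exact frame_coframe he hqU _
    · rw [hd, hd, ← h3 u s]
      exact (frame_coframe he hqU _).symm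

end Product

end FCosymplectic

end

theorem theoremT1 (n : ℕ) (M : Type*) [TopologicalSpace M] [T2Space M]
    [SecondCountableTopology M] [ConnectedSpace M]
    [ChartedSpace (FCosymplectic.Coord (2 * n + 1)) M]
    [IsManifold 𝓘(ℝ, FCosymplectic.Coord (2 * n + 1)) ∞ M]
    (S : FCosymplectic.AlmostContactMetric (2 * n + 1) M) (f : M → ℝ)
    (hS : FCosymplectic.IsFCosymplectic S f)
    (hsol : FCosymplectic.IsGradientRicciSoliton S.g)
    (hf : ∀ x, S.reebDeriv (S.fTilde f) x = 0) :
    ((∀ x, f x = 0) ∧ FCosymplectic.IsLocallyKahlerProduct S) ∨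
    (FCosymplectic.IsEinstein S.g ∧
      FCosymplectic.RicciEqSmul S.g (fun x => -2 * (n : ℝ) * S.fTilde f x)) := by
  obtain ⟨x₀⟩ := (inferInstance : Nonempty M)
  set c := S.fTilde f x₀ with hc₀
  have hc : ∀ x, S.fTilde f x = c := fun x => FCosymplectic.fTilde_eq hS hf x x₀
  have key : (∀ x, c ≠ 0 ∨ f x ≠ 0) → FCosymplectic.RicciEqSmul S.g (fun _ => -2 * (n : ℝ) * c) := by
    intro hcf
    have h1 := FCosymplectic.ricciEqSmul_of_soliton hS hc hsol (by omega) hcf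
    have h2 : -(c * (((2 * n + 1 : ℕ) : ℝ) - 1)) = -2 * (n : ℝ) * c := by
      push_cast
      ring
    rwa [h2] at h1
  have einstein : (∀ x, c ≠ 0 ∨ f x ≠ 0) → FCosymplectic.IsEinstein S.g ∧
      FCosymplectic.RicciEqSmul S.g (fun x => -2 * (n : ℝ) * S.fTilde f x) := fun hcf => by
    refine ⟨⟨_, key hcf⟩, ?_⟩
    simp only [hc]
    exact key hcf
  -- Only `c = 0` with `f` identically zero leads to the product; in every other case `c ≠ 0` or `f`
  -- has no zero, and the Einstein equation follows.
  rcases ne_or_eq c 0 with hne | h0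
  · exact Or.inr (einstein fun _ => Or.inl hne)
  · rcases FCosymplectic.eq_zero_or_ne_zero hS (fun x => (hc x).trans h0) with h | h
    · exact Or.inl ⟨h, FCosymplectic.isLocallyKahlerProduct hS h⟩
    · exact Or.inr (einstein fun x => Or.inr (h x))
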